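/- Let $N\ge 1$, let $V:\mathbb{R}^N\to[0,\infty)$ be smooth with $V(x)\to\infty$ as $|x|\to\infty$, and let $m>0$. Let $\lambda_0\in\mathbb{R}$ be the number with $\int_{\mathbb{R}^N}(\lambda_0-V)^+\,dx=m$, and put $\rho_{TF}:=(\lambda_0-V)^+$ and $\Omega_{TF}:=\{x\in\mathbb{R}^N:\rho_{TF}(x)>0\}$. For $\varepsilon>0$ let $$\mathcal{E}_{\varepsilon,V}(u)=\int_{\mathbb{R}^N}\frac{|\nabla u|^2}{2}+\frac{1}{2\varepsilon^2}\Big(V(x)|u|^2+\frac12|u|^4\Big)dx\in[0,\infty]$$ on $$\mathcal{H}_m=\Big\{u\in H^1(\mathbb{R}^N;\mathbb{C}):\int_{\mathbb{R}^N} V|u|^2<\infty,\ \int_{\mathbb{R}^N}|u|^2=m\Big\}.$$ Then there is a constant $C=C(N,m,V)$ such that for every $\varepsilon>0$, every positive minimizer $\eta\in\mathcal{H}_m$ of $\mathcal{E}_{\varepsilon,V}$ in $\mathcal{H}_m$ satisfies $$\|\eta^2-\rho_{TF}\|_{L^2(\mathbb{R}^N)}\le C\varepsilon^{2/3}.$$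 Moreover, for every $K\subset\subset\Omega_{TF}$ (that is, $\overline K$ is compact and contained in $\Omega_{TF}$) there is a constant $C=C(N,m,V,K)$ such that for every $\varepsilon>0$ and every positive minimizer $\eta$ of $\mathcal{E}_{\varepsilon,V}$ in $\mathcal{H}_m$, the function $\eta^2$ is weakly differentiable on $\mathbb{R}^N$ and $$\|\eta^2-\rho_{TF}\|_{L^\infty(K)}\le C\varepsilon^{2/3},\qquad \|\nabla(\eta^2)\|_{L^\infty(K)}\le C.$$ -/

import Mathlib

open MeasureTheory Filter
open scoped ENNReal ContDiff

noncomputable section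

/-- `G` is the weak gradient of `u` on `ℝ^N`: both are locally integrable and
`∫ u ∂ᵢφ = - ∫ Gᵢ φ` for every test function `φ ∈ C_c^∞(ℝ^N)` and every `i`. -/
structure HasWeakGradient {𝕜 : Type*} [RCLike 𝕜] {N : ℕ}
    (u : EuclideanSpace ℝ (Fin N) → 𝕜)
    (G : EuclideanSpace ℝ (Fin N) → EuclideanSpace 𝕜 (Fin N)) : Prop where
  locallyIntegrable : LocallyIntegrable u volume
  locallyIntegrable_grad : LocallyIntegrable G volume
  integral_eq : ∀ φ : EuclideanSpace ℝ (Fin N) → ℝ, ContDiff ℝ ∞ φ → HasCompactSupport φ →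
    ∀ i : Fin N, ∫ x, (fderiv ℝ φ x (EuclideanSpace.single i 1)) • u x = - ∫ x, φ x • G x i

/-- Weak gradients are unique up to null sets. -/
theorem HasWeakGradient.ae_eq {𝕜 : Type*} [RCLike 𝕜] {N : ℕ}
    {u : EuclideanSpace ℝ (Fin N) → 𝕜}
    {G H : EuclideanSpace ℝ (Fin N) → EuclideanSpace 𝕜 (Fin N)}
    (hG : HasWeakGradient u G) (hH : HasWeakGradient u H) : G =ᵐ[volume] H := by
  have key : ∀ i : Fin N, ∀ᵐ x, G x i = H x i := by
    intro i
    have hL : ∀ {F : EuclideanSpace ℝ (Fin N) → EuclideanSpace 𝕜 (Fin N)},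
        LocallyIntegrable F volume → LocallyIntegrable (fun x => F x i) volume := by
      intro F hF x
      obtain ⟨s, hs, hi⟩ := hF x
      exact ⟨s, hs, (EuclideanSpace.proj (𝕜 := 𝕜) i).integrable_comp hi⟩
    refine ae_eq_of_integral_contDiff_smul_eq (hL hG.2) (hL hH.2) ?_
    intro φ hφ hc
    exact neg_injective ((hG.3 φ hφ hc i).symm.trans (hH.3 φ hφ hc i))
  filter_upwards [ae_all_iff.2 key] with x hx
  ext i
  exact hx i

open Classical in
/-- The weak gradient `∇u`, well defined up to null sets (and `0` by convention if `u` has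
none). -/
def weakGradient {𝕜 : Type*} [RCLike 𝕜] {N : ℕ} (u : EuclideanSpace ℝ (Fin N) → 𝕜) :
    EuclideanSpace ℝ (Fin N) → EuclideanSpace 𝕜 (Fin N) :=
  if h : ∃ G, HasWeakGradient u G then h.choose else 0

/-- `u ∈ H¹(ℝ^N; ℂ)`: `u ∈ L²` has a weak gradient, and it is in `L²`. -/
def MemH1 {N : ℕ} (u : EuclideanSpace ℝ (Fin N) → ℂ) : Prop :=
  MemLp u 2 volume ∧ ∃ G, HasWeakGradient u G ∧ MemLp G 2 volume

/-- `u ∈ 𝓗_m`: `u ∈ H¹(ℝ^N; ℂ)`, `∫ V |u|² < ∞` and `∫ |u|² = m`. -/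
structure MemHm {N : ℕ} (V : EuclideanSpace ℝ (Fin N) → ℝ) (m : ℝ)
    (u : EuclideanSpace ℝ (Fin N) → ℂ) : Prop where
  memH1 : MemH1 u
  potential : Integrable (fun x => V x * ‖u x‖ ^ 2) volume
  mass : ∫ x, ‖u x‖ ^ 2 = m

/-- The Gross–Pitaevskii energy
`∫ |∇u|²/2 + 1/(2ε²) (V |u|² + |u|⁴/2)` of a potential `V ≥ 0`, with values in `[0, ∞]`. -/
def gpEnergy {N : ℕ} (ε : ℝ) (V : EuclideanSpace ℝ (Fin N) → ℝ)
    (u : EuclideanSpace ℝ (Fin N) → ℂ) : ℝ≥0∞ :=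
  ∫⁻ x, ENNReal.ofReal (‖weakGradient u x‖ ^ 2 / 2
    + 1 / (2 * ε ^ 2) * (V x * ‖u x‖ ^ 2 + 1 / 2 * ‖u x‖ ^ 4))

/-- `η` is a positive minimizer of the Gross–Pitaevskii energy in `𝓗_m`. -/
structure IsPositiveMinimizer {N : ℕ} (ε : ℝ) (V : EuclideanSpace ℝ (Fin N) → ℝ) (m : ℝ)
    (η : EuclideanSpace ℝ (Fin N) → ℝ) : Prop where
  pos : ∀ᵐ x, 0 < η x
  mem : MemHm V m (fun x => (η x : ℂ))
  le : ∀ u : EuclideanSpace ℝ (Fin N) → ℂ, MemHm V m u →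
    gpEnergy ε V (fun x => (η x : ℂ)) ≤ gpEnergy ε V u

/-- The Thomas–Fermi profile `(lam - V)⁺` at level `lam`. -/
def rhoTF {N : ℕ} (V : EuclideanSpace ℝ (Fin N) → ℝ) (lam : ℝ)
    (x : EuclideanSpace ℝ (Fin N)) : ℝ :=
  max (lam - V x) 0

/-- The Thomas–Fermi domain, on which the profile is positive. -/
def omegaTF {N : ℕ} (V : EuclideanSpace ℝ (Fin N) → ℝ) (lam : ℝ) :
    Set (EuclideanSpace ℝ (Fin N)) :=
  {x | 0 < rhoTF V lam x}

end

section
open Metric Set Topology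

/-! Write ρ for the Thomas–Fermi profile, and multiply the energy by 2ε². Pointwise, V + ρ = λ₀ + (V
- λ₀)⁺ and (V - λ₀)⁺ρ = 0. Completing the square, the potential part of the energy of any v of mass
m is therefore a constant plus ½‖v² - ρ‖₂² + ∫(V - λ₀)⁺v² (`IsCompetitor.energy_eq`). A smoothing of
√ρ over the range of values 0 ≤ λ₀ - V ≲ δ, rescaled to mass m, has ∫|∇v|² ≤ C/δ, ‖v² - ρ‖₂² ≤ Cδ²
and no excess term (`exists_competitor`). Comparing the minimizer with it costs ε²/δ + δ², which is
balanced by δ = ε^(2/3), and ‖η² - ρ‖₂ = O(δ) follows. The same identity puts the Lagrange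
multiplier l within O(δ) of λ₀ (`IsPositiveMinimizer.integral_sq_sub_rhoTF_sq_le`).

The minimizer solves ε²Δη = (η² + V - l)η weakly. Inside the domain, l - V is bounded below, and
comparison with a bump bounds η below. The maximum principle applied to z = η² + V - l then gives z
= O(ε²). Hence η² - ρ = z + (l - λ₀) = O(δ) there. On a ball of radius ε the function η oscillates
by O(ε) and Δη = zη/ε² is O(1), so the interior gradient estimate for Poisson's equation bounds ∇η
uniformly (`exists_interior_estimate`).

No regularity theory is invoked: every estimate is proved by elementary barriers for smooth
functions, applied to the mollifications of η and passed to the almost everywhere limit. Jensen's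
inequality makes the mollifications exact subsolutions of aΔu ≥ (u² - l)u, which gives the sup
bounds. A Lipschitz bound for η makes them solve the equation up to an error ε² times themselves on
balls (`IsWeakSolution.eventually_abs_sub_le`), which the interior estimates tolerate.

For ε bounded below only crude bounds are needed. There l = O(ε²), so Δη ≥ -Lη, and a Gaussian mean
value inequality bounds η by the mass. -/

/-- The partial derivative `∂ᵢu`. -/
noncomputable def pd {N : ℕ} (i : Fin N) (u : EuclideanSpace ℝ (Fin N) → ℝ)
    (x : EuclideanSpace ℝ (Fin N)) : ℝ :=
  fderiv ℝ u x (EuclideanSpace.single i 1)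

/-- The Laplacian `∑ ∂ᵢ∂ᵢu`. -/
noncomputable def lap {N : ℕ} (u : EuclideanSpace ℝ (Fin N) → ℝ)
    (x : EuclideanSpace ℝ (Fin N)) : ℝ :=
  ∑ i, pd i (pd i u) x

/-! ### Calculus of partial derivatives and the Laplacian. -/

section calculus
variable {N : ℕ} {u v : EuclideanSpace ℝ (Fin N) → ℝ}

theorem ContDiff.pd (hu : ContDiff ℝ ∞ u) (i : Fin N) : ContDiff ℝ ∞ (pd i u) := by
  have h : ContDiff ℝ ∞ (fderiv ℝ u) := hu.fderiv_right (by simp)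
  exact h.clm_apply contDiff_const

theorem ContDiff.lap (hu : ContDiff ℝ ∞ u) : ContDiff ℝ ∞ (lap u) :=
  ContDiff.sum fun i _ => (hu.pd i).pd i

theorem ContDiff.differentiableAt_top (hu : ContDiff ℝ ∞ u) (x) : DifferentiableAt ℝ u x :=
  (hu.differentiable (by simp)) x

theorem pd_add (hu : ContDiff ℝ ∞ u) (hv : ContDiff ℝ ∞ v) (i : Fin N) :
    pd i (fun x => u x + v x) = fun x => pd i u x + pd i v x := by
  ext x
  simp [pd, fderiv_fun_add (hu.differentiableAt_top x) (hv.differentiableAt_top x)]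

theorem pd_sub (hu : ContDiff ℝ ∞ u) (hv : ContDiff ℝ ∞ v) (i : Fin N) :
    pd i (fun x => u x - v x) = fun x => pd i u x - pd i v x := by
  ext x
  simp [pd, fderiv_fun_sub (hu.differentiableAt_top x) (hv.differentiableAt_top x)]

theorem pd_const (c : ℝ) (i : Fin N) : pd i (fun _ => c) = fun _ => 0 := by
  ext x
  simp [pd]

theorem pd_const_mul (hu : ContDiff ℝ ∞ u) (c : ℝ) (i : Fin N) :
    pd i (fun x => c * u x) = fun x => c * pd i u x := by
  ext x
  simp [pd, fderiv_const_mul (hu.differentiableAt_top x)]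

theorem pd_mul (hu : ContDiff ℝ ∞ u) (hv : ContDiff ℝ ∞ v) (i : Fin N) :
    pd i (fun x => u x * v x) = fun x => u x * pd i v x + v x * pd i u x := by
  ext x
  simp [pd, fderiv_fun_mul (hu.differentiableAt_top x) (hv.differentiableAt_top x)]

theorem pd_sq (hu : ContDiff ℝ ∞ u) (i : Fin N) :
    pd i (fun x => u x ^ 2) = fun x => 2 * (u x * pd i u x) := by
  have : (fun x => u x ^ 2) = fun x => u x * u x := by ext; ring
  rw [this, pd_mul hu hu]
  ext; ring

theorem pd_coord (i j : Fin N) : pd i (fun x => x j) = fun _ => if j = i then 1 else 0 := by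
  ext x
  have : fderiv ℝ (fun x : EuclideanSpace ℝ (Fin N) => x j) x = EuclideanSpace.proj j :=
    (EuclideanSpace.proj (𝕜 := ℝ) j).hasFDerivAt.fderiv
  simp [pd, this, PiLp.single_apply]

theorem contDiff_coord (j : Fin N) :
    ContDiff ℝ ∞ (fun x : EuclideanSpace ℝ (Fin N) => x j) :=
  (EuclideanSpace.proj (𝕜 := ℝ) j).contDiff

theorem lap_add (hu : ContDiff ℝ ∞ u) (hv : ContDiff ℝ ∞ v) :
    lap (fun x => u x + v x) = fun x => lap u x + lap v x := by
  ext x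
  simp [lap, pd_add hu hv, pd_add (hu.pd _) (hv.pd _), Finset.sum_add_distrib]

theorem lap_sub (hu : ContDiff ℝ ∞ u) (hv : ContDiff ℝ ∞ v) :
    lap (fun x => u x - v x) = fun x => lap u x - lap v x := by
  ext x
  simp [lap, pd_sub hu hv, pd_sub (hu.pd _) (hv.pd _), Finset.sum_sub_distrib]

theorem lap_const (c : ℝ) : lap (fun _ : EuclideanSpace ℝ (Fin N) => c) = fun _ => 0 := by
  ext x
  simp [lap, pd_const]

theorem lap_const_mul (hu : ContDiff ℝ ∞ u) (c : ℝ) :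
    lap (fun x => c * u x) = fun x => c * lap u x := by
  ext x
  simp [lap, pd_const_mul hu, pd_const_mul (hu.pd _), Finset.mul_sum]

theorem lap_mul (hu : ContDiff ℝ ∞ u) (hv : ContDiff ℝ ∞ v) :
    lap (fun x => u x * v x) =
      fun x => u x * lap v x + v x * lap u x + 2 * ∑ i, pd i u x * pd i v x := by
  ext x
  have h (i : Fin N) : pd i (pd i fun x => u x * v x) x =
      u x * pd i (pd i v) x + v x * pd i (pd i u) x + 2 * (pd i u x * pd i v x) := by
    rw [pd_mul hu hv, pd_add (hu.mul (hv.pd i)) (hv.mul (hu.pd i)), pd_mul hu (hv.pd i),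
      pd_mul hv (hu.pd i)]
    ring
  simp only [lap, h, Finset.sum_add_distrib, Finset.mul_sum]

theorem lap_sq (hu : ContDiff ℝ ∞ u) :
    lap (fun x => u x ^ 2) = fun x => 2 * (u x * lap u x) + 2 * ∑ i, pd i u x ^ 2 := by
  have : (fun x => u x ^ 2) = fun x => u x * u x := by ext; ring
  rw [this, lap_mul hu hu]
  ext x
  simp only [pow_two]
  ring

theorem pd_comp_add (a : EuclideanSpace ℝ (Fin N)) (i : Fin N) :
    pd i (fun x => u (a + x)) = fun x => pd i u (a + x) := by
  ext x
  simp [pd, fderiv_comp_add_left]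

theorem lap_comp_add (a : EuclideanSpace ℝ (Fin N)) :
    lap (fun x => u (a + x)) = fun x => lap u (a + x) := by
  ext x
  simp [lap, pd_comp_add]

theorem lap_coord (j : Fin N) : lap (fun x : EuclideanSpace ℝ (Fin N) => x j) = fun _ => 0 := by
  ext x
  simp [lap, pd_coord, pd_const]

theorem contDiff_normSq (a : EuclideanSpace ℝ (Fin N)) :
    ContDiff ℝ ∞ (fun x : EuclideanSpace ℝ (Fin N) => ‖x - a‖ ^ 2) :=
  (contDiff_id.sub contDiff_const).norm_sq ℝ

theorem pd_normSq (a : EuclideanSpace ℝ (Fin N)) (i : Fin N) :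
    pd i (fun x => ‖x - a‖ ^ 2) = fun x => 2 * (x i - a i) := by
  ext x
  have : HasFDerivAt (fun x : EuclideanSpace ℝ (Fin N) => ‖x - a‖ ^ 2) _ x :=
    ((hasFDerivAt_id x).sub_const a).norm_sq
  simp [pd, this.fderiv, EuclideanSpace.inner_single_right]

theorem lap_normSq (a : EuclideanSpace ℝ (Fin N)) :
    lap (fun x => ‖x - a‖ ^ 2) = fun _ => 2 * (N : ℝ) := by
  ext x
  have h (i : Fin N) : pd i (fun x : EuclideanSpace ℝ (Fin N) => 2 * (x i - a i)) x = 2 := by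
    rw [pd_const_mul ((contDiff_coord i).sub contDiff_const),
      pd_sub (contDiff_coord i) contDiff_const, pd_coord, pd_const]
    simp
  simp [lap, pd_normSq, h, mul_comm]

theorem hasDerivAt_line (hu : ContDiff ℝ ∞ u) (x : EuclideanSpace ℝ (Fin N)) (i : Fin N) (t : ℝ) :
    HasDerivAt (fun t : ℝ => u (x + t • EuclideanSpace.single i 1))
      (pd i u (x + t • EuclideanSpace.single i 1)) t := by
  have h1 : HasDerivAt (fun t : ℝ => x + t • (EuclideanSpace.single i 1 : EuclideanSpace ℝ (Fin N)))
      (EuclideanSpace.single i 1) t := by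
    simpa using ((hasDerivAt_id t).smul_const
      (EuclideanSpace.single i 1 : EuclideanSpace ℝ (Fin N))).const_add x
  exact (hu.differentiableAt_top _).hasFDerivAt.comp_hasDerivAt t h1

theorem IsLocalMax.pd_eq_zero {x : EuclideanSpace ℝ (Fin N)} (h : IsLocalMax u x) (i : Fin N) :
    pd i u x = 0 := by
  simp [pd, h.fderiv_eq_zero]

/-- If the second derivative along the line were positive, the point would also be a local minimum
of the restriction, which would then be locally constant with second derivative zero. -/
theorem IsLocalMax.pd_pd_nonpos {x : EuclideanSpace ℝ (Fin N)} (hu : ContDiff ℝ ∞ u)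
    (h : IsLocalMax u x) (i : Fin N) : pd i (pd i u) x ≤ 0 := by
  set e : EuclideanSpace ℝ (Fin N) := EuclideanSpace.single i 1
  set g : ℝ → ℝ := fun t => u (x + t • e)
  have hg1 : deriv g = fun t => pd i u (x + t • e) := by
    ext t; exact (hasDerivAt_line hu x i t).deriv
  have hg2 : deriv (deriv g) 0 = pd i (pd i u) x := by
    rw [hg1]
    simpa using (hasDerivAt_line (hu.pd i) x i 0).deriv
  have hc : Continuous fun t : ℝ => x + t • e := by fun_prop
  have hmax : IsLocalMax g 0 := by
    have : Tendsto (fun t : ℝ => x + t • e) (𝓝 0) (𝓝 x) := by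
      simpa using hc.tendsto 0
    filter_upwards [this.eventually h] with t ht
    simpa [g] using ht
  by_contra hpos
  push Not at hpos
  have hmin : IsLocalMin g 0 := by
    apply isLocalMin_of_deriv_deriv_pos
    · rw [hg2]; exact hpos
    · rw [hg1]; simpa using h.pd_eq_zero i
    · exact (hu.continuous.comp hc).continuousAt
  have hconst : g =ᶠ[𝓝 0] fun _ => g 0 := by
    filter_upwards [hmax, hmin] with t h1 h2 using le_antisymm h1 h2
  have : deriv (deriv g) 0 = 0 := by
    have h3 : deriv g =ᶠ[𝓝 0] fun _ => 0 := by
      simpa using hconst.deriv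
    rw [h3.deriv_eq]; simp
  linarith [hg2 ▸ this]

theorem IsLocalMax.lap_nonpos {x : EuclideanSpace ℝ (Fin N)} (hu : ContDiff ℝ ∞ u)
    (h : IsLocalMax u x) : lap u x ≤ 0 :=
  Finset.sum_nonpos fun i _ => h.pd_pd_nonpos hu i

end calculus

/-! ### Maximum principle, gradient estimate, global upper bound. -/

section maximumPrinciple
variable {N : ℕ} {u v : EuclideanSpace ℝ (Fin N) → ℝ}

/-- The maximum over the closed ball cannot lie on the sphere. Barrier arguments use this after
subtracting a quadratic centred at x₀, which forces the strict inequality on the sphere. -/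
theorem exists_isLocalMax_of_sphere_lt {h : EuclideanSpace ℝ (Fin N) → ℝ} (hh : Continuous h)
    {x₀ : EuclideanSpace ℝ (Fin N)} {R : ℝ} (hR : 0 < R)
    (hb : ∀ x, ‖x - x₀‖ = R → h x < h x₀) :
    ∃ y, ‖y - x₀‖ ≤ R ∧ h x₀ ≤ h y ∧ IsLocalMax h y := by
  obtain ⟨y, hy, hmax⟩ := (isCompact_closedBall x₀ R).exists_isMaxOn
    ⟨x₀, mem_closedBall_self hR.le⟩ hh.continuousOn
  have h0 : h x₀ ≤ h y := hmax (mem_closedBall_self hR.le)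
  rw [mem_closedBall, dist_eq_norm] at hy
  refine ⟨y, hy, h0, ?_⟩
  have hlt : ‖y - x₀‖ < R := by
    refine lt_of_le_of_ne hy fun he => ?_
    exact absurd (hb y he) (not_lt.2 h0)
  have : closedBall x₀ R ∈ 𝓝 y := by
    refine mem_of_superset (isOpen_ball.mem_nhds ?_) ball_subset_closedBall
    rwa [mem_ball, dist_eq_norm]
  exact hmax.isLocalMax this

theorem reflect_norm (i : Fin N) (x : EuclideanSpace ℝ (Fin N)) :
    ‖x - (2 * x i) • EuclideanSpace.single i (1 : ℝ)‖ = ‖x‖ := by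
  have h : ‖x - (2 * x i) • EuclideanSpace.single i (1 : ℝ)‖ ^ 2 = ‖x‖ ^ 2 := by
    rw [norm_sub_sq_real, inner_smul_right, norm_smul, EuclideanSpace.inner_single_right]
    simp
    rw [mul_pow, sq_abs]
    ring
  exact (pow_left_inj₀ (norm_nonneg _) (norm_nonneg _) two_ne_zero).1 h

theorem lap_comp_reflect (hu : ContDiff ℝ ∞ u) (i : Fin N) :
    lap (fun x => u (x - (2 * x i) • EuclideanSpace.single i (1 : ℝ))) =
      fun x => lap u (x - (2 * x i) • EuclideanSpace.single i (1 : ℝ)) := by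
  set e : EuclideanSpace ℝ (Fin N) := EuclideanSpace.single i (1 : ℝ) with he
  have hσ (x : EuclideanSpace ℝ (Fin N)) :
      HasFDerivAt (fun x : EuclideanSpace ℝ (Fin N) => x - (2 * x i) • e)
        (ContinuousLinearMap.id ℝ _ -
          ((2 : ℝ) • (EuclideanSpace.proj (𝕜 := ℝ) i : EuclideanSpace ℝ (Fin N) →L[ℝ] ℝ)).smulRight e) x := by
    have h1 : HasFDerivAt (fun x : EuclideanSpace ℝ (Fin N) => 2 * x i)
      ((2 : ℝ) • (EuclideanSpace.proj (𝕜 := ℝ) i : EuclideanSpace ℝ (Fin N) →L[ℝ] ℝ)) x :=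
      (EuclideanSpace.proj (𝕜 := ℝ) i).hasFDerivAt.const_mul 2
    exact (hasFDerivAt_id x).sub (h1.smul_const e)
  have key (w : EuclideanSpace ℝ (Fin N) → ℝ) (hw : ContDiff ℝ ∞ w) (j : Fin N) :
      pd j (fun x => w (x - (2 * x i) • e)) =
        fun x => (if j = i then -1 else 1) * pd j w (x - (2 * x i) • e) := by
    ext x
    have h2 := (hw.differentiableAt_top (x - (2 * x i) • e)).hasFDerivAt.comp x (hσ x)
    have h3 : fderiv ℝ (fun x : EuclideanSpace ℝ (Fin N) => w (x - (2 * x i) • e)) x = _ :=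
      h2.fderiv
    rw [pd, h3]
    by_cases hji : j = i
    · subst hji
      simp [pd, he]
      ring
    · have hij : ¬ i = j := fun h => hji h.symm
      simp [pd, hji, hij]
  ext x
  refine Finset.sum_congr rfl fun j _ => ?_
  have hs : ContDiff ℝ ∞ (fun x : EuclideanSpace ℝ (Fin N) => x - (2 * x i) • e) :=
    contDiff_id.sub ((contDiff_const.mul (contDiff_coord i)).smul contDiff_const)
  rw [key u hu j, pd_const_mul (u := fun x => pd j u (x - (2 * x i) • e)) ((hu.pd j).comp hs), key _ (hu.pd j)]
  by_cases hji : j = i <;> simp [hji]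

/-- Comparison on a half ball. The odd part φ of u in the i-th coordinate vanishes on the flat face,
is at most M on the sphere and has |Δφ| ≤ F. The barrier ψ is nonnegative on the face, at least M on
the sphere, and Δψ = 2NM/d² - 2A < -F. So φ ≤ ψ, and both vanish at the centre, where ∂ᵢφ = ∂ᵢu(x₀)
and ∂ᵢψ = Ad. -/
theorem pd_le_of_bound (hu : ContDiff ℝ ∞ u) {x₀ : EuclideanSpace ℝ (Fin N)} {d M F A : ℝ}
    (hd : 0 < d) (hM : ∀ x, ‖x - x₀‖ ≤ d → |u x| ≤ M) (hF : ∀ x, ‖x - x₀‖ ≤ d → |lap u x| ≤ F)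
    (hA : N * M / d ^ 2 + F / 2 < A) (i : Fin N) : pd i u x₀ ≤ A * d := by
  set e : EuclideanSpace ℝ (Fin N) := EuclideanSpace.single i (1 : ℝ) with he
  have hM0 : 0 ≤ M := (abs_nonneg _).trans (hM x₀ (by simpa using hd.le))
  have hF0 : 0 ≤ F := (abs_nonneg _).trans (hF x₀ (by simpa using hd.le))
  have hA0 : 0 < A := lt_of_le_of_lt (by positivity) hA
  have hs : ContDiff ℝ ∞ (fun x : EuclideanSpace ℝ (Fin N) => x - (2 * x i) • e) :=
    contDiff_id.sub ((contDiff_const.mul (contDiff_coord i)).smul contDiff_const)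
  have ht : ContDiff ℝ ∞ (fun x => u (x₀ + x)) := hu.comp (contDiff_const.add contDiff_id)
  have htr : ContDiff ℝ ∞ (fun x : EuclideanSpace ℝ (Fin N) => u (x₀ + (x - (2 * x i) • e))) :=
    ht.comp hs
  have hsq : ContDiff ℝ ∞ (fun x : EuclideanSpace ℝ (Fin N) => ‖x - 0‖ ^ 2) := contDiff_normSq 0
  have hci := contDiff_coord (N := N) i
  set φ : EuclideanSpace ℝ (Fin N) → ℝ :=
    fun x => 1 / 2 * (u (x₀ + x) - u (x₀ + (x - (2 * x i) • e))) with hφ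
  set ψ : EuclideanSpace ℝ (Fin N) → ℝ :=
    fun x => M / d ^ 2 * ‖x - 0‖ ^ 2 + A * (d * x i - x i ^ 2) with hψ
  have hφs : ContDiff ℝ ∞ φ := contDiff_const.mul (ht.sub htr)
  have hψs : ContDiff ℝ ∞ ψ := (contDiff_const.mul hsq).add
    (contDiff_const.mul ((contDiff_const.mul hci).sub (hci.pow 2)))
  have hlφ (x) : lap φ x = 1 / 2 * (lap u (x₀ + x) - lap u (x₀ + (x - (2 * x i) • e))) := by
    have h1 := lap_comp_reflect ht i
    rw [hφ, lap_const_mul (ht.sub htr), lap_sub ht htr, lap_comp_add]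
    simp only [he, h1, lap_comp_add]
  have hlψ (x) : lap ψ x = M / d ^ 2 * (2 * N) - 2 * A := by
    rw [hψ, lap_add (contDiff_const.mul hsq)
      (contDiff_const.mul ((contDiff_const.mul hci).sub (hci.pow 2))),
      lap_const_mul hsq, lap_normSq, lap_const_mul ((contDiff_const.mul hci).sub (hci.pow 2)),
      lap_sub (contDiff_const.mul hci) (hci.pow 2), lap_const_mul hci, lap_sq hci, lap_coord]
    simp [pd_coord]
    ring
  have hball (x : EuclideanSpace ℝ (Fin N)) (hx : ‖x‖ ≤ d) :
      ‖x₀ + x - x₀‖ ≤ d ∧ ‖x₀ + (x - (2 * x i) • e) - x₀‖ ≤ d := by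
    rw [add_sub_cancel_left, add_sub_cancel_left, he, reflect_norm]
    exact ⟨hx, hx⟩
  have hcoord (x : EuclideanSpace ℝ (Fin N)) (hx : ‖x‖ ≤ d) : x i ≤ d :=
    (le_abs_self _).trans ((PiLp.norm_apply_le x i).trans hx)
  have hψ0 (x : EuclideanSpace ℝ (Fin N)) (hx : ‖x‖ ≤ d) (hi : 0 ≤ x i) :
      M / d ^ 2 * ‖x‖ ^ 2 ≤ ψ x := by
    have : 0 ≤ A * (d * x i - x i ^ 2) :=
      mul_nonneg hA0.le (by nlinarith [hcoord x hx])
    simp only [hψ, sub_zero]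
    linarith
  have key : ∀ x : EuclideanSpace ℝ (Fin N), ‖x‖ ≤ d → 0 ≤ x i → φ x - ψ x ≤ 0 := by
    have hK : IsCompact (closedBall (0 : EuclideanSpace ℝ (Fin N)) d ∩ {x | 0 ≤ x i}) :=
      (isCompact_closedBall _ _).inter_right (isClosed_le continuous_const hci.continuous)
    have hcont : Continuous fun x => φ x - ψ x := hφs.continuous.sub hψs.continuous
    obtain ⟨y, ⟨hy1, hy2⟩, hmax⟩ := hK.exists_isMaxOn
      ⟨0, by simp [hd.le]⟩ hcont.continuousOn
    rw [mem_closedBall_zero_iff] at hy1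
    rw [mem_ofPred_eq] at hy2
    suffices hy : φ y - ψ y ≤ 0 by
      intro x hx hi
      exact (hmax ⟨by simpa using hx, hi⟩).trans hy
    by_contra hpos
    push Not at hpos
    have hlow : 0 ≤ M / d ^ 2 * ‖y‖ ^ 2 := by positivity
    have hy2' : 0 < y i := by
      refine lt_of_le_of_ne hy2 fun h0 => ?_
      have : φ y = 0 := by simp [hφ, ← h0]
      linarith [hψ0 y hy1 hy2]
    have hy1' : ‖y‖ < d := by
      refine lt_of_le_of_ne hy1 fun h0 => ?_
      have h1 := hψ0 y hy1 hy2
      rw [h0, div_mul_cancel₀ _ (by positivity)] at h1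
      have h2 := abs_le.1 (hM _ (hball y hy1).1)
      have h3 := abs_le.1 (hM _ (hball y hy1).2)
      simp only [hφ] at hpos
      linarith
    have hnhds : closedBall (0 : EuclideanSpace ℝ (Fin N)) d ∩ {x | 0 ≤ x i} ∈ 𝓝 y := by
      have ho : IsOpen (ball (0 : EuclideanSpace ℝ (Fin N)) d ∩ {x | 0 < x i}) :=
        isOpen_ball.inter (isOpen_lt continuous_const hci.continuous)
      refine mem_of_superset (ho.mem_nhds ⟨by simpa using hy1', hy2'⟩) ?_
      exact inter_subset_inter ball_subset_closedBall fun x (hx : 0 < x i) => le_of_lt hx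
    have hl := (hmax.isLocalMax hnhds).lap_nonpos (hφs.sub hψs)
    rw [lap_sub hφs hψs] at hl
    simp only [hlφ, hlψ] at hl
    have h2 := abs_le.1 (hF _ (hball y hy1).1)
    have h3 := abs_le.1 (hF _ (hball y hy1).2)
    have h4 : M / d ^ 2 * (2 * N) = 2 * (N * M / d ^ 2) := by ring
    linarith
  have hline (t : ℝ) (ht0 : 0 ≤ t) (htd : t ≤ d) :
      1 / 2 * (u (x₀ + t • e) - u (x₀ + (-t) • e)) - (M / d ^ 2 * t ^ 2 + A * (d * t - t ^ 2)) ≤ 0 := by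
    have h := key (t • e) (by simpa [norm_smul, he, abs_of_nonneg ht0] using htd)
      (by simpa [he] using ht0)
    have h5 : t • e - (2 * (t • e) i) • e = (-t) • e := by
      have h6 : (t • e) i = t := by simp [he]
      rw [h6, ← sub_smul]; ring_nf
    simp only [hφ, hψ, h5] at h
    simpa [norm_smul, he] using h
  have hder : HasDerivAt (fun t : ℝ => 1 / 2 * (u (x₀ + t • e) - u (x₀ + (-t) • e))
      - (M / d ^ 2 * t ^ 2 + A * (d * t - t ^ 2))) (pd i u x₀ - A * d) 0 := by
    have h1 := hasDerivAt_line hu x₀ i 0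
    have h2 : HasDerivAt (fun t : ℝ => u (x₀ + (-t) • e)) (- pd i u x₀) 0 := by
      have := (show HasDerivAt (fun t : ℝ => u (x₀ + t • e)) (pd i u x₀) (-0) by
        simpa using h1).comp (0 : ℝ) (hasDerivAt_neg (0 : ℝ))
      refine (this.congr_deriv (by simp)).congr_of_eventuallyEq ?_
      exact Eventually.of_forall fun t => rfl
    have h3 : HasDerivAt (fun t : ℝ => M / d ^ 2 * t ^ 2 + A * (d * t - t ^ 2)) (A * d) 0 := by
      have := ((hasDerivAt_pow 2 (0 : ℝ)).const_mul (M / d ^ 2)).add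
        ((((hasDerivAt_id (0 : ℝ)).const_mul d).sub (hasDerivAt_pow 2 (0 : ℝ))).const_mul A)
      exact this.congr_deriv (by simp)
    have := ((h1.sub h2).const_mul (1 / 2)).sub h3
    refine this.congr_deriv ?_
    simp
    ring
  have hlim := hder.tendsto_slope_zero_right
  have : pd i u x₀ - A * d ≤ 0 := by
    refine le_of_tendsto hlim ?_
    filter_upwards [Ioc_mem_nhdsGT hd] with t ht
    simp only [zero_add, smul_eq_mul]
    refine mul_nonpos_of_nonneg_of_nonpos (by have := ht.1; positivity) ?_
    have := hline t ht.1.le ht.2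
    simpa using this
  linarith

/-- Interior gradient estimate for Poisson's equation. -/
theorem abs_pd_le_of_bound (hu : ContDiff ℝ ∞ u) {x₀ : EuclideanSpace ℝ (Fin N)} {d M F A : ℝ}
    (hd : 0 < d) (hM : ∀ x, ‖x - x₀‖ ≤ d → |u x| ≤ M) (hF : ∀ x, ‖x - x₀‖ ≤ d → |lap u x| ≤ F)
    (hA : N * M / d ^ 2 + F / 2 < A) (i : Fin N) : |pd i u x₀| ≤ A * d := by
  have hneg : ContDiff ℝ ∞ fun x => (-1) * u x := contDiff_const.mul hu
  refine abs_le.2 ⟨?_, pd_le_of_bound hu hd hM hF hA i⟩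
  have := pd_le_of_bound hneg (x₀ := x₀) (M := M) (F := F) hd (by simpa using hM)
    (by rw [lap_const_mul hu]; simpa using hF) hA i
  rw [pd_const_mul hu] at this
  linarith

/-- A bounded positive solution of `a Δu ≥ u³ - l u` on the whole space is at most `√l`. -/
theorem sq_le_of_lap_ge (hu : ContDiff ℝ ∞ u) {a l B : ℝ} (ha : 0 < a)
    (hB : ∀ x, u x ≤ B) (hl : ∀ x, (u x ^ 2 - l) * u x ≤ a * lap u x)
    (x : EuclideanSpace ℝ (Fin N)) (hx0 : 0 < u x) : u x ^ 2 ≤ l := by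
  by_contra hlt
  push Not at hlt
  set p := (u x ^ 2 - l) * u x with hp
  have hppos : 0 < p := mul_pos (by linarith) hx0
  -- The quadratic κ|y - x|² is flat enough that aΔ of it, 2Naκ, stays below p, and R is the radius
  -- at which it reaches the bound B. At the resulting maximum y one has u(y) ≥ u(x), so the
  -- nonlinearity is at least p there.
  set κ := p / (a * (2 * N + 1)) with hκ
  have hκ0 : 0 < κ := by positivity
  have hB0 : 0 < B := hx0.trans_le (hB x)
  set R := Real.sqrt (B / κ) with hR
  have hR0 : 0 < R := Real.sqrt_pos.2 (by positivity)
  have hR2 : κ * R ^ 2 = B := by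
    rw [hR, Real.sq_sqrt (by positivity)]; field_simp
  have hq : ContDiff ℝ ∞ fun y : EuclideanSpace ℝ (Fin N) => κ * ‖y - x‖ ^ 2 :=
    contDiff_const.mul (contDiff_normSq x)
  obtain ⟨y, -, hy, hmax⟩ := exists_isLocalMax_of_sphere_lt (h := fun y => u y - κ * ‖y - x‖ ^ 2)
    (hu.sub hq).continuous (x₀ := x) hR0 (by
      intro y hy
      simp only [hy, hR2]
      have := hB y
      simp
      linarith)
  have h1 := hmax.lap_nonpos (hu.sub hq)
  rw [lap_sub hu hq, lap_const_mul (contDiff_normSq x), lap_normSq] at h1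
  simp only [sub_self, norm_zero] at hy h1
  have hyx : u x ≤ u y := by
    have : 0 ≤ κ * ‖y - x‖ ^ 2 := by positivity
    linarith
  have h2 : p ≤ (u y ^ 2 - l) * u y := by
    rw [hp]
    apply mul_le_mul _ hyx hx0.le
    · nlinarith
    · gcongr
  have h3 : a * lap u y ≤ a * (κ * (2 * N)) := by gcongr; linarith
  have h4 : a * (κ * (2 * N)) < p := by
    have : p = κ * (a * (2 * N + 1)) := by rw [hκ]; field_simp
    rw [this]
    nlinarith [mul_pos ha hκ0]
  linarith [hl y]

end maximumPrinciple

/-! ### Interior estimates for smooth approximate solutions. -/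

section apriori
variable {N : ℕ} {u V : EuclideanSpace ℝ (Fin N) → ℝ}

/-- With s = R² - |x - x₀|² the Laplacian of s² is 8R² - 4(N+2)s. Adding (N+2)²s²/(2R²) makes it a
perfect square. The bump thus serves as an explicit substitute for the first Dirichlet eigenfunction
of the ball. -/
theorem lap_bump_ge (x₀ x : EuclideanSpace ℝ (Fin N)) {R : ℝ} (hR : 0 < R) :
    -((N + 2) ^ 2 / (2 * R ^ 2)) * (R ^ 2 - ‖x - x₀‖ ^ 2) ^ 2 ≤
      lap (fun x => (R ^ 2 - ‖x - x₀‖ ^ 2) ^ 2) x := by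
  have h1 : ContDiff ℝ ∞ fun x : EuclideanSpace ℝ (Fin N) => R ^ 2 - ‖x - x₀‖ ^ 2 :=
    contDiff_const.sub (contDiff_normSq x₀)
  have h2 : ∑ i, (x i - x₀ i) ^ 2 = ‖x - x₀‖ ^ 2 := by
    rw [EuclideanSpace.norm_sq_eq]; simp
  have h3 (i : Fin N) : pd i (fun x => R ^ 2 - ‖x - x₀‖ ^ 2) x ^ 2 = 4 * (x i - x₀ i) ^ 2 := by
    rw [pd_sub contDiff_const (contDiff_normSq x₀), pd_const, pd_normSq]
    ring
  rw [lap_sq h1, lap_sub contDiff_const (contDiff_normSq x₀), lap_const, lap_normSq]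
  simp only [h3, ← Finset.mul_sum, h2]
  set s := R ^ 2 - ‖x - x₀‖ ^ 2 with hs
  have h4 : ‖x - x₀‖ ^ 2 = R ^ 2 - s := by rw [hs]; ring
  rw [h4]
  have h5 : 0 ≤ (4 * R ^ 2 - (N + 2) * s) ^ 2 / (2 * R ^ 2) := by positivity
  have h6 : (4 * R ^ 2 - (N + 2) * s) ^ 2 / (2 * R ^ 2) =
      8 * R ^ 2 - 4 * (N + 2) * s + (N + 2) ^ 2 / (2 * R ^ 2) * s ^ 2 := by
    field_simp
    ring
  nlinarith

/-- Interior lower bound for positive supersolutions of `a Δu = (u² - b) u`. -/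
theorem sub_le_sq_of_lap_le (hu : ContDiff ℝ ∞ u) (hpos : ∀ x, 0 < u x) {a b R : ℝ} (ha : 0 ≤ a)
    (hR : 0 < R) {x₀ : EuclideanSpace ℝ (Fin N)}
    (hl : ∀ x, ‖x - x₀‖ ≤ R → a * lap u x ≤ (u x ^ 2 - b) * u x) :
    b - a * ((N + 2) ^ 2 / (2 * R ^ 2)) ≤ u x₀ ^ 2 := by
  set ψ : EuclideanSpace ℝ (Fin N) → ℝ := fun x => (R ^ 2 - ‖x - x₀‖ ^ 2) ^ 2 with hψ
  have hψs : ContDiff ℝ ∞ ψ := (contDiff_const.sub (contDiff_normSq x₀)).pow 2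
  -- T is the least factor for which Tu lies above the bump. At the touching point y, TΔu ≥ Δψ ≥ -μψ
  -- = -μTu, and the differential inequality turns this into a lower bound for u(y)².
  obtain ⟨y, hy, hmax⟩ := (isCompact_closedBall x₀ R).exists_isMaxOn
    (f := fun x => ψ x / u x) ⟨x₀, mem_closedBall_self hR.le⟩
    (hψs.continuous.div hu.continuous fun x => (hpos x).ne').continuousOn
  rw [mem_closedBall, dist_eq_norm] at hy
  set T := ψ y / u y with hT
  have hψ0 : ψ x₀ = R ^ 4 := by simp [hψ]; ring
  have hT0 : 0 < T := by
    have h1 : ψ x₀ / u x₀ ≤ T := hmax (mem_closedBall_self hR.le)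
    refine lt_of_lt_of_le ?_ h1
    rw [hψ0]
    have := hpos x₀
    positivity
  have hle : ∀ x, ‖x - x₀‖ ≤ R → ψ x ≤ T * u x := fun x hx => by
    have h1 : ψ x / u x ≤ T := hmax (by rwa [mem_closedBall, dist_eq_norm])
    rwa [div_le_iff₀ (hpos x)] at h1
  have hyeq : ψ y = T * u y := by rw [hT]; field_simp [(hpos y).ne']
  have hyR : ‖y - x₀‖ < R := by
    refine lt_of_le_of_ne hy fun h => ?_
    have : ψ y = 0 := by simp [hψ, h]
    have h2 := mul_pos hT0 (hpos y)
    linarith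
  have hTu : ContDiff ℝ ∞ fun x => T * u x := contDiff_const.mul hu
  have hloc : IsLocalMax (fun x => ψ x - T * u x) y := by
    have : ball x₀ R ∈ 𝓝 y := isOpen_ball.mem_nhds (by rwa [mem_ball, dist_eq_norm])
    filter_upwards [this] with x hx
    rw [mem_ball, dist_eq_norm] at hx
    have := hle x hx.le
    linarith
  have h1 := hloc.lap_nonpos (hψs.sub hTu)
  rw [lap_sub hψs hTu, lap_const_mul hu] at h1
  have h2 : _ ≤ lap ψ y := lap_bump_ge x₀ y hR
  have h2' : -((N + 2) ^ 2 / (2 * R ^ 2)) * (T * u y) ≤ lap ψ y := by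
    rw [← hyeq]; exact h2
  set μ : ℝ := (N + 2) ^ 2 / (2 * R ^ 2) with hμ
  have h3 : -μ * u y ≤ lap u y := by
    have : T * (-μ * u y) ≤ T * lap u y := by linarith
    exact le_of_mul_le_mul_left this hT0
  have h4 := hl y hy
  have h5 : a * (-μ * u y) ≤ (u y ^ 2 - b) * u y := (mul_le_mul_of_nonneg_left h3 ha).trans h4
  have h6 : b - a * μ ≤ u y ^ 2 := by
    have : (-(a * μ)) * u y ≤ (u y ^ 2 - b) * u y := by linarith
    have := le_of_mul_le_mul_right this (hpos y)
    linarith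
  refine h6.trans ?_
  -- The bump is largest at the centre, so the bound at the touching point carries over to x₀.
  have h7 : T * u y ≤ T * u x₀ := by
    rw [← hyeq]
    refine le_trans ?_ (hle x₀ (by simpa using hR.le))
    rw [hψ0]
    have hr : ‖y - x₀‖ ^ 2 ≤ R ^ 2 := by gcongr
    have hn : 0 ≤ ‖y - x₀‖ ^ 2 := by positivity
    simp only [hψ]
    nlinarith
  have h8 : u y ≤ u x₀ := le_of_mul_le_mul_left h7 hT0
  have := hpos y
  gcongr

/-- Where a positive approximate solution of `a Δu = (u² + V - l) u` is bounded below,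
`u² + V - l = O(a)`. -/
theorem abs_sq_add_sub_le (hu : ContDiff ℝ ∞ u) (hV : ContDiff ℝ ∞ V) (hpos : ∀ x, 0 < u x)
    {a c l M G R : ℝ} (ha : 0 < a) (hR : 0 < R) (hc : 0 < c) {x₀ : EuclideanSpace ℝ (Fin N)}
    (huc : ∀ x, ‖x - x₀‖ ≤ R → c ≤ u x)
    (hM : ∀ x, ‖x - x₀‖ ≤ R → |u x ^ 2 + V x - l| ≤ M)
    (hG : ∀ x, ‖x - x₀‖ ≤ R → ∀ i, |pd i V x| ≤ G)
    (hG' : ∀ x, ‖x - x₀‖ ≤ R → |lap V x| ≤ G)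
    (hl : ∀ x, ‖x - x₀‖ ≤ R → |a * lap u x - (u x ^ 2 + V x - l) * u x| ≤ a * u x) :
    |u x₀ ^ 2 + V x₀ - l| ≤ a * (1 + (2 * N * M / R ^ 2 + G +
      2 * N * ((G + 2 * M / R) / (2 * c)) ^ 2) / (2 * c ^ 2)) := by
  have hx0 : ‖x₀ - x₀‖ ≤ R := by simpa using hR.le
  have hM0 : 0 ≤ M := (abs_nonneg _).trans (hM x₀ hx0)
  have hG0 : 0 ≤ G := (abs_nonneg _).trans (hG' x₀ hx0)
  set z : EuclideanSpace ℝ (Fin N) → ℝ := fun x => u x ^ 2 + V x - l with hz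
  -- A barrier that vanishes at x₀ and equals M, the bound for |z|, on the sphere. Since Δz = 2uΔu +
  -- 2|∇u|² + ΔV and aΔu is close to zu, the term 2u²z with u ≥ c controls z at an extremum of z ∓
  -- g.
  set g : EuclideanSpace ℝ (Fin N) → ℝ := fun x => M / R ^ 2 * ‖x - x₀‖ ^ 2 with hg
  set q := (G + 2 * M / R) / (2 * c) with hq
  set K := 2 * N * M / R ^ 2 + G + 2 * N * q ^ 2 with hK
  have hq0 : 0 ≤ q := by positivity
  have husq : ContDiff ℝ ∞ fun x => u x ^ 2 := hu.pow 2
  have hzs : ContDiff ℝ ∞ z := (husq.add hV).sub contDiff_const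
  have hgs : ContDiff ℝ ∞ g := contDiff_const.mul (contDiff_normSq x₀)
  have hlz (x) : lap z x = 2 * (u x * lap u x) + 2 * ∑ i, pd i u x ^ 2 + lap V x := by
    rw [hz, lap_sub (husq.add hV) contDiff_const, lap_add husq hV, lap_const, lap_sq hu]
    ring
  have hpz (i x) : pd i z x = 2 * (u x * pd i u x) + pd i V x := by
    rw [hz, pd_sub (husq.add hV) contDiff_const, pd_add husq hV, pd_const, pd_sq hu]
    ring
  have hlg (x) : lap g x = 2 * N * M / R ^ 2 := by
    rw [hg, lap_const_mul (contDiff_normSq x₀), lap_normSq]; ring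
  have hg0 (x) : 0 ≤ g x := by positivity
  have hgx0 : g x₀ = 0 := by simp [hg]
  have hgR (x) (hx : ‖x - x₀‖ = R) : g x = M := by simp only [hg, hx]; field_simp
  have fin (t s w : ℝ) (hw : c ≤ w) (hts : t ≤ s) (hs : 2 * (w ^ 2 * (s - a)) ≤ a * K) :
      t ≤ a * (1 + K / (2 * c ^ 2)) := by
    rw [mul_add, mul_one, ← sub_le_iff_le_add']
    refine (sub_le_sub_right hts a).trans ?_
    by_cases hsa : s - a ≤ 0
    · exact hsa.trans (by positivity)
    · push Not at hsa
      rw [mul_div_assoc', le_div_iff₀ (by positivity)]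
      have : c ^ 2 ≤ w ^ 2 := by gcongr
      nlinarith
  refine abs_le.2 ⟨?_, ?_⟩
  · rw [neg_le]
    by_contra hcon
    push Not at hcon
    have hB0 : 0 ≤ a * (1 + K / (2 * c ^ 2)) := by positivity
    obtain ⟨y, hy, hle, hmax⟩ := exists_isLocalMax_of_sphere_lt
      (h := fun x => (-1) * z x - g x)
      ((contDiff_const.mul hzs).sub hgs).continuous (x₀ := x₀) hR (by
        intro x hx
        have h1 := (abs_le.1 (hM x hx.le)).1
        simp only [hgR x hx, hgx0, hz]
        linarith)
    have h1 := hmax.lap_nonpos ((contDiff_const.mul hzs).sub hgs)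
    have h2 (i) := hmax.pd_eq_zero i
    rw [lap_sub (contDiff_const.mul hzs) hgs, lap_const_mul hzs] at h1
    simp only [hlz, hlg] at h1
    -- In the lower bound for z the term 2|∇u|² has the wrong sign. Criticality of -z - g at y
    -- expresses 2u∇u through ∇V and ∇g, which bounds it.
    have hgrad (i) : pd i u y ^ 2 ≤ q ^ 2 := by
      have h3 := h2 i
      rw [pd_sub (contDiff_const.mul hzs) hgs, pd_const_mul hzs, hg,
        pd_const_mul (contDiff_normSq x₀), pd_normSq] at h3
      simp only [hpz] at h3
      have h4 : |y i - x₀ i| ≤ R := (PiLp.norm_apply_le (y - x₀) i).trans hy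
      have h5 : |2 * (u y * pd i u y)| ≤ G + 2 * M / R := by
        have : 2 * (u y * pd i u y) = -(pd i V y + M / R ^ 2 * (2 * (y i - x₀ i))) := by linarith
        rw [this, abs_neg]
        refine (abs_add_le _ _).trans (add_le_add (hG y hy i) ?_)
        rw [abs_mul, abs_mul, abs_two, abs_of_nonneg (by positivity : 0 ≤ M / R ^ 2)]
        calc M / R ^ 2 * (2 * |y i - x₀ i|) ≤ M / R ^ 2 * (2 * R) := by gcongr
          _ = 2 * M / R := by field_simp
      have h6 : |pd i u y| ≤ q := by
        rw [hq, le_div_iff₀ (by positivity)]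
        rw [abs_mul, abs_mul, abs_two, abs_of_pos (hpos y)] at h5
        nlinarith [huc y hy, abs_nonneg (pd i u y)]
      exact sq_le_sq' (abs_le.1 h6).1 (abs_le.1 h6).2
    have hsum : ∑ i, pd i u y ^ 2 ≤ N * q ^ 2 := by
      refine (Finset.sum_le_sum fun i _ => hgrad i).trans ?_
      simp
    have h7 := (abs_le.1 (hl y hy)).2
    have h8 := (abs_le.1 (hG' y hy)).2
    have huy := hpos y
    have h9 : u y * (a * lap u y) ≤ u y * (z y * u y + a * u y) := by
      gcongr; simp only [hz]; linarith
    have h10 : 0 ≤ a * (2 * N * M / R ^ 2 + 2 * (u y * lap u y) + 2 * (N * q ^ 2) + G) := by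
      apply mul_nonneg ha.le
      linarith
    refine absurd (fin (-z x₀) (-z y) (u y) (huc y hy) ?_ ?_) (not_le.2 hcon)
    · rw [hgx0] at hle; linarith [hg0 y]
    · rw [hK]
      nlinarith
  · by_contra hcon
    push Not at hcon
    have hB0 : 0 ≤ a * (1 + K / (2 * c ^ 2)) := by positivity
    obtain ⟨y, hy, hle, hmax⟩ := exists_isLocalMax_of_sphere_lt
      (h := fun x => z x - g x) (hzs.sub hgs).continuous (x₀ := x₀) hR (by
        intro x hx
        have h1 := (abs_le.1 (hM x hx.le)).2
        simp only [hgR x hx, hgx0, hz]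
        linarith)
    have h1 := hmax.lap_nonpos (hzs.sub hgs)
    rw [lap_sub hzs hgs] at h1
    simp only [hlz, hlg] at h1
    -- For the upper bound the gradient term has the favourable sign and is dropped.
    have hsum : 0 ≤ ∑ i, pd i u y ^ 2 := Finset.sum_nonneg fun i _ => sq_nonneg _
    have h7 := (abs_le.1 (hl y hy)).1
    have h8 := (abs_le.1 (hG' y hy)).1
    have huy := hpos y
    have h9 : u y * (z y * u y - a * u y) ≤ u y * (a * lap u y) := by
      gcongr; simp only [hz]; linarith
    have h10 : a * (2 * (u y * lap u y)) ≤ a * (2 * N * M / R ^ 2 + G) := by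
      gcongr
      linarith
    refine absurd (fin (z x₀) (z y) (u y) (huc y hy) ?_ ?_) (not_le.2 hcon)
    · rw [hgx0] at hle; linarith [hg0 y]
    · rw [hK]
      have : 0 ≤ a * (2 * N * q ^ 2) := by positivity
      nlinarith

/-- Interior estimates, uniform in `ε`, for positive approximate solutions of
`ε² Δu = (u² + V - l) u` where `l - V` is bounded below. -/
theorem exists_interior_estimate (hV : ContDiff ℝ ∞ V) {R b G M : ℝ} (hR : 0 < R) (hb : 0 < b)
    (hG0 : 0 < G) (hM0 : 0 < M) :
    ∃ ε₀ > 0, ∃ C > 0, ∀ ε, 0 < ε → ε ≤ ε₀ → ∀ (l : ℝ) (u : EuclideanSpace ℝ (Fin N) → ℝ)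
      (x₀ : EuclideanSpace ℝ (Fin N)), ContDiff ℝ ∞ u → (∀ x, 0 < u x) →
      (∀ x, ‖x - x₀‖ ≤ 3 * R → 2 * b ≤ l - V x ∧ (∀ i, |pd i V x| ≤ G) ∧ |lap V x| ≤ G ∧
        |V x - V x₀| ≤ G * ‖x - x₀‖ ∧ u x ≤ M ∧ |u x ^ 2 + V x - l| ≤ M ∧
        |ε ^ 2 * lap u x - (u x ^ 2 + V x - l) * u x| ≤ ε ^ 2 * u x) →
      |u x₀ ^ 2 + V x₀ - l| ≤ C * ε ^ 2 ∧ ∀ i, |pd i u x₀| ≤ C := by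
  set μ : ℝ := (N + 2) ^ 2 / (2 * R ^ 2) with hμ
  set c := Real.sqrt b with hc
  have hc0 : 0 < c := Real.sqrt_pos.2 hb
  have hcb : c ^ 2 = b := Real.sq_sqrt hb.le
  set B : ℝ := 1 + (2 * N * M / R ^ 2 + G + 2 * N * ((G + 2 * M / R) / (2 * c)) ^ 2) / (2 * c ^ 2)
    with hB
  have hB0 : 0 < B := by positivity
  have hμ0 : 0 < μ := by positivity
  set C' : ℝ := N * ((2 * B + G) / (2 * c)) + (B + 1) * M with hC'
  have hC'0 : 0 < C' := by positivity
  -- ε ≤ R keeps the ball of radius ε in the region where z is controlled. The square root gives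
  -- ε²(1 + μ) ≤ b: the equation error ε² and the bump loss ε²μ together take at most half of the
  -- gap 2b. The data live on radius 3R, the lower bound for u on 2R, the bound for z on R.
  refine ⟨min (min 1 R) (Real.sqrt (b / (1 + μ))), by positivity, B + C', by positivity, ?_⟩
  intro ε hε hεle l u x₀ hu hpos H
  have hε1 : ε ≤ 1 := hεle.trans ((min_le_left _ _).trans (min_le_left _ _))
  have hεR : ε ≤ R := hεle.trans ((min_le_left _ _).trans (min_le_right _ _))
  have hεb : ε ^ 2 * (1 + μ) ≤ b := by
    have h1 : ε ≤ Real.sqrt (b / (1 + μ)) := hεle.trans (min_le_right _ _)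
    rwa [Real.le_sqrt' hε, le_div_iff₀ (by positivity)] at h1
  have hε2 : 0 < ε ^ 2 := by positivity
  have tri (x y w : EuclideanSpace ℝ (Fin N)) {r s : ℝ} (h1 : ‖x - y‖ ≤ r) (h2 : ‖y - w‖ ≤ s) :
      ‖x - w‖ ≤ r + s := by
    have := norm_add_le (x - y) (y - w)
    rw [sub_add_sub_cancel] at this
    linarith
  have hlow : ∀ y, ‖y - x₀‖ ≤ 2 * R → c ≤ u y := by
    intro y hy
    have h1 := sub_le_sq_of_lap_le hu hpos hε2.le hR (x₀ := y) (b := 2 * b - ε ^ 2) (by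
      intro x hx
      have h2 := H x (by have := tri x y x₀ hx hy; linarith)
      have h3 := (abs_le.1 h2.2.2.2.2.2.2).2
      have h4 : (2 * b - (l - V x)) * u x ≤ 0 :=
        mul_nonpos_of_nonpos_of_nonneg (by linarith [h2.1]) (hpos x).le
      nlinarith)
    have h5 : c ^ 2 ≤ u y ^ 2 := by rw [hcb]; linarith
    exact (pow_le_pow_iff_left₀ hc0.le (hpos y).le two_ne_zero).1 h5
  have hzb : ∀ y, ‖y - x₀‖ ≤ R → |u y ^ 2 + V y - l| ≤ ε ^ 2 * B := by
    intro y hy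
    have tr (x) (hx : ‖x - y‖ ≤ R) : ‖x - x₀‖ ≤ 2 * R := by
      have := tri x y x₀ hx hy; linarith
    have tr' (x) (hx : ‖x - y‖ ≤ R) : ‖x - x₀‖ ≤ 3 * R := by
      have := tr x hx; linarith
    exact abs_sq_add_sub_le hu hV hpos hε2 hR hc0 (fun x hx => hlow x (tr x hx))
      (fun x hx => (H x (tr' x hx)).2.2.2.2.2.1) (fun x hx => (H x (tr' x hx)).2.1)
      (fun x hx => (H x (tr' x hx)).2.2.1) (fun x hx => (H x (tr' x hx)).2.2.2.2.2.2)
  have hx0 : ‖x₀ - x₀‖ ≤ R := by simpa using hR.le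
  refine ⟨(hzb x₀ hx0).trans (by nlinarith), fun i => ?_⟩
  -- At scale d = ε both terms of the gradient estimate are O(1). Subtracting u(x₀) replaces the sup
  -- of u by its oscillation, which is O(ε) because u² = z + l - V with z = O(ε²), V Lipschitz and u
  -- ≥ c.
  have h1 := abs_pd_le_of_bound (u := fun x => u x - u x₀) (hu.sub contDiff_const) (x₀ := x₀)
    (d := ε) (M := ε * ((2 * B + G) / (2 * c))) (F := (B + 1) * M) (A := C' / ε) hε ?_ ?_ ?_ i
  · rw [pd_sub hu contDiff_const, pd_const, div_mul_cancel₀ _ hε.ne'] at h1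
    simp only [sub_zero] at h1
    linarith
  · intro x hx
    have hxR := hx.trans hεR
    have h2 := hzb x hxR
    have h3 := hzb x₀ hx0
    have h4 := (H x (by linarith)).2.2.2.1
    have h5 : |u x ^ 2 - u x₀ ^ 2| ≤ ε * (2 * B + G) := by
      have h6 : G * ‖x - x₀‖ ≤ G * ε := by gcongr
      have h7 : ε ^ 2 * B ≤ ε * B := by gcongr; nlinarith
      have h8 : u x ^ 2 - u x₀ ^ 2 = (u x ^ 2 + V x - l) - (u x₀ ^ 2 + V x₀ - l) - (V x - V x₀) := by
        ring
      rw [h8]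
      refine (abs_sub _ _).trans ((add_le_add (abs_sub _ _) h4).trans ?_)
      linarith
    rw [mul_div_assoc', le_div_iff₀ (by positivity)]
    refine le_trans ?_ h5
    have h6 : u x ^ 2 - u x₀ ^ 2 = (u x - u x₀) * (u x + u x₀) := by ring
    have h7 := hlow x (by linarith)
    have h8 := hlow x₀ (by linarith)
    rw [h6, abs_mul, abs_of_pos (add_pos (hpos x) (hpos x₀))]
    gcongr
    linarith
  · intro x hx
    have hxR := hx.trans hεR
    rw [lap_sub hu contDiff_const, lap_const]
    simp only [sub_zero]
    have h2 := H x (by linarith)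
    have h3 := h2.2.2.2.2.2.2
    have h4 := hzb x hxR
    have h5 : |ε ^ 2 * lap u x| ≤ ε ^ 2 * ((B + 1) * M) := by
      have h6 : |(u x ^ 2 + V x - l) * u x| ≤ ε ^ 2 * B * u x := by
        rw [abs_mul, abs_of_pos (hpos x)]
        exact mul_le_mul_of_nonneg_right h4 (hpos x).le
      have h7 : ε ^ 2 * ((B + 1) * u x) ≤ ε ^ 2 * ((B + 1) * M) := by
        gcongr; exact h2.2.2.2.2.1
      have h8 := abs_add_le (ε ^ 2 * lap u x - (u x ^ 2 + V x - l) * u x)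
        ((u x ^ 2 + V x - l) * u x)
      rw [sub_add_cancel] at h8
      linarith
    rw [abs_mul, abs_of_pos hε2] at h5
    exact le_of_mul_le_mul_left h5 hε2
  · rw [lt_div_iff₀ hε, hC']
    have h2 : (N * (ε * ((2 * B + G) / (2 * c))) / ε ^ 2 + (B + 1) * M / 2) * ε =
      N * ((2 * B + G) / (2 * c)) + (B + 1) * M * (ε / 2) := by field_simp
    rw [h2]
    have h3 : (B + 1) * M * (ε / 2) < (B + 1) * M * 1 :=
      mul_lt_mul_of_pos_left (by linarith) (by positivity)
    linarith

end apriori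

/-! ### Gaussian mean value inequality. -/

section gaussianMean
variable {N : ℕ}

/-- The (unnormalized) Gaussian `exp (-|y|²/2)`. -/
noncomputable def gauss (y : EuclideanSpace ℝ (Fin N)) : ℝ := Real.exp (-(1 / 2) * ‖y - 0‖ ^ 2)

theorem gauss_pos (y : EuclideanSpace ℝ (Fin N)) : 0 < gauss y := Real.exp_pos _

theorem contDiff_gauss : ContDiff ℝ ∞ (gauss (N := N)) :=
  Real.contDiff_exp.comp (contDiff_const.mul (contDiff_normSq 0))

theorem pd_gauss (i : Fin N) (y : EuclideanSpace ℝ (Fin N)) : pd i gauss y = -(y i * gauss y) := by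
  have hs : ContDiff ℝ ∞ fun y : EuclideanSpace ℝ (Fin N) => -(1 / 2) * ‖y - 0‖ ^ 2 :=
    contDiff_const.mul (contDiff_normSq 0)
  have h1 : pd i (fun y : EuclideanSpace ℝ (Fin N) => -(1 / 2) * ‖y - 0‖ ^ 2) y = -(y i) := by
    rw [pd_const_mul (contDiff_normSq 0), pd_normSq]
    simp
  have h2 : HasFDerivAt gauss _ y := (hs.differentiableAt_top y).hasFDerivAt.exp
  rw [pd, h2.fderiv]
  rw [pd] at h1
  rw [_root_.smul_apply, h1]
  simp only [gauss, smul_eq_mul]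
  ring

theorem integrable_exp_neg_mul_norm_sq {b : ℝ} (hb : 0 < b) :
    Integrable fun y : EuclideanSpace ℝ (Fin N) => Real.exp (-b * ‖y‖ ^ 2) := by
  have h := (GaussianFourier.integrable_cexp_neg_mul_sq_norm_add (V := EuclideanSpace ℝ (Fin N))
    (b := (b : ℂ)) (by simpa using hb) 0 0).norm
  refine h.congr (Eventually.of_forall fun y => ?_)
  simp only [Complex.norm_exp]
  congr 1
  have : (-(b : ℂ) * (‖y‖ : ℂ) ^ 2 + 0 * ((inner ℝ 0 y : ℝ) : ℂ)) = ((-b * ‖y‖ ^ 2 : ℝ) : ℂ) := by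
    push_cast; ring
  rw [this, Complex.ofReal_re]

theorem integrable_gauss : Integrable (gauss (N := N)) := by
  have := integrable_exp_neg_mul_norm_sq (N := N) (b := 1 / 2) (by norm_num)
  exact this.congr (Eventually.of_forall fun y => by simp [gauss])

theorem integrable_norm_mul_gauss :
    Integrable fun y : EuclideanSpace ℝ (Fin N) => ‖y‖ * gauss y := by
  refine ((integrable_exp_neg_mul_norm_sq (N := N) (b := 1 / 4) (by norm_num)).const_mul 2).mono'
    (continuous_norm.mul contDiff_gauss.continuous).aestronglyMeasurable
    (Eventually.of_forall fun y => ?_)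
  rw [Real.norm_of_nonneg (mul_nonneg (norm_nonneg _) (gauss_pos y).le)]
  have h1 : gauss y = Real.exp (-(1 / 4) * ‖y‖ ^ 2) * Real.exp (-(1 / 4) * ‖y‖ ^ 2) := by
    rw [gauss, ← Real.exp_add, sub_zero]; ring_nf
  have h2 : ‖y‖ * Real.exp (-(1 / 4) * ‖y‖ ^ 2) ≤ 2 := by
    have h3 := Real.add_one_le_exp (1 / 4 * ‖y‖ ^ 2)
    have h4 : Real.exp (-(1 / 4) * ‖y‖ ^ 2) * Real.exp (1 / 4 * ‖y‖ ^ 2) = 1 := by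
      rw [← Real.exp_add]; simp
    have h5 := Real.exp_pos (-(1 / 4) * ‖y‖ ^ 2)
    have h6 : ‖y‖ ≤ 2 * Real.exp (1 / 4 * ‖y‖ ^ 2) := by nlinarith [sq_nonneg (‖y‖ - 2)]
    calc ‖y‖ * Real.exp (-(1 / 4) * ‖y‖ ^ 2)
        ≤ 2 * Real.exp (1 / 4 * ‖y‖ ^ 2) * Real.exp (-(1 / 4) * ‖y‖ ^ 2) := by gcongr
      _ = 2 := by rw [mul_assoc, mul_comm (Real.exp _), h4, mul_one]
  rw [h1, ← mul_assoc]
  gcongr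

variable {u : EuclideanSpace ℝ (Fin N) → ℝ}

theorem integrable_mul_gauss {f : EuclideanSpace ℝ (Fin N) → ℝ} (hf : Continuous f) {B : ℝ}
    (hB : ∀ x, |f x| ≤ B) : Integrable fun y => f y * gauss y := by
  exact integrable_gauss.bdd_mul hf.aestronglyMeasurable (Eventually.of_forall hB)

/-- This is the heat equation in the time variable r²/2. Differentiation under the integral produces
∇u(x + ry)·y times the Gaussian, and y times the Gaussian is minus its gradient, so one integration
by parts yields r times the Laplacian. -/
theorem hasDerivAt_gaussianMean (hu : ContDiff ℝ ∞ u) {B : ℝ} (hB : ∀ x, |u x| ≤ B)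
    (hB1 : ∀ i x, |pd i u x| ≤ B) (hB2 : ∀ i x, |pd i (pd i u) x| ≤ B)
    (x : EuclideanSpace ℝ (Fin N)) (r : ℝ) :
    HasDerivAt (fun r : ℝ => ∫ y, u (x + r • y) * gauss y)
      (r * ∫ y, lap u (x + r • y) * gauss y) r := by
  have hc (s : ℝ) : ContDiff ℝ ∞ fun y : EuclideanSpace ℝ (Fin N) => x + s • y :=
    contDiff_const.add (contDiff_id.const_smul s)
  have hpd (w : EuclideanSpace ℝ (Fin N) → ℝ) (hw : ContDiff ℝ ∞ w) (s : ℝ) (i : Fin N) :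
      pd i (fun y => w (x + s • y)) = fun y => s * pd i w (x + s • y) := by
    ext y
    have h1 : HasFDerivAt (fun y : EuclideanSpace ℝ (Fin N) => x + s • y)
        (s • ContinuousLinearMap.id ℝ _) y := ((hasFDerivAt_id y).const_smul s).const_add x
    have h2 : HasFDerivAt (fun y => w (x + s • y)) _ y :=
      (hw.differentiableAt_top (x + s • y)).hasFDerivAt.comp y h1
    simp [pd, h2.fderiv]
  have hF (s : ℝ) : Integrable fun y => u (x + s • y) * gauss y :=
    integrable_mul_gauss ((hu.comp (hc s)).continuous) fun y => hB _
  have hint (i : Fin N) (s : ℝ) : Integrable fun y => pd i u (x + s • y) * (y i * gauss y) := by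
    have h1 : Integrable fun y : EuclideanSpace ℝ (Fin N) => y i * gauss y := by
      refine integrable_norm_mul_gauss.mono'
        ((contDiff_coord i).continuous.mul contDiff_gauss.continuous).aestronglyMeasurable
        (Eventually.of_forall fun y => ?_)
      rw [norm_mul, Real.norm_of_nonneg (gauss_pos y).le]
      exact mul_le_mul_of_nonneg_right (PiLp.norm_apply_le y i) (gauss_pos y).le
    exact h1.bdd_mul (((hu.pd i).comp (hc s)).continuous).aestronglyMeasurable
      (Eventually.of_forall fun y => hB1 i _)
  have hF' : Continuous fun y : EuclideanSpace ℝ (Fin N) =>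
      ∑ i, pd i u (x + r • y) * (y i * gauss y) :=
    continuous_finsetSum _ fun i _ => (((hu.pd i).comp (hc r)).continuous).mul
      ((contDiff_coord i).continuous.mul contDiff_gauss.continuous)
  have key := (hasDerivAt_integral_of_dominated_loc_of_deriv_le (μ := volume)
    (F := fun (r : ℝ) (y : EuclideanSpace ℝ (Fin N)) => u (x + r • y) * gauss y)
    (F' := fun r y => ∑ i, pd i u (x + r • y) * (y i * gauss y)) (x₀ := r) (s := univ)
    (bound := fun y => N * B * (‖y‖ * gauss y)) univ_mem
    (Eventually.of_forall fun s => (hF s).aestronglyMeasurable) (hF r)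
    hF'.aestronglyMeasurable
    (Eventually.of_forall fun y s _ => by
      refine (norm_sum_le _ _).trans ?_
      calc ∑ i, ‖pd i u (x + s • y) * (y i * gauss y)‖
          ≤ ∑ _i : Fin N, B * (‖y‖ * gauss y) := by
            refine Finset.sum_le_sum fun i _ => ?_
            have hB0 : 0 ≤ B := (abs_nonneg _).trans (hB x)
            rw [norm_mul, norm_mul, Real.norm_of_nonneg (gauss_pos y).le]
            have := (gauss_pos y).le
            gcongr
            · exact hB1 i _
            · exact PiLp.norm_apply_le y i
        _ = N * B * (‖y‖ * gauss y) := by simp; ring)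
    (integrable_norm_mul_gauss.const_mul _)
    (Eventually.of_forall fun y s _ => by
      have h1 : HasDerivAt (fun s : ℝ => x + s • y) y s := by
        simpa using ((hasDerivAt_id s).smul_const y).const_add x
      have h2 := ((hu.differentiableAt_top (x + s • y)).hasFDerivAt.comp_hasDerivAt s h1).mul_const
        (gauss y)
      refine h2.congr_deriv ?_
      have h3 : y = ∑ i, y i • EuclideanSpace.single i (1 : ℝ) := by
        have := (EuclideanSpace.basisFun (Fin N) ℝ).sum_repr y
        simpa using this.symm
      conv_lhs => rw [h3]
      rw [map_sum, Finset.sum_mul]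
      refine Finset.sum_congr rfl fun i _ => ?_
      rw [map_smul, smul_eq_mul, ← h3, pd]
      ring)).2
  refine key.congr_deriv ?_
  rw [integral_finsetSum _ fun i _ => hint i r]
  have hi2 (i : Fin N) : Integrable fun y => pd i (pd i u) (x + r • y) * gauss y :=
    integrable_mul_gauss (((hu.pd i).pd i).comp (hc r)).continuous fun y => hB2 i _
  have hibp (i : Fin N) : ∫ y, pd i u (x + r • y) * (y i * gauss y) =
      r * ∫ y, pd i (pd i u) (x + r • y) * gauss y := by
    have hcomp : ContDiff ℝ ∞ fun y => pd i u (x + r • y) := (hu.pd i).comp (hc r)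
    have h1 := hpd (pd i u) (hu.pd i) r i
    have h2 : ∀ y, fderiv ℝ (fun y => pd i u (x + r • y)) y (EuclideanSpace.single i 1) =
        r * pd i (pd i u) (x + r • y) := fun y => congrFun h1 y
    have h3 : ∀ y, fderiv ℝ gauss y (EuclideanSpace.single i 1) = -(y i * gauss y) :=
      fun y => pd_gauss i y
    have h := integral_mul_fderiv_eq_neg_fderiv_mul_of_integrable (μ := volume)
      (f := fun y => pd i u (x + r • y)) (g := gauss) (v := EuclideanSpace.single i 1)
      (by
        simp only [h2]
        simpa only [mul_assoc] using (hi2 i).const_mul r)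
      (by
        simp only [h3, mul_neg]
        exact (hint i r).neg)
      (integrable_mul_gauss hcomp.continuous fun y => hB1 i _)
      (fun y _ => hcomp.differentiableAt_top y) (fun y _ => contDiff_gauss.differentiableAt_top y)
    simp only [h2, h3, mul_neg, mul_assoc] at h
    rw [integral_neg, neg_inj, integral_const_mul] at h
    exact h
  simp only [hibp, ← Finset.mul_sum, lap, Finset.sum_mul]
  rw [integral_finsetSum _ fun i _ => hi2 i]

/-- Mean value inequality for nonnegative functions with `Δu ≥ -Λ u`. -/
theorem mul_integral_gauss_le (hu : ContDiff ℝ ∞ u) {B : ℝ} (hB : ∀ x, |u x| ≤ B)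
    (hB1 : ∀ i x, |pd i u x| ≤ B) (hB2 : ∀ i x, |pd i (pd i u) x| ≤ B) {L : ℝ}
    (hL : ∀ x, -L * u x ≤ lap u x) (x : EuclideanSpace ℝ (Fin N)) :
    u x * ∫ y : EuclideanSpace ℝ (Fin N), gauss y ≤
      Real.exp (L / 2) * ∫ y, u (x + y) * gauss y := by
  set A : ℝ → ℝ := fun r => ∫ y, u (x + r • y) * gauss y with hA
  have hd (r : ℝ) := hasDerivAt_gaussianMean hu hB hB1 hB2 x r
  have hc (s : ℝ) : ContDiff ℝ ∞ fun y : EuclideanSpace ℝ (Fin N) => x + s • y :=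
    contDiff_const.add (contDiff_id.const_smul s)
  have hF (s : ℝ) : Integrable fun y => u (x + s • y) * gauss y :=
    integrable_mul_gauss ((hu.comp (hc s)).continuous) fun y => hB _
  have hlb (z) : |lap u z| ≤ N * B := by
    refine (Finset.abs_sum_le_sum_abs _ _).trans ?_
    refine (Finset.sum_le_sum fun i _ => hB2 i z).trans ?_
    simp
  have hl (s : ℝ) : -L * A s ≤ ∫ y, lap u (x + s • y) * gauss y := by
    rw [hA, ← integral_const_mul]
    refine integral_mono ((hF s).const_mul _) (integrable_mul_gauss
      ((hu.lap.comp (hc s)).continuous) fun y => hlb _) fun y => ?_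
    simp only [← mul_assoc]
    exact mul_le_mul_of_nonneg_right (hL _) (gauss_pos y).le
  -- From A' ≥ -LrA, the factor exp(Lr²/2) makes the product nondecreasing. Its values at r = 0 and
  -- r = 1 are the two sides of the claim.
  set g : ℝ → ℝ := fun r => Real.exp (L / 2 * r ^ 2) * A r with hg
  have hgd (r : ℝ) : HasDerivAt g (Real.exp (L / 2 * r ^ 2) * (L * r) * A r +
      Real.exp (L / 2 * r ^ 2) * (r * ∫ y, lap u (x + r • y) * gauss y)) r := by
    have h1 : HasDerivAt (fun r : ℝ => Real.exp (L / 2 * r ^ 2))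
        (Real.exp (L / 2 * r ^ 2) * (L * r)) r := by
      have := ((hasDerivAt_pow 2 r).const_mul (L / 2)).exp
      refine this.congr_deriv ?_
      simp; ring
    exact h1.mul (hd r)
  have hmono : MonotoneOn g (Icc 0 1) := by
    refine monotoneOn_of_hasDerivWithinAt_nonneg (convex_Icc 0 1)
      (fun r _ => (hgd r).continuousAt.continuousWithinAt)
      (fun r _ => (hgd r).hasDerivWithinAt) fun r hr => ?_
    rw [interior_Icc] at hr
    have h1 := mul_le_mul_of_nonneg_left (hl r) hr.1.le
    have h2 : 0 ≤ Real.exp (L / 2 * r ^ 2) *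
        (L * r * A r + r * ∫ y, lap u (x + r • y) * gauss y) :=
      mul_nonneg (Real.exp_pos _).le (by linarith)
    linarith
  have h01 := hmono (left_mem_Icc.2 zero_le_one) (right_mem_Icc.2 zero_le_one) zero_le_one
  simp only [hg, hA] at h01
  simpa [integral_const_mul] using h01

/-- An upper bound, depending only on `N`, `L` and `m`, for nonnegative functions with
`Δu ≥ -L u` and `∫ u² ≤ m`. -/
theorem le_of_lap_ge_of_integral_sq_le (hu : ContDiff ℝ ∞ u) {B : ℝ} (hB : ∀ x, |u x| ≤ B)
    (hB1 : ∀ i x, |pd i u x| ≤ B) (hB2 : ∀ i x, |pd i (pd i u) x| ≤ B) {L m : ℝ}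
    (hL : ∀ x, -L * u x ≤ lap u x) (hi : Integrable fun x => u x ^ 2)
    (hm : ∫ x, u x ^ 2 ≤ m) (x : EuclideanSpace ℝ (Fin N)) :
    u x ≤ Real.exp (L / 2) * ((m + ∫ y : EuclideanSpace ℝ (Fin N), gauss y) /
      ∫ y : EuclideanSpace ℝ (Fin N), gauss y) := by
  have hG : 0 < ∫ y : EuclideanSpace ℝ (Fin N), gauss y :=
    (integral_pos_iff_support_of_nonneg (fun y => (gauss_pos y).le) integrable_gauss).2 (by
      have : Function.support (gauss (N := N)) = univ :=
        eq_univ_of_forall fun y => (gauss_pos y).ne'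
      rw [this]
      exact isOpen_univ.measure_pos volume univ_nonempty)
  rw [mul_div_assoc', le_div_iff₀ hG]
  refine (mul_integral_gauss_le hu hB hB1 hB2 hL x).trans ?_
  gcongr
  have hi' : Integrable fun y => u (x + y) ^ 2 := hi.comp_add_left x
  have h1 : ∫ y, u (x + y) ^ 2 = ∫ y, u y ^ 2 := integral_add_left_eq_self (fun y => u y ^ 2) x
  -- Pointwise u·gauss ≤ u² + gauss² ≤ u² + gauss, since the Gaussian is at most 1.
  calc ∫ y, u (x + y) * gauss y ≤ ∫ y, (u (x + y) ^ 2 + gauss y) := by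
        refine integral_mono (integrable_mul_gauss
          (hu.continuous.comp (continuous_const.add continuous_id)) fun y => hB _)
          (hi'.add integrable_gauss) fun y => ?_
        have h2 : gauss y ≤ 1 := Real.exp_le_one_iff.2 (by nlinarith [norm_nonneg (y - 0)])
        have h3 := gauss_pos y
        simp only
        nlinarith [sq_nonneg (u (x + y) - gauss y), sq_nonneg (u (x + y))]
    _ = (∫ y, u (x + y) ^ 2) + ∫ y, gauss y := integral_add hi' integrable_gauss
    _ ≤ m + ∫ y, gauss y := by rw [h1]; gcongr

end gaussianMean

/-! ### Convolution with smooth compactly supported kernels. -/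

/-- The convolution `∫ f(y) k(x - y) dy`. -/
noncomputable def cv {N : ℕ} (k f : EuclideanSpace ℝ (Fin N) → ℝ)
    (x : EuclideanSpace ℝ (Fin N)) : ℝ :=
  ∫ y, f y * k (x - y)

section convolution
variable {N : ℕ} {k f g : EuclideanSpace ℝ (Fin N) → ℝ}

theorem cv_eq_convolution (k f : EuclideanSpace ℝ (Fin N) → ℝ) :
    cv k f = MeasureTheory.convolution f k (ContinuousLinearMap.lsmul ℝ ℝ) volume := rfl

theorem HasCompactSupport.pd (hk : HasCompactSupport k) (i : Fin N) :
    HasCompactSupport (pd i k) :=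
  (hk.fderiv ℝ).comp_left (g := fun T : EuclideanSpace ℝ (Fin N) →L[ℝ] ℝ =>
    T (EuclideanSpace.single i 1)) rfl

theorem contDiff_cv (hk : ContDiff ℝ ∞ k) (hc : HasCompactSupport k)
    (hf : LocallyIntegrable f volume) : ContDiff ℝ ∞ (cv k f) :=
  hc.contDiff_convolution_right (ContinuousLinearMap.lsmul ℝ ℝ) hf hk

theorem pd_cv (hk : ContDiff ℝ ∞ k) (hc : HasCompactSupport k)
    (hf : LocallyIntegrable f volume) (i : Fin N) : pd i (cv k f) = cv (pd i k) f := by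
  ext x
  have h := hc.hasFDerivAt_convolution_right (ContinuousLinearMap.lsmul ℝ ℝ) hf
    (hk.of_le (by simp)) x
  rw [pd, cv_eq_convolution, h.fderiv, convolution_precompR_apply _ hf (hc.fderiv ℝ)
    (hk.continuous_fderiv (by simp))]
  rfl

theorem ContDiff.reflect (hk : ContDiff ℝ ∞ k) (x : EuclideanSpace ℝ (Fin N)) :
    ContDiff ℝ ∞ fun y => k (x - y) := hk.comp (contDiff_const.sub contDiff_id)

theorem HasCompactSupport.reflect (hc : HasCompactSupport k) (x : EuclideanSpace ℝ (Fin N)) :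
    HasCompactSupport fun y => k (x - y) := hc.comp_homeomorph (Homeomorph.subLeft x)

theorem pd_reflect (hk : ContDiff ℝ ∞ k) (x : EuclideanSpace ℝ (Fin N)) (i : Fin N) :
    pd i (fun y => k (x - y)) = fun y => -pd i k (x - y) := by
  ext y
  have h : HasFDerivAt (fun y => k (x - y)) _ y :=
    (hk.differentiableAt_top (x - y)).hasFDerivAt.comp y ((hasFDerivAt_id y).const_sub x)
  simp [pd, h.fderiv]

theorem lap_reflect (hk : ContDiff ℝ ∞ k) (x : EuclideanSpace ℝ (Fin N)) :
    lap (fun y => k (x - y)) = fun y => lap k (x - y) := by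
  ext y
  refine Finset.sum_congr rfl fun i _ => ?_
  have : (fun y => -pd i k (x - y)) = fun y => (-1) * pd i k (x - y) := by ext; ring
  rw [pd_reflect hk, this, pd_const_mul ((hk.pd i).reflect x), pd_reflect (hk.pd i)]
  ring

theorem integrable_mul_reflect (hk : Continuous k) (hc : HasCompactSupport k)
    (hf : LocallyIntegrable f volume) (x : EuclideanSpace ℝ (Fin N)) :
    Integrable fun y => f y * k (x - y) := by
  have h := hf.integrable_smul_left_of_hasCompactSupport (g := fun y => k (x - y))
    (hk.comp (continuous_const.sub continuous_id)) (hc.reflect x)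
  simpa [mul_comm] using h

theorem lap_cv (hk : ContDiff ℝ ∞ k) (hc : HasCompactSupport k)
    (hf : LocallyIntegrable f volume) (x : EuclideanSpace ℝ (Fin N)) :
    lap (cv k f) x = ∫ y, f y * lap (fun y => k (x - y)) y := by
  rw [lap_reflect hk]
  simp only [lap, Finset.mul_sum]
  rw [integral_finsetSum _ fun i _ => integrable_mul_reflect ((hk.pd i).pd i).continuous
    ((hc.pd i).pd i) hf x]
  refine Finset.sum_congr rfl fun i _ => ?_
  rw [pd_cv hk hc hf, pd_cv (hk.pd i) (hc.pd i) hf]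
  rfl

theorem abs_cv_le (hk : Continuous k) (hc : HasCompactSupport k) (hf : MemLp f 2 volume)
    (x : EuclideanSpace ℝ (Fin N)) : |cv k f x| ≤ (∫ y, f y ^ 2) + ∫ y, k y ^ 2 := by
  have h1 : Integrable fun y => k (x - y) ^ 2 := by
    have : Integrable fun y => k y * k y :=
      (hk.mul hk).integrable_of_hasCompactSupport (hc.mul_right (f := k) (f' := k))
    simpa only [← pow_two] using this.comp_sub_left x
  have h2 : ∫ y, k (x - y) ^ 2 = ∫ y, k y ^ 2 := integral_sub_left_eq_self (fun y => k y ^ 2) _ x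
  rw [← h2, ← integral_add hf.integrable_sq h1]
  refine (abs_integral_le_integral_abs).trans (integral_mono_of_nonneg
    (Eventually.of_forall fun _ => abs_nonneg _) (hf.integrable_sq.add h1)
    (Eventually.of_forall fun y => ?_))
  simp only
  rw [abs_mul, ← sq_abs (f y), ← sq_abs (k (x - y))]
  nlinarith [sq_nonneg (|f y| - |k (x - y)|), sq_nonneg (|f y| ), sq_nonneg (|k (x - y)|)]

/-- `∫ |k ⋆ f|² ≤ ∫ |f|²` for a probability density `k`. -/
theorem integrable_cv_sq_and_integral_le (hk : ContDiff ℝ ∞ k) (hc : HasCompactSupport k)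
    (hk0 : ∀ y, 0 ≤ k y) (hk1 : ∫ y, k y = 1) (hf : MemLp f 2 volume) :
    Integrable (fun x => cv k f x ^ 2) ∧ ∫ x, cv k f x ^ 2 ≤ ∫ x, f x ^ 2 := by
  have hfl : LocallyIntegrable f volume := hf.locallyIntegrable (by norm_num)
  have hf2 : Integrable fun y => f y ^ 2 := hf.integrable_sq
  have hki : Integrable k := hk.continuous.integrable_of_hasCompactSupport hc
  have hle (x) : cv k f x ^ 2 ≤ cv k (fun y => f y ^ 2) x := by
    set a := cv k f x with ha
    have i1 : Integrable fun y => f y ^ 2 * k (x - y) :=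
      integrable_mul_reflect hk.continuous hc hf2.locallyIntegrable x
    have i2 : Integrable fun y => f y * k (x - y) :=
      integrable_mul_reflect hk.continuous hc hfl x
    have i3 : Integrable fun y => k (x - y) := hki.comp_sub_left x
    have e3 : ∫ y, k (x - y) = 1 := by rw [integral_sub_left_eq_self, hk1]
    -- Jensen's inequality for the square is the nonnegativity of this variance.
    have h0 : 0 ≤ ∫ y, (f y - a) ^ 2 * k (x - y) :=
      integral_nonneg fun y => mul_nonneg (sq_nonneg _) (hk0 _)
    have h1 : (fun y => (f y - a) ^ 2 * k (x - y)) =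
        fun y => f y ^ 2 * k (x - y) - 2 * a * (f y * k (x - y)) + a ^ 2 * k (x - y) := by
      ext; ring
    have i12 : Integrable fun y => f y ^ 2 * k (x - y) - 2 * a * (f y * k (x - y)) :=
      i1.sub (i2.const_mul _)
    rw [h1, integral_add i12 (i3.const_mul _),
      integral_sub i1 (i2.const_mul _), integral_const_mul, integral_const_mul, e3] at h0
    have h2 : ∫ y, f y * k (x - y) = a := rfl
    rw [h2] at h0
    change a ^ 2 ≤ ∫ y, f y ^ 2 * k (x - y)
    linarith
  have hint : Integrable (cv k fun y => f y ^ 2) := by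
    rw [cv_eq_convolution]
    exact hf2.integrable_convolution _ hki
  have hI : ∫ x, cv k (fun y => f y ^ 2) x = ∫ x, f x ^ 2 := by
    rw [cv_eq_convolution, integral_convolution _ hf2 hki]
    simp [hk1]
  have hint' : Integrable fun x => cv k f x ^ 2 := by
    refine hint.mono' (((contDiff_cv hk hc hfl).continuous.pow 2).aestronglyMeasurable)
      (Eventually.of_forall fun x => ?_)
    rw [Real.norm_of_nonneg (sq_nonneg _)]
    exact hle x
  exact ⟨hint', hI ▸ integral_mono hint' hint hle⟩

/-- Bounds for `k ⋆ f` where `k` is a probability density supported in `ball 0 r`. -/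
theorem cv_le_of_ae_le (hk : Continuous k) (hc : HasCompactSupport k)
    (hk0 : ∀ y, 0 ≤ k y) (hk1 : ∫ y, k y = 1) (hf : LocallyIntegrable f volume) {r M : ℝ}
    (hr : ∀ y, r ≤ ‖y‖ → k y = 0) {x : EuclideanSpace ℝ (Fin N)}
    (h : ∀ᵐ y, ‖y - x‖ < r → f y ≤ M) : cv k f x ≤ M := by
  have hki : Integrable fun y => k (x - y) :=
    (hk.integrable_of_hasCompactSupport hc).comp_sub_left x
  have e3 : ∫ y, M * k (x - y) = M := by
    rw [integral_const_mul, integral_sub_left_eq_self k, hk1, mul_one]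
  rw [← e3]
  refine integral_mono_ae (integrable_mul_reflect hk hc hf x) (hki.const_mul M) ?_
  filter_upwards [h] with y hy
  by_cases hyr : ‖y - x‖ < r
  · exact mul_le_mul_of_nonneg_right (hy hyr) (hk0 _)
  · rw [hr (x - y) (by rw [norm_sub_rev]; exact not_lt.1 hyr)]
    simp

theorem abs_cv_sub_le_of_ae_le (hk : Continuous k) (hc : HasCompactSupport k)
    (hk0 : ∀ y, 0 ≤ k y) (hk1 : ∫ y, k y = 1) (hf : LocallyIntegrable f volume) {r M a : ℝ}
    (hr : ∀ y, r ≤ ‖y‖ → k y = 0) {x : EuclideanSpace ℝ (Fin N)}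
    (h : ∀ᵐ y, ‖y - x‖ < r → |f y - a| ≤ M) : |cv k f x - a| ≤ M := by
  have h1 := cv_le_of_ae_le hk hc hk0 hk1 hf hr (M := a + M) (x := x) (by
    filter_upwards [h] with y hy hyr
    linarith [(abs_le.1 (hy hyr)).2])
  have h2 := cv_le_of_ae_le hk hc hk0 hk1 hf.neg hr (M := -a + M) (x := x) (by
    filter_upwards [h] with y hy hyr
    simp only [Pi.neg_apply]
    linarith [(abs_le.1 (hy hyr)).1])
  have h3 : cv k (-f) x = - cv k f x := by simp [cv, integral_neg]
  rw [h3] at h2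
  exact abs_le.2 ⟨by linarith, by linarith⟩

/-- Freezes the coefficient q at the value a. As f and k are nonnegative, the error is relative, a
multiple of the convolution itself, which is the form of error the interior estimates accept. -/
theorem abs_cv_mul_sub_le (hk : Continuous k) (hc : HasCompactSupport k)
    (hk0 : ∀ y, 0 ≤ k y) (hf : LocallyIntegrable f volume) (hf0 : ∀ᵐ y, 0 ≤ f y)
    {q : EuclideanSpace ℝ (Fin N) → ℝ} (hq : LocallyIntegrable (fun y => q y * f y) volume)
    {r κ a : ℝ} (hr : ∀ y, r ≤ ‖y‖ → k y = 0) {x : EuclideanSpace ℝ (Fin N)}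
    (h : ∀ᵐ y, ‖y - x‖ < r → |q y - a| ≤ κ) :
    |cv k (fun y => q y * f y) x - a * cv k f x| ≤ κ * cv k f x := by
  have i1 := integrable_mul_reflect hk hc hf x
  have i2 := integrable_mul_reflect hk hc hq x
  have e : cv k (fun y => q y * f y) x - a * cv k f x =
      ∫ y, (q y * f y * k (x - y) - a * (f y * k (x - y))) := by
    rw [integral_sub i2 (i1.const_mul _), integral_const_mul]; rfl
  have e' : κ * cv k f x = ∫ y, κ * (f y * k (x - y)) := by
    rw [integral_const_mul]; rfl
  rw [e, e']
  refine (abs_integral_le_integral_abs).trans (integral_mono_ae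
    (i2.sub (i1.const_mul _)).abs (i1.const_mul _) ?_)
  filter_upwards [h, hf0] with y hy hy0
  have e2 : q y * f y * k (x - y) - a * (f y * k (x - y)) = (q y - a) * (f y * k (x - y)) := by
    ring
  simp only [e2]
  by_cases hyr : ‖y - x‖ < r
  · rw [abs_mul, abs_of_nonneg (mul_nonneg hy0 (hk0 _))]
    exact mul_le_mul_of_nonneg_right (hy hyr) (mul_nonneg hy0 (hk0 _))
  · rw [hr (x - y) (by rw [norm_sub_rev]; exact not_lt.1 hyr)]
    simp

/-- Jensen's inequality for the convex function `t ↦ t³` on `[0, ∞)`. -/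
theorem cv_pow_three_le (hk : Continuous k) (hc : HasCompactSupport k)
    (hk0 : ∀ y, 0 ≤ k y) (hk1 : ∫ y, k y = 1) (hf : LocallyIntegrable f volume)
    (hf0 : ∀ᵐ y, 0 ≤ f y) (hf3 : LocallyIntegrable (fun y => f y ^ 3) volume)
    (x : EuclideanSpace ℝ (Fin N)) : cv k f x ^ 3 ≤ cv k (fun y => f y ^ 3) x := by
  have i1 := integrable_mul_reflect hk hc hf x
  have i3 := integrable_mul_reflect hk hc hf3 x
  have ik : Integrable fun y => k (x - y) :=
    (hk.integrable_of_hasCompactSupport hc).comp_sub_left x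
  have e3 : ∫ y, k (x - y) = 1 := by rw [integral_sub_left_eq_self, hk1]
  set s := cv k f x with hs
  have hs0 : 0 ≤ s := integral_nonneg_of_ae (by
    filter_upwards [hf0] with y hy using mul_nonneg hy (hk0 _))
  have h : ∫ y, (3 * s ^ 2 * (f y * k (x - y)) - 2 * s ^ 3 * k (x - y)) ≤
      ∫ y, f y ^ 3 * k (x - y) := by
    refine integral_mono_ae ((i1.const_mul _).sub (ik.const_mul _)) i3 ?_
    filter_upwards [hf0] with y hy
    -- This is t³ - 3s²t + 2s³ ≥ 0: the cube lies above its tangent line at s.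
    have h1 : 0 ≤ (f y - s) ^ 2 * (f y + 2 * s) := by positivity
    have h2 := mul_nonneg h1 (hk0 (x - y))
    nlinarith
  rw [integral_sub (i1.const_mul _) (ik.const_mul _), integral_const_mul, integral_const_mul,
    e3] at h
  have h2 : ∫ y, f y * k (x - y) = s := rfl
  rw [h2] at h
  change s ^ 3 ≤ ∫ y, f y ^ 3 * k (x - y)
  linarith

theorem cv_pos (hk : Continuous k) (hc : HasCompactSupport k) (hk0 : ∀ y, 0 ≤ k y)
    (hk1 : ∫ y, k y = 1) (hf : LocallyIntegrable f volume) (hf0 : ∀ᵐ y, 0 < f y)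
    (x : EuclideanSpace ℝ (Fin N)) : 0 < cv k f x := by
  have i1 := integrable_mul_reflect hk hc hf x
  have ik : Integrable fun y => k (x - y) :=
    (hk.integrable_of_hasCompactSupport hc).comp_sub_left x
  have e3 : ∫ y, k (x - y) = 1 := by rw [integral_sub_left_eq_self, hk1]
  have h0 : 0 ≤ᵐ[volume] fun y => f y * k (x - y) := by
    filter_upwards [hf0] with y hy using mul_nonneg hy.le (hk0 _)
  refine lt_of_le_of_ne (integral_nonneg_of_ae h0) fun h => ?_
  have h1 := (integral_eq_zero_iff_of_nonneg_ae h0 i1).1 h.symm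
  have h2 : (fun y => k (x - y)) =ᵐ[volume] 0 := by
    filter_upwards [h1, hf0] with y hy hy0
    exact (mul_eq_zero.1 hy).resolve_left hy0.ne'
  rw [integral_congr_ae h2] at e3
  simp at e3

end convolution

/-! ### A mollifying sequence and almost everywhere convergence. -/

section mollifier
variable {N : ℕ}

/-- A smooth bump function supported in the ball of radius `1 / (n + 1)`. -/
noncomputable def bumpSeq (N n : ℕ) : ContDiffBump (0 : EuclideanSpace ℝ (Fin N)) where
  rIn := 1 / (2 * (n + 1))
  rOut := 1 / (n + 1)
  rIn_pos := by positivity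
  rIn_lt_rOut := by
    apply one_div_lt_one_div_of_lt <;> nlinarith [(Nat.cast_nonneg n : (0 : ℝ) ≤ n)]

/-- A sequence of mollifiers. -/
noncomputable def mol (N n : ℕ) : EuclideanSpace ℝ (Fin N) → ℝ := (bumpSeq N n).normed volume

theorem contDiff_mol (n : ℕ) : ContDiff ℝ ∞ (mol N n) :=
  ContDiffBump.contDiff_normed (n := ⊤) _

theorem hasCompactSupport_mol (n : ℕ) : HasCompactSupport (mol N n) :=
  ContDiffBump.hasCompactSupport_normed _

theorem mol_nonneg (n : ℕ) (y : EuclideanSpace ℝ (Fin N)) : 0 ≤ mol N n y :=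
  ContDiffBump.nonneg_normed _ y

theorem integral_mol (n : ℕ) : ∫ y, mol N n y = 1 := ContDiffBump.integral_normed _

theorem mol_eq_zero (n : ℕ) (y : EuclideanSpace ℝ (Fin N)) (hy : 1 / ((n : ℝ) + 1) ≤ ‖y‖) :
    mol N n y = 0 := by
  have h : Function.support (mol N n) = ball 0 (1 / ((n : ℝ) + 1)) :=
    ContDiffBump.support_normed_eq (bumpSeq N n)
  by_contra hne
  have : y ∈ Function.support (mol N n) := hne
  rw [h, mem_ball_zero_iff] at this
  linarith

theorem ae_tendsto_cv_mol {f : EuclideanSpace ℝ (Fin N) → ℝ} (hf : LocallyIntegrable f volume) :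
    ∀ᵐ x, Tendsto (fun n => cv (mol N n) f x) atTop (𝓝 (f x)) := by
  -- K = 2 is the fixed ratio of outer to inner radius. It keeps the kernels comparable to averages
  -- over balls, so that Lebesgue differentiation applies.
  have h := ContDiffBump.ae_convolution_tendsto_right_of_locallyIntegrable (μ := volume)
    (φ := bumpSeq N) (l := atTop) (K := 2) tendsto_one_div_add_atTop_nhds_zero_nat
    (Eventually.of_forall fun n => by
      simp only [bumpSeq]
      apply le_of_eq
      field_simp) hf
  filter_upwards [h] with x hx
  refine hx.congr fun n => ?_
  rw [convolution_lsmul_swap]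
  simp [cv, mol, mul_comm]

theorem abs_sub_le_of_pd_le {u : EuclideanSpace ℝ (Fin N) → ℝ} (hu : ContDiff ℝ ∞ u)
    {x₀ : EuclideanSpace ℝ (Fin N)} {R L : ℝ} (hL : ∀ x, ‖x - x₀‖ ≤ R → ∀ i, |pd i u x| ≤ L)
    {x y : EuclideanSpace ℝ (Fin N)} (hx : ‖x - x₀‖ ≤ R) (hy : ‖y - x₀‖ ≤ R) :
    |u x - u y| ≤ N * L * ‖x - y‖ := by
  have h := (convex_closedBall x₀ R).norm_image_sub_le_of_norm_fderiv_le (𝕜 := ℝ) (f := u)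
    (C := N * L) (fun z _ => hu.differentiableAt_top z) (fun z hz => by
      rw [mem_closedBall, dist_eq_norm] at hz
      have hL0 : 0 ≤ N * L := by
        have : N * L = ∑ _i : Fin N, L := by simp
        rw [this]
        exact Finset.sum_nonneg fun i _ => (abs_nonneg _).trans (hL z hz i)
      refine ContinuousLinearMap.opNorm_le_bound _ hL0 fun v => ?_
      have h3 : v = ∑ i, v i • EuclideanSpace.single i (1 : ℝ) := by
        have := (EuclideanSpace.basisFun (Fin N) ℝ).sum_repr v
        simpa using this.symm
      conv_lhs => rw [h3]
      rw [map_sum]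
      refine (norm_sum_le _ _).trans ?_
      calc ∑ i, ‖fderiv ℝ u z (v i • EuclideanSpace.single i (1 : ℝ))‖
          ≤ ∑ _i : Fin N, ‖v‖ * L := by
            refine Finset.sum_le_sum fun i _ => ?_
            rw [map_smul, norm_smul]
            exact mul_le_mul (PiLp.norm_apply_le v i) (hL z hz i) (norm_nonneg _) (norm_nonneg _)
        _ = N * L * ‖v‖ := by simp; ring)
    (by rwa [mem_closedBall, dist_eq_norm]) (by rwa [mem_closedBall, dist_eq_norm] :
      x ∈ closedBall x₀ R)
  exact h

end mollifier

/-! ### Weak solutions and their mollifications. -/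

/-- `η` is an almost everywhere positive distributional solution of `a Δη = (η² + V - l) η`. -/
structure IsWeakSolution {N : ℕ} (V : EuclideanSpace ℝ (Fin N) → ℝ) (a l : ℝ)
    (η : EuclideanSpace ℝ (Fin N) → ℝ) : Prop where
  pos : ∀ᵐ x, 0 < η x
  memLp : MemLp η 2 volume
  locallyIntegrable_cube : LocallyIntegrable (fun x => η x ^ 3) volume
  integral_eq : ∀ φ : EuclideanSpace ℝ (Fin N) → ℝ, ContDiff ℝ ∞ φ → HasCompactSupport φ →
    a * ∫ x, η x * lap φ x = ∫ x, (η x ^ 2 + V x - l) * η x * φ x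

namespace IsWeakSolution
variable {N : ℕ} {V η : EuclideanSpace ℝ (Fin N) → ℝ} {a l : ℝ}

theorem locallyIntegrable (h : IsWeakSolution V a l η) : LocallyIntegrable η volume :=
  h.memLp.locallyIntegrable (by norm_num)

theorem locallyIntegrable_mul (h : IsWeakSolution V a l η) {W : EuclideanSpace ℝ (Fin N) → ℝ}
    (hW : Continuous W) : LocallyIntegrable (fun x => W x * η x) volume := by
  rw [← locallyIntegrableOn_univ]
  exact h.locallyIntegrable.locallyIntegrableOn univ |>.continuousOn_mul hW.continuousOn
    isOpen_univ.isLocallyClosed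

theorem locallyIntegrable_rhs (h : IsWeakSolution V a l η) (hV : Continuous V) :
    LocallyIntegrable (fun x => (η x ^ 2 + V x - l) * η x) volume := by
  have := h.locallyIntegrable_cube.add (h.locallyIntegrable_mul
    (W := fun x => V x - l) (hV.sub continuous_const))
  refine this.congr (Eventually.of_forall fun x => ?_)
  simp only [Pi.add_apply]
  ring

theorem contDiff_cv (h : IsWeakSolution V a l η) (n : ℕ) : ContDiff ℝ ∞ (cv (mol N n) η) :=
  _root_.contDiff_cv (contDiff_mol n) (hasCompactSupport_mol n) h.locallyIntegrable

theorem cv_pos (h : IsWeakSolution V a l η) (n : ℕ) (x) : 0 < cv (mol N n) η x :=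
  _root_.cv_pos (contDiff_mol n).continuous (hasCompactSupport_mol n) (mol_nonneg n)
    (integral_mol n) h.locallyIntegrable h.pos x

theorem mul_lap_cv (h : IsWeakSolution V a l η) (n : ℕ) (x) :
    a * lap (cv (mol N n) η) x = cv (mol N n) (fun x => (η x ^ 2 + V x - l) * η x) x := by
  rw [lap_cv (contDiff_mol n) (hasCompactSupport_mol n) h.locallyIntegrable,
    h.integral_eq _ ((contDiff_mol n).reflect x) ((hasCompactSupport_mol n).reflect x)]
  rfl

/-- Jensen's inequality puts the mollified cube above the cube of the mollification, and the term
with V is nonnegative. The mollification is thus an exact subsolution, without error term. -/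
theorem sub_mul_le_mul_lap_cv (h : IsWeakSolution V a l η) (hV : Continuous V)
    (hV0 : ∀ x, 0 ≤ V x) (n : ℕ) (x) :
    (cv (mol N n) η x ^ 2 - l) * cv (mol N n) η x ≤ a * lap (cv (mol N n) η) x := by
  have hk := (contDiff_mol (N := N) n).continuous
  have hc := hasCompactSupport_mol (N := N) n
  have hV1 := h.locallyIntegrable_mul hV
  have i1 := integrable_mul_reflect hk hc h.locallyIntegrable x
  have i3 := integrable_mul_reflect hk hc h.locallyIntegrable_cube x
  have iV := integrable_mul_reflect hk hc hV1 x
  have e : cv (mol N n) (fun x => (η x ^ 2 + V x - l) * η x) x =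
      cv (mol N n) (fun x => η x ^ 3) x + cv (mol N n) (fun x => V x * η x) x
        - l * cv (mol N n) η x := by
    have e1 : (fun y => (η y ^ 2 + V y - l) * η y * mol N n (x - y)) = fun y =>
        (η y ^ 3 * mol N n (x - y) + V y * η y * mol N n (x - y)) - l * (η y * mol N n (x - y)) := by
      ext; ring
    have i4 : Integrable fun y => η y ^ 3 * mol N n (x - y) + V y * η y * mol N n (x - y) :=
      i3.add iV
    simp only [cv]
    rw [e1, integral_sub i4 (i1.const_mul _), integral_add i3 iV, integral_const_mul]
  rw [h.mul_lap_cv, e]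
  have h1 := cv_pow_three_le hk hc (mol_nonneg n) (integral_mol n) h.locallyIntegrable
    (h.pos.mono fun y hy => hy.le) h.locallyIntegrable_cube x
  have h2 : 0 ≤ cv (mol N n) (fun x => V x * η x) x := integral_nonneg_of_ae (by
    filter_upwards [h.pos] with y hy
    exact mul_nonneg (mul_nonneg (hV0 y) hy.le) (mol_nonneg n _))
  nlinarith

theorem ae_tendsto (h : IsWeakSolution V a l η) :
    ∀ᵐ x, Tendsto (fun n => cv (mol N n) η x) atTop (𝓝 (η x)) :=
  ae_tendsto_cv_mol h.locallyIntegrable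

theorem ae_sq_le (h : IsWeakSolution V a l η) (ha : 0 < a) (hV : Continuous V)
    (hV0 : ∀ x, 0 ≤ V x) : ∀ᵐ x, η x ^ 2 ≤ l := by
  filter_upwards [h.ae_tendsto] with x hx
  refine le_of_tendsto (hx.pow 2) (Eventually.of_forall fun n => ?_)
  exact sq_le_of_lap_ge (h.contDiff_cv n) ha
    (fun y => (le_abs_self _).trans (abs_cv_le (contDiff_mol n).continuous
      (hasCompactSupport_mol n) h.memLp y)) (h.sub_mul_le_mul_lap_cv hV hV0 n) x (h.cv_pos n x)

/-- Serves large a, where the bound by √l is not uniform. Dropping the cubic term leaves Δu ≥ -Lu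
for the mollifications, to which the Gaussian mean value inequality applies. -/
theorem ae_le_of_div_le (h : IsWeakSolution V a l η) (ha : 0 < a) (hV : Continuous V)
    (hV0 : ∀ x, 0 ≤ V x) {L m : ℝ} (hL : l ≤ L * a) (hm : ∫ x, η x ^ 2 = m) :
    ∀ᵐ x, η x ≤ Real.exp (L / 2) * ((m + ∫ y : EuclideanSpace ℝ (Fin N), gauss y) /
      ∫ y : EuclideanSpace ℝ (Fin N), gauss y) := by
  filter_upwards [h.ae_tendsto] with x hx
  refine le_of_tendsto hx (Eventually.of_forall fun n => ?_)
  have hk := contDiff_mol (N := N) n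
  have hc := hasCompactSupport_mol (N := N) n
  have hint := integrable_cv_sq_and_integral_le hk hc (mol_nonneg n) (integral_mol n) h.memLp
  have hs1 : 0 ≤ ∑ i, ∫ y, pd i (mol N n) y ^ 2 :=
    Finset.sum_nonneg fun i _ => integral_nonneg fun y => sq_nonneg _
  have hs2 : 0 ≤ ∑ i, ∫ y, pd i (pd i (mol N n)) y ^ 2 :=
    Finset.sum_nonneg fun i _ => integral_nonneg fun y => sq_nonneg _
  have hs0 : 0 ≤ ∫ y, mol N n y ^ 2 := integral_nonneg fun y => sq_nonneg _
  refine le_of_lap_ge_of_integral_sq_le (h.contDiff_cv n)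
    -- This bound on the derivatives depends on n, but it only licenses the mean value inequality
    -- and does not enter its conclusion.
    (B := (∫ y, η y ^ 2) + ((∫ y, mol N n y ^ 2) + (∑ i, ∫ y, pd i (mol N n) y ^ 2) +
      (∑ i, ∫ y, pd i (pd i (mol N n)) y ^ 2))) ?_ ?_ ?_ ?_ hint.1 (hint.2.trans_eq hm) x
  · intro y
    refine (abs_cv_le hk.continuous hc h.memLp y).trans ?_
    gcongr
    linarith
  · intro i y
    rw [pd_cv hk hc h.locallyIntegrable]
    refine (abs_cv_le (hk.pd i).continuous (hc.pd i) h.memLp y).trans ?_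
    gcongr
    have := Finset.single_le_sum (f := fun i => ∫ y, pd i (mol N n) y ^ 2)
      (fun i _ => integral_nonneg fun y => sq_nonneg _) (Finset.mem_univ i)
    linarith
  · intro i y
    rw [pd_cv hk hc h.locallyIntegrable, pd_cv (hk.pd i) (hc.pd i) h.locallyIntegrable]
    refine (abs_cv_le ((hk.pd i).pd i).continuous ((hc.pd i).pd i) h.memLp y).trans ?_
    gcongr
    have := Finset.single_le_sum (f := fun i => ∫ y, pd i (pd i (mol N n)) y ^ 2)
      (fun i _ => integral_nonneg fun y => sq_nonneg _) (Finset.mem_univ i)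
    linarith
  · intro y
    have h1 := h.sub_mul_le_mul_lap_cv hV hV0 n y
    have h2 := h.cv_pos n y
    have h3 : a * (-L * cv (mol N n) η y) ≤ a * lap (cv (mol N n) η) y := by
      refine le_trans ?_ h1
      have h4 : 0 ≤ cv (mol N n) η y ^ 2 * cv (mol N n) η y := by positivity
      nlinarith
    exact le_of_mul_le_mul_left h3 ha

theorem cv_le (h : IsWeakSolution V a l η) {M : ℝ} (hM : ∀ᵐ x, η x ≤ M) (n : ℕ) (x) :
    cv (mol N n) η x ≤ M :=
  cv_le_of_ae_le (contDiff_mol n).continuous (hasCompactSupport_mol n) (mol_nonneg n)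
    (integral_mol n) h.locallyIntegrable (mol_eq_zero n) (hM.mono fun _ hy _ => hy)

theorem one_div_le_one (n : ℕ) : 1 / ((n : ℝ) + 1) ≤ 1 := by
  rw [div_le_one (by positivity)]
  linarith [(Nat.cast_nonneg n : (0 : ℝ) ≤ n)]

/-- The gradient estimate on a unit ball, with aΔ of the mollification bounded by the mollified
right-hand side. The 2 in R + 2 is one unit for that ball and one for the support of the kernel. The
bound is uniform in n but degenerates as a → 0. -/
theorem abs_pd_cv_le (h : IsWeakSolution V a l η) (ha : 0 < a) (hV : Continuous V) {M S R : ℝ}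
    (hM : ∀ᵐ x, η x ≤ M) {x₀ : EuclideanSpace ℝ (Fin N)} (hS : ∀ x, ‖x - x₀‖ ≤ R + 2 → |V x| ≤ S)
    (n : ℕ) (i : Fin N) {x : EuclideanSpace ℝ (Fin N)} (hx : ‖x - x₀‖ ≤ R) :
    |pd i (cv (mol N n) η) x| ≤ N * M + (M ^ 2 + S + |l|) * M / a + 1 := by
  have hM0 : 0 < M := (h.cv_pos 0 0).trans_le (h.cv_le hM 0 0)
  have hS0 : 0 ≤ S := (abs_nonneg _).trans (hS x (by linarith))
  have key (y : EuclideanSpace ℝ (Fin N)) (hy : ‖y - x‖ ≤ 1) :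
      |lap (cv (mol N n) η) y| ≤ (M ^ 2 + S + |l|) * M / a := by
    have e : |lap (cv (mol N n) η) y| * a = |a * lap (cv (mol N n) η) y| := by
      rw [abs_mul, abs_of_pos ha, mul_comm]
    rw [le_div_iff₀ ha, e, h.mul_lap_cv, ← sub_zero (cv _ _ _)]
    refine abs_cv_sub_le_of_ae_le (contDiff_mol n).continuous (hasCompactSupport_mol n)
      (mol_nonneg n) (integral_mol n) (h.locallyIntegrable_rhs hV) (mol_eq_zero n) ?_
    filter_upwards [hM, h.pos] with w hw hw0 hwy
    rw [sub_zero, abs_mul, abs_of_pos hw0]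
    have h1 : ‖w - x₀‖ ≤ R + 2 := by
      have e : w - x₀ = (w - y) + (y - x) + (x - x₀) := by abel
      rw [e]
      have := norm_add₃_le (a := w - y) (b := y - x) (c := x - x₀)
      linarith [one_div_le_one n]
    have h2 : |η w ^ 2 + V w - l| ≤ M ^ 2 + S + |l| := by
      refine (abs_sub _ _).trans (add_le_add ((abs_add_le _ _).trans (add_le_add ?_ (hS w h1))) le_rfl)
      rw [abs_of_nonneg (sq_nonneg _)]
      gcongr
    gcongr
  have := abs_pd_le_of_bound (h.contDiff_cv n) (x₀ := x) (d := 1) (M := M)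
    (F := (M ^ 2 + S + |l|) * M / a) (A := N * M + (M ^ 2 + S + |l|) * M / a + 1) one_pos
    (fun y _ => by
      rw [abs_of_pos (h.cv_pos n y)]
      exact h.cv_le hM n y) key (by
        have : 0 ≤ (M ^ 2 + S + |l|) * M / a := by positivity
        simp only [one_pow, div_one]
        linarith) i
  simpa using this

theorem exists_bound_of_continuous {f : EuclideanSpace ℝ (Fin N) → ℝ} (hf : Continuous f)
    (x₀ : EuclideanSpace ℝ (Fin N)) (R : ℝ) : ∃ S > 0, ∀ x, ‖x - x₀‖ ≤ R → |f x| ≤ S := by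
  obtain ⟨S, hS⟩ := (isCompact_closedBall x₀ R).exists_bound_of_continuousOn hf.continuousOn
  refine ⟨max S 1, by positivity, fun x hx => (hS x ?_).trans (le_max_left _ _)⟩
  rwa [mem_closedBall, dist_eq_norm]

theorem exists_bound_pd {f : EuclideanSpace ℝ (Fin N) → ℝ} (hf : ContDiff ℝ ∞ f)
    (x₀ : EuclideanSpace ℝ (Fin N)) (R : ℝ) :
    ∃ S > 0, ∀ x, ‖x - x₀‖ ≤ R → ∀ i, |pd i f x| ≤ S := by
  choose S hS0 hS using fun i : Fin N => exists_bound_of_continuous (hf.pd i).continuous x₀ R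
  refine ⟨1 + ∑ i, S i, ?_, fun x hx i => (hS i x hx).trans ?_⟩
  · have := Finset.sum_nonneg fun i (_ : i ∈ Finset.univ) => (hS0 i).le
    linarith
  · have := Finset.single_le_sum (f := S) (fun i _ => (hS0 i).le) (Finset.mem_univ i)
    linarith

/-- The mollifications of a bounded weak solution solve the equation approximately, with an error
that is uniformly small on balls. -/
theorem eventually_abs_sub_le (h : IsWeakSolution V a l η) (ha : 0 < a) (hV : ContDiff ℝ ∞ V)
    {M : ℝ} (hM : ∀ᵐ x, η x ≤ M) (x₀ : EuclideanSpace ℝ (Fin N)) (R : ℝ) {κ : ℝ} (hκ : 0 < κ) :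
    ∀ᶠ n in atTop, ∀ x, ‖x - x₀‖ ≤ R → |a * lap (cv (mol N n) η) x -
      (cv (mol N n) η x ^ 2 + V x - l) * cv (mol N n) η x| ≤ κ * cv (mol N n) η x := by
  obtain ⟨S, -, hS⟩ := exists_bound_of_continuous hV.continuous x₀ (R + 1 + 2)
  obtain ⟨G, hG0, hG⟩ := exists_bound_pd hV x₀ (R + 1)
  have hM0 : 0 < M := (h.cv_pos 0 0).trans_le (h.cv_le hM 0 0)
  set L := |N * M + (M ^ 2 + S + |l|) * M / a + 1| with hL
  have hLb (n x) (hx : ‖x - x₀‖ ≤ R + 1) (i) : |pd i (cv (mol N n) η) x| ≤ L :=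
    (h.abs_pd_cv_le ha hV.continuous hM hS n i hx).trans (le_abs_self _)
  have hL0 : 0 ≤ L := abs_nonneg _
  -- The gradient bound is uniform in n, so η itself is Lipschitz on the ball between points where
  -- the mollifications converge, which are almost all points.
  have hlip : ∀ x y, Tendsto (fun n => cv (mol N n) η x) atTop (𝓝 (η x)) →
      Tendsto (fun n => cv (mol N n) η y) atTop (𝓝 (η y)) → ‖x - x₀‖ ≤ R + 1 →
      ‖y - x₀‖ ≤ R + 1 → |η x - η y| ≤ N * L * ‖x - y‖ := fun x y hx hy hx' hy' =>
    le_of_tendsto (hx.sub hy).abs (Eventually.of_forall fun n =>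
      abs_sub_le_of_pd_le (h.contDiff_cv n) (hLb n) hx' hy')
  have hsmall : ∀ᶠ n : ℕ in atTop,
      (2 * M * (2 * N * L) + N * G) * (1 / ((n : ℝ) + 1)) ≤ κ := by
    have := (tendsto_one_div_add_atTop_nhds_zero_nat (𝕜 := ℝ)).const_mul
      (2 * M * (2 * N * L) + N * G)
    rw [mul_zero] at this
    exact this.eventually (ge_mem_nhds hκ)
  filter_upwards [hsmall] with n hn x hx
  set r : ℝ := 1 / ((n : ℝ) + 1) with hr
  have hr1 : r ≤ 1 := one_div_le_one n
  have tri (y : EuclideanSpace ℝ (Fin N)) (hy : ‖y - x‖ < r) : ‖y - x₀‖ ≤ R + 1 := by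
    have := norm_add_le (y - x) (x - x₀)
    rw [sub_add_sub_cancel] at this
    linarith
  rw [h.mul_lap_cv]
  -- The coefficient η² + V - l is compared with its mollified version at x. Within the kernel's
  -- radius r the two differ by O(r), which the choice of n makes at most κ.
  refine (abs_cv_mul_sub_le (contDiff_mol n).continuous (hasCompactSupport_mol n) (mol_nonneg n)
    h.locallyIntegrable (h.pos.mono fun _ hy => hy.le) (h.locallyIntegrable_rhs hV.continuous)
    (mol_eq_zero n) (κ := κ) ?_)
  filter_upwards [h.ae_tendsto, hM, h.pos] with y hy hyM hy0 hyr
  have h1 : |cv (mol N n) η x - η y| ≤ 2 * N * L * r := by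
    refine abs_cv_sub_le_of_ae_le (contDiff_mol n).continuous (hasCompactSupport_mol n)
      (mol_nonneg n) (integral_mol n) h.locallyIntegrable (mol_eq_zero n) ?_
    filter_upwards [h.ae_tendsto] with w hw hwr
    refine (hlip w y hw hy (tri w hwr) (tri y hyr)).trans ?_
    have h2 : ‖w - y‖ ≤ 2 * r := by
      have := norm_sub_le (w - x) (y - x)
      rw [sub_sub_sub_cancel_right] at this
      linarith
    calc N * L * ‖w - y‖ ≤ N * L * (2 * r) := by gcongr
      _ = 2 * N * L * r := by ring
  have h2 : |V y - V x| ≤ N * G * r := by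
    refine (abs_sub_le_of_pd_le hV hG (tri y hyr) (by linarith)).trans ?_
    gcongr
  have h3 : |η y ^ 2 - cv (mol N n) η x ^ 2| ≤ 2 * M * (2 * N * L * r) := by
    have e : η y ^ 2 - cv (mol N n) η x ^ 2 =
      (η y + cv (mol N n) η x) * (η y - cv (mol N n) η x) := by ring
    have hc := h.cv_pos n x
    have hcM := h.cv_le hM n x
    rw [e, abs_mul, abs_sub_comm (η y), abs_of_pos (by linarith)]
    gcongr
    linarith
  have e : η y ^ 2 + V y - l - (cv (mol N n) η x ^ 2 + V x - l) =
      (η y ^ 2 - cv (mol N n) η x ^ 2) + (V y - V x) := by ring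
  rw [e]
  refine (abs_add_le _ _).trans ((add_le_add h3 h2).trans ?_)
  linarith

end IsWeakSolution

/-! ### Weak differentiability of η². -/

section weakGradientSq
variable {N : ℕ} {V η : EuclideanSpace ℝ (Fin N) → ℝ} {a l : ℝ}
  {g : Fin N → EuclideanSpace ℝ (Fin N) → ℝ}

theorem pd_cv_mol_eq (hη : LocallyIntegrable η volume)
    (hg : ∀ φ : EuclideanSpace ℝ (Fin N) → ℝ, ContDiff ℝ ∞ φ → HasCompactSupport φ →
      ∀ i, ∫ x, η x * pd i φ x = -∫ x, g i x * φ x) (n : ℕ) (i : Fin N) :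
    pd i (cv (mol N n) η) = cv (mol N n) (g i) := by
  ext x
  have h := hg _ ((contDiff_mol n).reflect x) ((hasCompactSupport_mol n).reflect x) i
  rw [pd_reflect (contDiff_mol n)] at h
  simp only [mul_neg, integral_neg, neg_inj] at h
  rw [pd_cv (contDiff_mol n) (hasCompactSupport_mol n) hη]
  exact h

/-- Classical integration by parts for the squared mollifications, then dominated convergence. On
the support of the test function the mollifications and their gradients are bounded uniformly in n,
and the gradients converge almost everywhere to the weak gradient. -/
theorem IsWeakSolution.hasWeakGradient_sq (h : IsWeakSolution V a l η) (ha : 0 < a)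
    (hV : Continuous V) {M : ℝ} (hM : ∀ᵐ x, η x ≤ M) (hgl : ∀ i, LocallyIntegrable (g i) volume)
    (hg : ∀ φ : EuclideanSpace ℝ (Fin N) → ℝ, ContDiff ℝ ∞ φ → HasCompactSupport φ →
      ∀ i, ∫ x, η x * pd i φ x = -∫ x, g i x * φ x) :
    HasWeakGradient (fun x => η x ^ 2)
      (fun x => WithLp.toLp 2 fun i => 2 * (η x * g i x)) := by
  have hM0 : 0 < M := (h.cv_pos 0 0).trans_le (h.cv_le hM 0 0)
  have hηm : AEStronglyMeasurable η volume := h.memLp.aestronglyMeasurable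
  have hcl (i) : LocallyIntegrable (fun x => 2 * (η x * g i x)) volume := by
    refine ((hgl i).smul (2 * M)).mono
      ((hηm.mul (hgl i).aestronglyMeasurable).const_mul 2) ?_
    filter_upwards [hM, h.pos] with x hx hx0
    simp only [Pi.smul_apply, smul_eq_mul, norm_mul, Real.norm_eq_abs]
    rw [abs_of_pos hx0, abs_of_pos hM0, mul_assoc]
    gcongr
  refine ⟨h.memLp.integrable_sq.locallyIntegrable, ?_, ?_⟩
  · rw [locallyIntegrable_iff]
    intro K hK
    have e : (fun x => WithLp.toLp 2 fun i => 2 * (η x * g i x)) =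
        fun x => ∑ i, (2 * (η x * g i x)) • EuclideanSpace.single i (1 : ℝ) := by
      ext x j
      simp [Finset.sum_apply, Pi.single_apply]
    rw [e]
    exact integrable_finsetSum _ fun i _ => (locallyIntegrable_iff.1 (hcl i) K hK).smul_const _
  · intro φ hφ hφc i
    obtain ⟨R, hR⟩ := hφc.isCompact.isBounded.subset_closedBall (0 : EuclideanSpace ℝ (Fin N))
    obtain ⟨S, -, hS⟩ := IsWeakSolution.exists_bound_of_continuous hV 0 (R + 2)
    set L := N * M + (M ^ 2 + S + |l|) * M / a + 1 with hL
    have hzero (x) (hx : φ x ≠ 0) : ‖x - 0‖ ≤ R := by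
      have := hR (subset_tsupport _ hx)
      rwa [mem_closedBall, dist_eq_norm] at this
    have hb (n x) : |φ x * (2 * (cv (mol N n) η x * pd i (cv (mol N n) η) x))| ≤
        |φ x| * (2 * (M * L)) := by
      by_cases hx : φ x = 0
      · simp [hx]
      · have h1 := h.abs_pd_cv_le ha hV hM hS n i (hzero x hx)
        have h2 := h.cv_le hM n x
        rw [abs_mul, abs_mul, abs_mul, abs_two, abs_of_pos (h.cv_pos n x)]
        gcongr
    have hpc : Continuous (pd i φ) := (hφ.pd i).continuous
    have hb' (n x) : |pd i φ x * cv (mol N n) η x ^ 2| ≤ |pd i φ x| * M ^ 2 := by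
      have h2 := h.cv_le hM n x
      have h3 := h.cv_pos n x
      rw [abs_mul, abs_of_nonneg (sq_nonneg (cv _ _ _))]
      gcongr
    have hφi : Integrable φ := hφ.continuous.integrable_of_hasCompactSupport hφc
    have hpi : Integrable (pd i φ) := hpc.integrable_of_hasCompactSupport (hφc.pd i)
    have hcv (n) := h.contDiff_cv n
    have t1 : Tendsto (fun n => ∫ x, pd i φ x * cv (mol N n) η x ^ 2) atTop
        (𝓝 (∫ x, pd i φ x * η x ^ 2)) := by
      refine tendsto_integral_of_dominated_convergence (fun x => |pd i φ x| * M ^ 2)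
        (fun n => (hpc.mul ((hcv n).continuous.pow 2)).aestronglyMeasurable)
        (hpi.abs.mul_const _) (fun n => Eventually.of_forall (hb' n)) ?_
      filter_upwards [h.ae_tendsto] with x hx
      exact (hx.pow 2).const_mul _
    have t2 : Tendsto (fun n => ∫ x, φ x * (2 * (cv (mol N n) η x * pd i (cv (mol N n) η) x)))
        atTop (𝓝 (∫ x, φ x * (2 * (η x * g i x)))) := by
      refine tendsto_integral_of_dominated_convergence (fun x => |φ x| * (2 * (M * L)))
        (fun n => (hφ.continuous.mul (continuous_const.mul ((hcv n).continuous.mul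
          ((hcv n).pd i).continuous))).aestronglyMeasurable)
        (hφi.abs.mul_const _) (fun n => Eventually.of_forall (hb n)) ?_
      filter_upwards [h.ae_tendsto, ae_tendsto_cv_mol (hgl i)] with x hx hx'
      rw [← funext fun n => congrFun (pd_cv_mol_eq h.locallyIntegrable hg n i) x] at hx'
      exact ((hx.mul hx').const_mul _).const_mul _
    have heq (n) : ∫ x, pd i φ x * cv (mol N n) η x ^ 2 =
        -∫ x, φ x * (2 * (cv (mol N n) η x * pd i (cv (mol N n) η) x)) := by
      have hsq : ContDiff ℝ ∞ fun x => cv (mol N n) η x ^ 2 := (hcv n).pow 2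
      have e (x) : fderiv ℝ (fun x => cv (mol N n) η x ^ 2) x (EuclideanSpace.single i 1) =
          2 * (cv (mol N n) η x * pd i (cv (mol N n) η) x) := congrFun (pd_sq (hcv n) i) x
      have j1 : Integrable fun x => φ x * (2 * (cv (mol N n) η x * pd i (cv (mol N n) η) x)) :=
        (hφ.continuous.mul (continuous_const.mul ((hcv n).continuous.mul
          ((hcv n).pd i).continuous))).integrable_of_hasCompactSupport hφc.mul_right
      have j2 : Integrable fun x => pd i φ x * cv (mol N n) η x ^ 2 :=
        (hpc.mul hsq.continuous).integrable_of_hasCompactSupport (hφc.pd i).mul_right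
      have j3 : Integrable fun x => φ x * cv (mol N n) η x ^ 2 :=
        (hφ.continuous.mul hsq.continuous).integrable_of_hasCompactSupport hφc.mul_right
      have := integral_mul_fderiv_eq_neg_fderiv_mul_of_integrable (μ := volume) (f := φ)
        (g := fun x => cv (mol N n) η x ^ 2) (v := EuclideanSpace.single i 1) j2
        (by simpa only [e] using j1) j3 (fun x _ => hφ.differentiableAt_top x)
        (fun x _ => hsq.differentiableAt_top x)
      simp only [e] at this
      rw [this, neg_neg]
      rfl
    have t3 := t2.neg
    rw [← funext heq] at t3
    exact tendsto_nhds_unique t1 t3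

end weakGradientSq

/-! ### Algebra of complex weak gradients. -/

section weakGradient
variable {N : ℕ} {v w : EuclideanSpace ℝ (Fin N) → ℂ}
  {G H : EuclideanSpace ℝ (Fin N) → EuclideanSpace ℂ (Fin N)}

theorem weakGradient_ae_eq (h : HasWeakGradient v G) : weakGradient v =ᵐ[volume] G := by
  have hex : ∃ G, HasWeakGradient v G := ⟨G, h⟩
  rw [weakGradient, dif_pos hex]
  exact hex.choose_spec.ae_eq h

theorem HasWeakGradient.locallyIntegrable_apply (h : HasWeakGradient v G) (i : Fin N) :
    LocallyIntegrable (fun x => G x i) volume := by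
  intro x
  obtain ⟨s, hs, hi⟩ := h.locallyIntegrable_grad x
  exact ⟨s, hs, (EuclideanSpace.proj (𝕜 := ℂ) i).integrable_comp hi⟩

theorem HasWeakGradient.integrable_smul (h : HasWeakGradient v G)
    {φ : EuclideanSpace ℝ (Fin N) → ℝ} (hφ : Continuous φ) (hc : HasCompactSupport φ) (i : Fin N) :
    Integrable fun x => φ x • G x i :=
  (h.locallyIntegrable_apply i).integrable_smul_left_of_hasCompactSupport hφ hc

theorem HasWeakGradient.add (hv : HasWeakGradient v G) (hw : HasWeakGradient w H) :
    HasWeakGradient (fun x => v x + w x) (fun x => G x + H x) := by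
  refine ⟨hv.locallyIntegrable.add hw.locallyIntegrable,
    hv.locallyIntegrable_grad.add hw.locallyIntegrable_grad, fun φ hφ hc i => ?_⟩
  have hφi : Continuous fun x => fderiv ℝ φ x (EuclideanSpace.single i 1) := (hφ.pd i).continuous
  have hci : HasCompactSupport fun x => fderiv ℝ φ x (EuclideanSpace.single i 1) := hc.pd i
  simp only [smul_add, PiLp.add_apply]
  rw [integral_add (hv.locallyIntegrable.integrable_smul_left_of_hasCompactSupport hφi hci)
      (hw.locallyIntegrable.integrable_smul_left_of_hasCompactSupport hφi hci),
    integral_add (hv.integrable_smul hφ.continuous hc i) (hw.integrable_smul hφ.continuous hc i),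
    hv.integral_eq φ hφ hc i, hw.integral_eq φ hφ hc i]
  ring

theorem HasWeakGradient.const_mul (hv : HasWeakGradient v G) (c : ℂ) :
    HasWeakGradient (fun x => c * v x) (fun x => c • G x) := by
  refine ⟨hv.locallyIntegrable.smul c, hv.locallyIntegrable_grad.smul c, fun φ hφ hc i => ?_⟩
  have e1 (x) : fderiv ℝ φ x (EuclideanSpace.single i 1) • (c * v x) =
      c * (fderiv ℝ φ x (EuclideanSpace.single i 1) • v x) := by
    rw [mul_smul_comm]
  have e2 (x) : φ x • (c • G x) i = c * (φ x • G x i) := by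
    rw [PiLp.smul_apply, smul_eq_mul, mul_smul_comm]
  simp only [e1, e2, integral_const_mul, hv.integral_eq φ hφ hc i, mul_neg]

/-- The classical gradient of a real function, as a complex vector field. -/
noncomputable def cgrad (f : EuclideanSpace ℝ (Fin N) → ℝ) (x : EuclideanSpace ℝ (Fin N)) :
    EuclideanSpace ℂ (Fin N) :=
  WithLp.toLp 2 fun i => (pd i f x : ℂ)

variable {f : EuclideanSpace ℝ (Fin N) → ℝ}

theorem norm_cgrad_sq (x : EuclideanSpace ℝ (Fin N)) : ‖cgrad f x‖ ^ 2 = ∑ i, pd i f x ^ 2 := by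
  rw [EuclideanSpace.norm_sq_eq]
  simp [cgrad]

theorem continuous_cgrad (hf : ContDiff ℝ ∞ f) : Continuous (cgrad f) :=
  (PiLp.continuous_toLp 2 _).comp
    (continuous_pi fun i => Complex.continuous_ofReal.comp (hf.pd i).continuous)

theorem hasCompactSupport_cgrad (hc : HasCompactSupport f) : HasCompactSupport (cgrad f) := by
  refine HasCompactSupport.intro hc.isCompact fun x hx => ?_
  have : fderiv ℝ f x = 0 :=
    image_eq_zero_of_notMem_tsupport fun h => hx (tsupport_fderiv_subset ℝ h)
  ext i
  simp [cgrad, pd, this]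

theorem hasWeakGradient_cgrad (hf : ContDiff ℝ ∞ f) (hfc : HasCompactSupport f) :
    HasWeakGradient (fun x => (f x : ℂ)) (cgrad f) := by
  refine ⟨(Complex.continuous_ofReal.comp hf.continuous).locallyIntegrable,
    (continuous_cgrad hf).locallyIntegrable, fun φ hφ hc i => ?_⟩
  have hp := (hφ.pd i).continuous
  have hpf := (hf.pd i).continuous
  have e := integral_mul_fderiv_eq_neg_fderiv_mul_of_integrable (μ := volume) (f := φ) (g := f)
    (v := EuclideanSpace.single i 1)
    ((hp.mul hf.continuous).integrable_of_hasCompactSupport hfc.mul_left)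
    ((hφ.continuous.mul hpf).integrable_of_hasCompactSupport hc.mul_right)
    ((hφ.continuous.mul hf.continuous).integrable_of_hasCompactSupport hc.mul_right)
    (fun x _ => hφ.differentiableAt_top x) (fun x _ => hf.differentiableAt_top x)
  have e1 (x) : fderiv ℝ φ x (EuclideanSpace.single i 1) • (f x : ℂ) =
      ((fderiv ℝ φ x (EuclideanSpace.single i 1) * f x : ℝ) : ℂ) := by
    rw [Complex.real_smul]; push_cast; rfl
  have e2 (x) : φ x • cgrad f x i =
      ((φ x * fderiv ℝ f x (EuclideanSpace.single i 1) : ℝ) : ℂ) := by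
    rw [Complex.real_smul]; push_cast; rfl
  simp only [e1, e2, integral_complex_ofReal, e]
  push_cast
  rw [neg_neg]

theorem HasCompactSupport.memLp_of_continuous {F : Type*} [NormedAddCommGroup F]
    {g : EuclideanSpace ℝ (Fin N) → F} (hg : Continuous g) (hc : HasCompactSupport g) :
    MemLp g 2 volume :=
  hg.memLp_of_hasCompactSupport hc

theorem HasWeakGradient.integral_re_mul_pd {η : EuclideanSpace ℝ (Fin N) → ℝ}
    (h : HasWeakGradient (fun x => (η x : ℂ)) G) {φ : EuclideanSpace ℝ (Fin N) → ℝ}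
    (hφ : ContDiff ℝ ∞ φ) (hc : HasCompactSupport φ) (i : Fin N) :
    ∫ x, η x * pd i φ x = -∫ x, (G x i).re * φ x := by
  have e := congrArg Complex.re (h.integral_eq φ hφ hc i)
  have i2 := h.integrable_smul hφ.continuous hc i
  have i1 := h.locallyIntegrable.integrable_smul_left_of_hasCompactSupport
    (hφ.pd i).continuous (hc.pd i)
  have hre1 := integral_re i1
  have hre2 := integral_re i2
  rw [Complex.neg_re] at e
  simp only [RCLike.re_to_complex] at hre1 hre2
  change (∫ x, pd i φ x • (η x : ℂ)).re = _ at e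
  rw [← hre1, ← hre2] at e
  simpa [mul_comm] using e

end weakGradient

/-! ### The energy in real integrals, and competitors. -/

section energy
variable {N : ℕ} {V : EuclideanSpace ℝ (Fin N) → ℝ} {ε m : ℝ}

theorem gpEnergy_eq (hV0 : ∀ x, 0 ≤ V x) {v : EuclideanSpace ℝ (Fin N) → ℂ}
    {G : EuclideanSpace ℝ (Fin N) → EuclideanSpace ℂ (Fin N)} (h : HasWeakGradient v G)
    (hG : MemLp G 2 volume) (hP : Integrable fun x => V x * ‖v x‖ ^ 2)
    (hQ : Integrable fun x => ‖v x‖ ^ 4) :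
    gpEnergy ε V v = ENNReal.ofReal ((∫ x, ‖G x‖ ^ 2) / 2 + 1 / (2 * ε ^ 2) *
      ((∫ x, V x * ‖v x‖ ^ 2) + 1 / 2 * ∫ x, ‖v x‖ ^ 4)) := by
  have hD : Integrable fun x => ‖G x‖ ^ 2 := hG.integrable_norm_pow (by norm_num)
  have i1 : Integrable fun x => V x * ‖v x‖ ^ 2 + 1 / 2 * ‖v x‖ ^ 4 := hP.add (hQ.const_mul _)
  have i2 : Integrable fun x => 1 / (2 * ε ^ 2) * (V x * ‖v x‖ ^ 2 + 1 / 2 * ‖v x‖ ^ 4) :=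
    i1.const_mul _
  have e : (∫ x, ‖G x‖ ^ 2) / 2 + 1 / (2 * ε ^ 2) *
      ((∫ x, V x * ‖v x‖ ^ 2) + 1 / 2 * ∫ x, ‖v x‖ ^ 4) =
      ∫ x, (‖G x‖ ^ 2 / 2 + 1 / (2 * ε ^ 2) * (V x * ‖v x‖ ^ 2 + 1 / 2 * ‖v x‖ ^ 4)) := by
    rw [integral_add (hD.div_const 2) i2, integral_div, integral_const_mul,
      integral_add hP (hQ.const_mul _), integral_const_mul]
  have i3 : Integrable fun x => ‖G x‖ ^ 2 / 2 +
      1 / (2 * ε ^ 2) * (V x * ‖v x‖ ^ 2 + 1 / 2 * ‖v x‖ ^ 4) := (hD.div_const 2).add i2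
  rw [e, ofReal_integral_eq_lintegral_ofReal i3
    (Eventually.of_forall fun x => by
      have := hV0 x
      simp only [Pi.zero_apply]
      positivity)]
  refine lintegral_congr_ae ?_
  filter_upwards [weakGradient_ae_eq h] with x hx
  rw [hx]

/-- The quartic term has weight 1/(4ε²) in the energy and the other terms are nonnegative. -/
theorem integrable_pow_four_of_gpEnergy_lt_top (hε : 0 < ε) (hV0 : ∀ x, 0 ≤ V x)
    {v : EuclideanSpace ℝ (Fin N) → ℂ} (hv : AEStronglyMeasurable v volume)
    (h : gpEnergy ε V v < ⊤) : Integrable fun x => ‖v x‖ ^ 4 := by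
  refine ⟨(hv.norm.pow 4), ?_⟩
  rw [hasFiniteIntegral_iff_norm]
  have hle : ∫⁻ x, ENNReal.ofReal ‖‖v x‖ ^ 4‖ ≤ ENNReal.ofReal (4 * ε ^ 2) * gpEnergy ε V v := by
    rw [gpEnergy, ← lintegral_const_mul' _ _ ENNReal.ofReal_ne_top]
    refine lintegral_mono fun x => ?_
    rw [← ENNReal.ofReal_mul (by positivity)]
    refine ENNReal.ofReal_le_ofReal ?_
    rw [Real.norm_of_nonneg (by positivity)]
    have h1 := mul_nonneg (hV0 x) (sq_nonneg ‖v x‖)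
    have e : 4 * ε ^ 2 * (‖weakGradient v x‖ ^ 2 / 2 +
        1 / (2 * ε ^ 2) * (V x * ‖v x‖ ^ 2 + 1 / 2 * ‖v x‖ ^ 4)) =
        2 * ε ^ 2 * ‖weakGradient v x‖ ^ 2 + 2 * (V x * ‖v x‖ ^ 2) + ‖v x‖ ^ 4 := by
      field_simp
      ring
    rw [e]
    have : 0 ≤ 2 * ε ^ 2 * ‖weakGradient v x‖ ^ 2 := by positivity
    linarith
  exact hle.trans_lt (ENNReal.mul_lt_top ENNReal.ofReal_lt_top h)

/-- An admissible real competitor `v` with weak gradient `H` and finite energy. -/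
structure IsCompetitor (V : EuclideanSpace ℝ (Fin N) → ℝ) (m : ℝ)
    (v : EuclideanSpace ℝ (Fin N) → ℝ)
    (H : EuclideanSpace ℝ (Fin N) → EuclideanSpace ℂ (Fin N)) : Prop where
  hasWeakGradient : HasWeakGradient (fun x => (v x : ℂ)) H
  memLp_grad : MemLp H 2 volume
  memLp : MemLp v 2 volume
  potential : Integrable fun x => V x * v x ^ 2
  pow_four : Integrable fun x => v x ^ 4
  mass : ∫ x, v x ^ 2 = m

namespace IsCompetitor
variable {v : EuclideanSpace ℝ (Fin N) → ℝ}
  {H : EuclideanSpace ℝ (Fin N) → EuclideanSpace ℂ (Fin N)}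

theorem norm_ofReal_sq (t : ℝ) : ‖(t : ℂ)‖ ^ 2 = t ^ 2 := by simp

theorem norm_ofReal_four (t : ℝ) : ‖(t : ℂ)‖ ^ 4 = t ^ 4 := by
  rw [Complex.norm_real, Real.norm_eq_abs]
  exact Even.pow_abs (by decide) t

theorem memHm (h : IsCompetitor V m v H) : MemHm V m (fun x => (v x : ℂ)) where
  memH1 := ⟨h.memLp.ofReal, H, h.hasWeakGradient, h.memLp_grad⟩
  potential := by simpa only [norm_ofReal_sq] using h.potential
  mass := by simpa only [norm_ofReal_sq] using h.mass

theorem gpEnergy_eq (hV0 : ∀ x, 0 ≤ V x) (h : IsCompetitor V m v H) :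
    gpEnergy ε V (fun x => (v x : ℂ)) = ENNReal.ofReal ((∫ x, ‖H x‖ ^ 2) / 2 + 1 / (2 * ε ^ 2) *
      ((∫ x, V x * v x ^ 2) + 1 / 2 * ∫ x, v x ^ 4)) := by
  have := _root_.gpEnergy_eq (ε := ε) hV0 h.hasWeakGradient h.memLp_grad
    (by simpa only [norm_ofReal_sq] using h.potential)
    (by simpa only [norm_ofReal_four] using h.pow_four)
  simpa only [norm_ofReal_sq, norm_ofReal_four] using this

end IsCompetitor

namespace IsPositiveMinimizer
variable {η v : EuclideanSpace ℝ (Fin N) → ℝ}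
  {G H : EuclideanSpace ℝ (Fin N) → EuclideanSpace ℂ (Fin N)}

/-- Membership in 𝓗_m does not include integrability of the fourth power. For a minimizer it follows
from finite energy, which comparison with any one competitor supplies. -/
theorem exists_isCompetitor (h : IsPositiveMinimizer ε V m η) (hε : 0 < ε) (hV0 : ∀ x, 0 ≤ V x)
    (hv : IsCompetitor V m v H) : ∃ G, IsCompetitor V m η G := by
  obtain ⟨hη, G, hG, hG2⟩ := h.mem.memH1
  have hfin : gpEnergy ε V (fun x => (η x : ℂ)) < ⊤ := by
    refine (h.le _ hv.memHm).trans_lt ?_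
    rw [hv.gpEnergy_eq hV0]
    exact ENNReal.ofReal_lt_top
  have h4 := integrable_pow_four_of_gpEnergy_lt_top hε hV0 hη.aestronglyMeasurable hfin
  exact ⟨G, hG, hG2, hη.re, by simpa only [IsCompetitor.norm_ofReal_sq] using h.mem.potential,
    by simpa only [IsCompetitor.norm_ofReal_four] using h4,
    by simpa only [IsCompetitor.norm_ofReal_sq] using h.mem.mass⟩

theorem energy_le (h : IsPositiveMinimizer ε V m η) (hε : 0 < ε) (hV0 : ∀ x, 0 ≤ V x)
    (hη : IsCompetitor V m η G) (hv : IsCompetitor V m v H) :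
    ε ^ 2 * (∫ x, ‖G x‖ ^ 2) + (∫ x, V x * η x ^ 2) + 1 / 2 * ∫ x, η x ^ 4 ≤
      ε ^ 2 * (∫ x, ‖H x‖ ^ 2) + (∫ x, V x * v x ^ 2) + 1 / 2 * ∫ x, v x ^ 4 := by
  have h1 := h.le _ hv.memHm
  have h2 : 0 ≤ ∫ x, ‖H x‖ ^ 2 := integral_nonneg fun x => by positivity
  have h3 : 0 ≤ ∫ x, V x * v x ^ 2 := integral_nonneg fun x => mul_nonneg (hV0 x) (sq_nonneg _)
  have h4 : 0 ≤ ∫ x, v x ^ 4 := integral_nonneg fun x => by positivity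
  rw [hη.gpEnergy_eq hV0, hv.gpEnergy_eq hV0, ENNReal.ofReal_le_ofReal_iff (by positivity)] at h1
  have h5 := mul_le_mul_of_nonneg_left h1 (by positivity : 0 ≤ 2 * ε ^ 2)
  have e (D P Q : ℝ) : 2 * ε ^ 2 * (D / 2 + 1 / (2 * ε ^ 2) * (P + 1 / 2 * Q)) =
      ε ^ 2 * D + P + 1 / 2 * Q := by
    field_simp
    ring
  rwa [e, e] at h5

end IsPositiveMinimizer

end energy

/-! ### The Euler–Lagrange equation. -/

section eulerLagrange
variable {N : ℕ} {V : EuclideanSpace ℝ (Fin N) → ℝ} {ε m : ℝ}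
  {η φ : EuclideanSpace ℝ (Fin N) → ℝ}
  {G : EuclideanSpace ℝ (Fin N) → EuclideanSpace ℂ (Fin N)}

theorem IsCompetitor.locallyIntegrable_cube (h : IsCompetitor V m η G) :
    LocallyIntegrable (fun x => η x ^ 3) volume := by
  have hi : Integrable fun x => η x ^ 2 + η x ^ 4 := h.memLp.integrable_sq.add h.pow_four
  refine (hi.mono' (h.memLp.aestronglyMeasurable.pow 3)
    (Eventually.of_forall fun x => ?_)).locallyIntegrable
  simp only [Pi.pow_apply, norm_pow, Real.norm_eq_abs]
  rw [← sq_abs (η x), ← Even.pow_abs (by decide : Even 4) (η x)]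
  nlinarith [mul_nonneg (sq_nonneg (|η x|)) (sq_nonneg (|η x| - 1)), sq_nonneg (|η x|),
    sq_nonneg (|η x| ^ 2)]

theorem norm_add_smul_cgrad_sq (z : EuclideanSpace ℂ (Fin N)) (t : ℝ)
    (x : EuclideanSpace ℝ (Fin N)) : ‖z + (t : ℂ) • cgrad φ x‖ ^ 2 =
      ‖z‖ ^ 2 + 2 * t * (∑ i, (z i).re * pd i φ x) + t ^ 2 * ∑ i, pd i φ x ^ 2 := by
  rw [EuclideanSpace.norm_sq_eq, EuclideanSpace.norm_sq_eq, Finset.mul_sum, Finset.mul_sum,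
    ← Finset.sum_add_distrib, ← Finset.sum_add_distrib]
  refine Finset.sum_congr rfl fun i _ => ?_
  simp only [PiLp.add_apply, PiLp.smul_apply, cgrad, smul_eq_mul, Complex.sq_norm,
    Complex.normSq_apply, Complex.add_re, Complex.add_im, Complex.mul_re, Complex.mul_im,
    Complex.ofReal_re, Complex.ofReal_im]
  ring

theorem integrable_mul_of_hasCompactSupport {f ψ : EuclideanSpace ℝ (Fin N) → ℝ}
    (hf : LocallyIntegrable f volume) (hψ : Continuous ψ) (hc : HasCompactSupport ψ) :
    Integrable fun x => f x * ψ x := by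
  have := hf.integrable_smul_left_of_hasCompactSupport hψ hc
  simpa [mul_comm] using this

theorem integrable_sq_of_hasCompactSupport {ψ : EuclideanSpace ℝ (Fin N) → ℝ}
    (hψ : Continuous ψ) (hc : HasCompactSupport ψ) : Integrable fun x => ψ x ^ 2 :=
  (hc.memLp_of_continuous hψ).integrable_sq

/-- The scaled perturbations `c (η + t φ)` of `η` are competitors, with explicit energies. -/
theorem IsCompetitor.perturb (h : IsCompetitor V m η G) (hV : Continuous V) (hφ : ContDiff ℝ ∞ φ)
    (hφc : HasCompactSupport φ) :
    ∃ b q P₁ P₂ Q₂ Q₃ Q₄ D₂ : ℝ, b = ∫ x, η x * φ x ∧ P₁ = ∫ x, V x * η x * φ x ∧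
      ∀ c t : ℝ, ∃ (v : EuclideanSpace ℝ (Fin N) → ℝ)
        (H : EuclideanSpace ℝ (Fin N) → EuclideanSpace ℂ (Fin N)),
        IsCompetitor V (c ^ 2 * (m + 2 * t * b + t ^ 2 * q)) v H ∧
        ∫ x, ‖H x‖ ^ 2 = c ^ 2 * ((∫ x, ‖G x‖ ^ 2) - 2 * t * (∫ x, η x * lap φ x) + t ^ 2 * D₂) ∧
        ∫ x, V x * v x ^ 2 = c ^ 2 * ((∫ x, V x * η x ^ 2) + 2 * t * P₁ + t ^ 2 * P₂) ∧
        ∫ x, v x ^ 4 = c ^ 4 * ((∫ x, η x ^ 4) + 4 * t * (∫ x, η x ^ 3 * φ x) + t ^ 2 * Q₂ +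
          t ^ 3 * Q₃ + t ^ 4 * Q₄) := by
  have hφ0 := hφ.continuous
  have hηl : LocallyIntegrable η volume := h.memLp.locallyIntegrable (by norm_num)
  have hη2 : Integrable fun x => η x ^ 2 := h.memLp.integrable_sq
  have ib : Integrable fun x => η x * φ x := integrable_mul_of_hasCompactSupport hηl hφ0 hφc
  have iq : Integrable fun x => φ x ^ 2 := integrable_sq_of_hasCompactSupport hφ0 hφc
  have iP1 : Integrable fun x => V x * η x * φ x := by
    have := integrable_mul_of_hasCompactSupport hηl (hV.mul hφ0) (hφc.mul_left (f := V))
    refine this.congr (Eventually.of_forall fun x => by simp only [Pi.mul_apply]; ring)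
  have iP2 : Integrable fun x => V x * φ x ^ 2 := by
    have := (hV.mul (hφ0.mul hφ0)).integrable_of_hasCompactSupport (μ := volume)
      (HasCompactSupport.mul_left (f := V) (hφc.mul_right (f := φ) (f' := φ)))
    refine this.congr (Eventually.of_forall fun x => by simp only [Pi.mul_apply]; ring)
  have iQ1 : Integrable fun x => η x ^ 3 * φ x :=
    integrable_mul_of_hasCompactSupport h.locallyIntegrable_cube hφ0 hφc
  have iQ2 : Integrable fun x => η x ^ 2 * (φ x * φ x) :=
    integrable_mul_of_hasCompactSupport hη2.locallyIntegrable (hφ0.mul hφ0)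
      (hφc.mul_right (f := φ) (f' := φ))
  have iQ3 : Integrable fun x => η x * (φ x * (φ x * φ x)) :=
    integrable_mul_of_hasCompactSupport hηl (hφ0.mul (hφ0.mul hφ0))
      (hφc.mul_right (f := φ) (f' := fun x => φ x * φ x))
  have iQ4 : Integrable fun x => φ x * (φ x * (φ x * φ x)) :=
    integrable_mul_of_hasCompactSupport hφ0.locallyIntegrable (hφ0.mul (hφ0.mul hφ0))
      (hφc.mul_right (f := φ) (f' := fun x => φ x * φ x))
  have hgl (i) : LocallyIntegrable (fun x => (G x i).re) volume := by
    intro x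
    obtain ⟨s, hs, hi⟩ := h.hasWeakGradient.locallyIntegrable_apply i x
    exact ⟨s, hs, hi.re⟩
  have iD1' (i) : Integrable fun x => (G x i).re * pd i φ x :=
    integrable_mul_of_hasCompactSupport (hgl i) (hφ.pd i).continuous (hφc.pd i)
  have iD1 : Integrable fun x => ∑ i, (G x i).re * pd i φ x :=
    integrable_finsetSum _ fun i _ => iD1' i
  have iD2 : Integrable fun x => ∑ i, pd i φ x ^ 2 := 
    integrable_finsetSum _ fun i _ =>
      integrable_sq_of_hasCompactSupport (hφ.pd i).continuous (hφc.pd i)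
  have hD : Integrable fun x => ‖G x‖ ^ 2 := h.memLp_grad.integrable_norm_pow (by norm_num)
  -- The weak gradient of η is moved onto φ, so the first variation contains η only against Δφ, as
  -- in the distributional equation.
  have eD1 : ∫ x, ∑ i, (G x i).re * pd i φ x = -∫ x, η x * lap φ x := by
    have il (i) : Integrable fun x => η x * pd i (pd i φ) x :=
      integrable_mul_of_hasCompactSupport hηl ((hφ.pd i).pd i).continuous ((hφc.pd i).pd i)
    simp only [lap, Finset.mul_sum]
    rw [integral_finsetSum _ fun i _ => iD1' i, integral_finsetSum _ fun i _ => il i,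
      ← Finset.sum_neg_distrib]
    refine Finset.sum_congr rfl fun i _ => ?_
    rw [h.hasWeakGradient.integral_re_mul_pd (hφ.pd i) (hφc.pd i), neg_neg]
  refine ⟨_, ∫ x, φ x ^ 2, _, ∫ x, V x * φ x ^ 2, 6 * ∫ x, η x ^ 2 * (φ x * φ x),
    4 * ∫ x, η x * (φ x * (φ x * φ x)), ∫ x, φ x * (φ x * (φ x * φ x)),
    ∫ x, ∑ i, pd i φ x ^ 2, rfl, rfl, fun c t => ⟨fun x => c * (η x + t * φ x),
    fun x => (c : ℂ) • (G x + (t : ℂ) • cgrad φ x), ?_⟩⟩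
  have em (x) : (c * (η x + t * φ x)) ^ 2 =
      c ^ 2 * (η x ^ 2 + 2 * t * (η x * φ x) + t ^ 2 * φ x ^ 2) := by ring
  have eP (x) : V x * (c * (η x + t * φ x)) ^ 2 =
      c ^ 2 * (V x * η x ^ 2 + 2 * t * (V x * η x * φ x) + t ^ 2 * (V x * φ x ^ 2)) := by ring
  have eQ (x) : (c * (η x + t * φ x)) ^ 4 =
      c ^ 4 * (η x ^ 4 + 4 * t * (η x ^ 3 * φ x) + t ^ 2 * (6 * (η x ^ 2 * (φ x * φ x))) +
        t ^ 3 * (4 * (η x * (φ x * (φ x * φ x)))) + t ^ 4 * (φ x * (φ x * (φ x * φ x)))) := by ring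
  have eD (x) : ‖(c : ℂ) • (G x + (t : ℂ) • cgrad φ x)‖ ^ 2 = c ^ 2 * (‖G x‖ ^ 2 +
      2 * t * (∑ i, (G x i).re * pd i φ x) + t ^ 2 * ∑ i, pd i φ x ^ 2) := by
    rw [norm_smul, mul_pow, norm_add_smul_cgrad_sq]
    simp
  have jm1 : Integrable fun x => η x ^ 2 + 2 * t * (η x * φ x) := hη2.add (ib.const_mul _)
  have jP1 : Integrable fun x => V x * η x ^ 2 + 2 * t * (V x * η x * φ x) :=
    h.potential.add (iP1.const_mul _)
  have jP2 : Integrable fun x =>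
      V x * η x ^ 2 + 2 * t * (V x * η x * φ x) + t ^ 2 * (V x * φ x ^ 2) :=
    jP1.add (iP2.const_mul _)
  have jQ1 : Integrable fun x => η x ^ 4 + 4 * t * (η x ^ 3 * φ x) :=
    h.pow_four.add (iQ1.const_mul _)
  have jQ2 : Integrable fun x => η x ^ 4 + 4 * t * (η x ^ 3 * φ x) +
      t ^ 2 * (6 * (η x ^ 2 * (φ x * φ x))) := jQ1.add ((iQ2.const_mul _).const_mul _)
  have jQ3 : Integrable fun x => η x ^ 4 + 4 * t * (η x ^ 3 * φ x) +
      t ^ 2 * (6 * (η x ^ 2 * (φ x * φ x))) + t ^ 3 * (4 * (η x * (φ x * (φ x * φ x)))) :=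
    jQ2.add ((iQ3.const_mul _).const_mul _)
  have jQ4 : Integrable fun x => η x ^ 4 + 4 * t * (η x ^ 3 * φ x) +
      t ^ 2 * (6 * (η x ^ 2 * (φ x * φ x))) + t ^ 3 * (4 * (η x * (φ x * (φ x * φ x)))) +
      t ^ 4 * (φ x * (φ x * (φ x * φ x))) := jQ3.add (iQ4.const_mul _)
  have jD1 : Integrable fun x => ‖G x‖ ^ 2 + 2 * t * (∑ i, (G x i).re * pd i φ x) :=
    hD.add (iD1.const_mul _)
  refine ⟨⟨?_, ?_, ?_, ?_, ?_, ?_⟩, ?_, ?_, ?_⟩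
  · have := (h.hasWeakGradient.add ((hasWeakGradient_cgrad hφ hφc).const_mul (t : ℂ))).const_mul
      (c : ℂ)
    simpa using this
  · exact (h.memLp_grad.add ((HasCompactSupport.memLp_of_continuous (continuous_cgrad hφ)
      (hasCompactSupport_cgrad hφc)).const_smul (t : ℂ))).const_smul (c : ℂ)
  · exact (h.memLp.add ((HasCompactSupport.memLp_of_continuous hφ0 hφc).const_mul t)).const_mul c
  · simp only [eP]
    exact jP2.const_mul _
  · simp only [eQ]
    exact jQ4.const_mul _
  · simp only [em]
    rw [integral_const_mul, integral_add jm1 (iq.const_mul _), integral_add hη2 (ib.const_mul _),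
      integral_const_mul, integral_const_mul, h.mass]
  · simp only [eD]
    rw [integral_const_mul, integral_add jD1 (iD2.const_mul _), integral_add hD (iD1.const_mul _),
      integral_const_mul, integral_const_mul, eD1]
    ring
  · simp only [eP]
    rw [integral_const_mul, integral_add jP1 (iP2.const_mul _),
      integral_add h.potential (iP1.const_mul _), integral_const_mul, integral_const_mul]
  · simp only [eQ]
    rw [integral_const_mul, integral_add jQ3 (iQ4.const_mul _),
      integral_add jQ2 ((iQ3.const_mul _).const_mul _),
      integral_add jQ1 ((iQ2.const_mul _).const_mul _), integral_add h.pow_four (iQ1.const_mul _)]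
    simp only [integral_const_mul]

/-- First-order condition at `t = 0` for the energies of the normalized perturbations. -/
theorem firstOrder_eq {m b q A₀ A₁ A₂ Q₀ Q₁ Q₂ Q₃ Q₄ : ℝ} (hm : 0 < m)
    (h : ∀ᶠ t in 𝓝 (0 : ℝ), 0 ≤ m * (m + 2 * t * b + t ^ 2 * q) * (A₀ + 2 * t * A₁ + t ^ 2 * A₂) +
      m ^ 2 / 2 * (Q₀ + 4 * t * Q₁ + t ^ 2 * Q₂ + t ^ 3 * Q₃ + t ^ 4 * Q₄) -
      (A₀ + 1 / 2 * Q₀) * (m + 2 * t * b + t ^ 2 * q) ^ 2) :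
    A₁ + Q₁ = (A₀ + Q₀) / m * b := by
  -- The energy inequality with denominators cleared. The polynomial p vanishes at 0 and is
  -- nonnegative nearby, so p'(0) = 0.
  set p : ℝ → ℝ := fun t =>
    m * (m + 2 * t * b + t ^ 2 * q) * (A₀ + 2 * t * A₁ + t ^ 2 * A₂) +
      m ^ 2 / 2 * (Q₀ + 4 * t * Q₁ + t ^ 2 * Q₂ + t ^ 3 * Q₃ + t ^ 4 * Q₄) -
      (A₀ + 1 / 2 * Q₀) * (m + 2 * t * b + t ^ 2 * q) ^ 2 with hp
  have hp0 : p 0 = 0 := by simp only [hp]; ring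
  have hmin : IsLocalMin p 0 := by
    filter_upwards [h] with t ht
    rw [hp0]
    exact ht
  have hid := hasDerivAt_id (0 : ℝ)
  have hq2 (a₀ a₁ a₂ : ℝ) : HasDerivAt (fun t : ℝ => a₀ + 2 * t * a₁ + t ^ 2 * a₂) (2 * a₁) 0 := by
    have := (((hid.const_mul 2).mul_const a₁).const_add a₀).add
      ((hasDerivAt_pow 2 (0 : ℝ)).mul_const a₂)
    exact this.congr_deriv (by simp)
  have hq4 : HasDerivAt (fun t : ℝ => Q₀ + 4 * t * Q₁ + t ^ 2 * Q₂ + t ^ 3 * Q₃ + t ^ 4 * Q₄)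
      (4 * Q₁) 0 := by
    have := (((((hid.const_mul 4).mul_const Q₁).const_add Q₀).add
      ((hasDerivAt_pow 2 (0 : ℝ)).mul_const Q₂)).add
      ((hasDerivAt_pow 3 (0 : ℝ)).mul_const Q₃)).add ((hasDerivAt_pow 4 (0 : ℝ)).mul_const Q₄)
    exact this.congr_deriv (by simp)
  have hd : HasDerivAt p (m * (2 * b) * A₀ + m * m * (2 * A₁) + m ^ 2 / 2 * (4 * Q₁) -
      (A₀ + 1 / 2 * Q₀) * (2 * m * (2 * b))) 0 := by
    have := ((((hq2 m b q).const_mul m).mul (hq2 A₀ A₁ A₂)).add (hq4.const_mul (m ^ 2 / 2))).sub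
      (((hq2 m b q).pow 2).const_mul (A₀ + 1 / 2 * Q₀))
    exact this.congr_deriv (by simp)
  have h0 := hmin.hasDerivAt_eq_zero hd
  have h1 : m * (A₁ + Q₁) = (A₀ + Q₀) * b := by
    have : 2 * m * (m * (A₁ + Q₁) - (A₀ + Q₀) * b) = 0 := by linarith
    have := (mul_eq_zero.1 this).resolve_left (by positivity)
    linarith
  field_simp
  linarith

/-- First variation among mass-preserving perturbations. The multiplier takes the explicit value
that testing the equation with η itself would give, and the estimates of l start from it. -/
theorem IsPositiveMinimizer.isWeakSolution (h : IsPositiveMinimizer ε V m η) (hε : 0 < ε)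
    (hm : 0 < m) (hV : Continuous V) (hV0 : ∀ x, 0 ≤ V x) (hη : IsCompetitor V m η G) :
    IsWeakSolution V (ε ^ 2)
      ((ε ^ 2 * (∫ x, ‖G x‖ ^ 2) + (∫ x, V x * η x ^ 2) + ∫ x, η x ^ 4) / m) η := by
  refine ⟨h.pos, hη.memLp, hη.locallyIntegrable_cube, fun φ hφ hφc => ?_⟩
  obtain ⟨b, q, P₁, P₂, Q₂, Q₃, Q₄, D₂, hb, hP₁, hpert⟩ := hη.perturb hV hφ hφc
  set D₀ := ∫ x, ‖G x‖ ^ 2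
  set P₀ := ∫ x, V x * η x ^ 2
  set Q₀ := ∫ x, η x ^ 4
  set Q₁ := ∫ x, η x ^ 3 * φ x with hQ₁
  set E₁ := ∫ x, η x * lap φ x
  have hpos : ∀ᶠ t in 𝓝 (0 : ℝ), 0 < m + 2 * t * b + t ^ 2 * q := by
    have hc : ContinuousAt (fun t : ℝ => m + 2 * t * b + t ^ 2 * q) 0 := by fun_prop
    exact hc.eventually (lt_mem_nhds (by simpa using hm))
  have key := firstOrder_eq (A₀ := ε ^ 2 * D₀ + P₀) (A₁ := -(ε ^ 2 * E₁) + P₁)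
    (A₂ := ε ^ 2 * D₂ + P₂) (Q₀ := Q₀) (Q₁ := Q₁) (Q₂ := Q₂) (Q₃ := Q₃) (Q₄ := Q₄) (b := b) (q := q)
    hm (by
      filter_upwards [hpos] with t ht
      set n := m + 2 * t * b + t ^ 2 * q with hn
      -- The factor √(m/n) restores the mass m, n being the mass of η + tφ.
      obtain ⟨v, H, hv, e1, e2, e3⟩ := hpert (Real.sqrt (m / n)) t
      have hs : Real.sqrt (m / n) ^ 2 = m / n := Real.sq_sqrt (by positivity)
      have hs4 : Real.sqrt (m / n) ^ 4 = (m / n) ^ 2 := by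
        rw [show (4 : ℕ) = 2 * 2 from rfl, pow_mul, hs]
      rw [hs, ← hn, div_mul_cancel₀ _ ht.ne'] at hv
      have hle := h.energy_le hε hV0 hη hv
      rw [e1, e2, e3, hs, hs4] at hle
      have h2 := mul_le_mul_of_nonneg_right hle (sq_nonneg n)
      have e : (ε ^ 2 * (m / n * (D₀ - 2 * t * E₁ + t ^ 2 * D₂)) +
          m / n * (P₀ + 2 * t * P₁ + t ^ 2 * P₂) + 1 / 2 * ((m / n) ^ 2 * (Q₀ + 4 * t * Q₁ +
          t ^ 2 * Q₂ + t ^ 3 * Q₃ + t ^ 4 * Q₄))) * n ^ 2 =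
          m * n * (ε ^ 2 * D₀ + P₀ + 2 * t * (-(ε ^ 2 * E₁) + P₁) + t ^ 2 * (ε ^ 2 * D₂ + P₂)) +
          m ^ 2 / 2 * (Q₀ + 4 * t * Q₁ + t ^ 2 * Q₂ + t ^ 3 * Q₃ + t ^ 4 * Q₄) := by
        field_simp
        ring
      rw [e] at h2
      linarith)
  have hηl : LocallyIntegrable η volume := hη.memLp.locallyIntegrable (by norm_num)
  have ib : Integrable fun x => η x * φ x :=
    integrable_mul_of_hasCompactSupport hηl hφ.continuous hφc
  have iQ1 : Integrable fun x => η x ^ 3 * φ x :=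
    integrable_mul_of_hasCompactSupport hη.locallyIntegrable_cube hφ.continuous hφc
  have iP1 : Integrable fun x => V x * η x * φ x := by
    have := integrable_mul_of_hasCompactSupport hηl (hV.mul hφ.continuous) (hφc.mul_left (f := V))
    refine this.congr (Eventually.of_forall fun x => by simp only [Pi.mul_apply]; ring)
  set l := (ε ^ 2 * D₀ + P₀ + Q₀) / m
  have e (x) : (η x ^ 2 + V x - l) * η x * φ x =
      (η x ^ 3 * φ x + V x * η x * φ x) - l * (η x * φ x) := by ring
  have i2 : Integrable fun x => η x ^ 3 * φ x + V x * η x * φ x := iQ1.add iP1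
  simp only [e]
  rw [integral_sub i2 (ib.const_mul _), integral_add iQ1 iP1, integral_const_mul, ← hb, ← hP₁,
    ← hQ₁]
  linarith

end eulerLagrange

/-! ### A smooth square-root profile. -/

section profile

/-- A smooth substitute for `s ↦ √(s⁺)`. -/
theorem exists_smooth_sqrt_profile : ∃ (h : ℝ → ℝ) (C : ℝ), 0 < C ∧ ContDiff ℝ ∞ h ∧
    (∀ s ≤ 0, h s = 0) ∧ (∀ s, |h s ^ 2 - max s 0| ≤ C) ∧ ∀ s, |deriv h s| ≤ C := by
  -- For s ≥ 0, r² = √(1 + s²) lies between s and s + 1, and r has bounded derivative. The smooth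
  -- transition cuts it off at s = 0.
  set r : ℝ → ℝ := fun s => Real.sqrt (Real.sqrt (1 + s ^ 2)) with hr
  have hpos (s : ℝ) : 0 < 1 + s ^ 2 := by positivity
  have hrs : ContDiff ℝ ∞ r :=
    ((contDiff_const.add (contDiff_id.pow 2)).sqrt fun s => (hpos s).ne').sqrt
      fun s => (Real.sqrt_pos.2 (hpos s)).ne'
  set h : ℝ → ℝ := fun s => Real.smoothTransition s * r s with hh
  have hhs : ContDiff ℝ ∞ h := Real.smoothTransition.contDiff.mul hrs
  have hr2 (s) : r s ^ 2 = Real.sqrt (1 + s ^ 2) := Real.sq_sqrt (Real.sqrt_nonneg _)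
  have h0 : ∀ s ≤ 0, h s = 0 := fun s hs => by
    simp [hh, Real.smoothTransition.zero_of_nonpos hs]
  -- Compactness handles the transition zone. To its left the profile vanishes, to its right it
  -- equals r.
  obtain ⟨B, hB⟩ := (isCompact_Icc (a := (-1 : ℝ)) (b := 2)).exists_bound_of_continuousOn
    (hhs.continuous_deriv (by simp)).continuousOn
  refine ⟨h, max B 2, by positivity, hhs, h0, fun s => le_trans ?_ (le_max_right _ _), fun s => ?_⟩
  · rcases le_total s 0 with hs | hs
    · simp [h0 s hs, hs]
    · rw [max_eq_left hs]
      have e : h s ^ 2 = Real.smoothTransition s ^ 2 * Real.sqrt (1 + s ^ 2) := by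
        simp only [hh, mul_pow, hr2]
      have h1 : s ≤ Real.sqrt (1 + s ^ 2) := Real.le_sqrt_of_sq_le (by linarith)
      have h2 : Real.sqrt (1 + s ^ 2) ≤ 1 + s := by
        rw [Real.sqrt_le_left (by linarith)]; nlinarith
      rw [e]
      rcases le_total 1 s with hs1 | hs1
      · rw [Real.smoothTransition.one_of_one_le hs1, abs_le]
        constructor <;> linarith
      · have h3 := Real.smoothTransition.nonneg s
        have h4 := Real.smoothTransition.le_one s
        have h5 : Real.smoothTransition s ^ 2 ≤ 1 := pow_le_one₀ h3 h4
        have h6 : 0 ≤ Real.sqrt (1 + s ^ 2) := Real.sqrt_nonneg _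
        have h7 : Real.smoothTransition s ^ 2 * Real.sqrt (1 + s ^ 2) ≤
          1 * Real.sqrt (1 + s ^ 2) := by gcongr
        have h8 : 0 ≤ Real.smoothTransition s ^ 2 * Real.sqrt (1 + s ^ 2) := by positivity
        rw [abs_le]
        constructor <;> linarith
  · by_cases hs : s ∈ Icc (-1 : ℝ) 2
    · exact (hB s hs).trans (le_max_left _ _)
    · refine le_trans ?_ (le_max_right _ _)
      rcases lt_or_ge s (-1) with hs1 | hs1
      · have : h =ᶠ[𝓝 s] fun _ => 0 := by
          filter_upwards [Iio_mem_nhds (show s < 0 by linarith)] with t ht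
          exact h0 t (le_of_lt ht)
        rw [this.deriv_eq]
        simp
      · have hs2 : 2 < s := by
          by_contra hcon
          exact hs ⟨hs1, not_lt.1 hcon⟩
        have : h =ᶠ[𝓝 s] r := by
          filter_upwards [Ioi_mem_nhds (show 1 < s by linarith)] with t ht
          simp [hh, Real.smoothTransition.one_of_one_le (le_of_lt ht)]
        rw [this.deriv_eq]
        have hd : HasDerivAt r _ s :=
          ((((hasDerivAt_pow 2 s).const_add 1).sqrt (hpos s).ne').sqrt
            (Real.sqrt_pos.2 (hpos s)).ne')
        rw [hd.deriv]
        have h1 : s ≤ Real.sqrt (1 + s ^ 2) := Real.le_sqrt_of_sq_le (by linarith)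
        have h2 : 1 ≤ Real.sqrt (Real.sqrt (1 + s ^ 2)) := by
          rw [Real.one_le_sqrt, Real.one_le_sqrt]; nlinarith
        have h3 : (((2 : ℕ) : ℝ) * s ^ (2 - 1)) / (2 * Real.sqrt (1 + s ^ 2)) ≤ 1 := by
          rw [div_le_one (by linarith)]; norm_num; linarith
        have h4 : 0 ≤ (((2 : ℕ) : ℝ) * s ^ (2 - 1)) / (2 * Real.sqrt (1 + s ^ 2)) := by positivity
        rw [abs_of_nonneg (by positivity), div_le_iff₀ (by positivity)]
        linarith

end profile

/-! ### Thomas–Fermi profile: energy splitting and good competitors. -/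

section thomasFermi
variable {N : ℕ} {V : EuclideanSpace ℝ (Fin N) → ℝ} {lam m : ℝ}

theorem isCompact_sublevel (hV : Continuous V)
    (hlim : Tendsto V (cocompact (EuclideanSpace ℝ (Fin N))) atTop) (s : ℝ) :
    IsCompact {x | V x ≤ s} := by
  have h := hlim.eventually (eventually_gt_atTop s)
  obtain ⟨K, hK, hsub⟩ := mem_cocompact.1 h
  refine hK.of_isClosed_subset (isClosed_le hV continuous_const) fun x (hx : V x ≤ s) => ?_
  by_contra hxK
  exact absurd (hsub hxK : s < V x) (not_lt.2 hx)

theorem continuous_rhoTF (hV : Continuous V) : Continuous (rhoTF V lam) :=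
  (continuous_const.sub hV).max continuous_const

theorem rhoTF_eq_zero {x : EuclideanSpace ℝ (Fin N)} (hx : lam < V x) : rhoTF V lam x = 0 :=
  max_eq_right (by linarith)

theorem hasCompactSupport_rhoTF (hV : Continuous V)
    (hlim : Tendsto V (cocompact (EuclideanSpace ℝ (Fin N))) atTop) :
    HasCompactSupport (rhoTF V lam) :=
  HasCompactSupport.intro (isCompact_sublevel hV hlim lam) fun x (hx : ¬ V x ≤ lam) =>
    rhoTF_eq_zero (not_le.1 hx)

/-- Optimality and complementary slackness for the Thomas–Fermi problem: the source of both integral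
identities below. -/
theorem thomasFermi_identity (x : EuclideanSpace ℝ (Fin N)) :
    V x + rhoTF V lam x = lam + max (V x - lam) 0 ∧ max (V x - lam) 0 * rhoTF V lam x = 0 := by
  rw [rhoTF]
  rcases le_total (V x) lam with h | h
  · rw [max_eq_left (by linarith), max_eq_right (by linarith)]
    constructor <;> ring
  · rw [max_eq_right (by linarith), max_eq_left (by linarith)]
    constructor <;> ring

namespace IsCompetitor
variable {v : EuclideanSpace ℝ (Fin N) → ℝ}
  {H : EuclideanSpace ℝ (Fin N) → EuclideanSpace ℂ (Fin N)}

theorem integrable_sq_sub_rhoTF_sq (h : IsCompetitor V m v H) (hV : Continuous V)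
    (hlim : Tendsto V (cocompact (EuclideanSpace ℝ (Fin N))) atTop) :
    Integrable fun x => (v x ^ 2 - rhoTF V lam x) ^ 2 := by
  have hρ2 := integrable_sq_of_hasCompactSupport (continuous_rhoTF (lam := lam) hV)
    (hasCompactSupport_rhoTF hV hlim)
  refine ((h.pow_four.add hρ2).const_mul 2).mono'
    (((h.memLp.aestronglyMeasurable.pow 2).sub
      (continuous_rhoTF hV).aestronglyMeasurable).pow 2) (Eventually.of_forall fun x => ?_)
  simp only [Pi.add_apply]
  rw [Real.norm_of_nonneg (sq_nonneg _)]
  nlinarith [sq_nonneg (v x ^ 2 + rhoTF V lam x)]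

theorem integrable_excess (h : IsCompetitor V m v H) (hV : Continuous V) (hV0 : ∀ x, 0 ≤ V x) :
    Integrable fun x => max (V x - lam) 0 * v x ^ 2 := by
  refine (h.potential.add (h.memLp.integrable_sq.const_mul |lam|)).mono'
    ((((hV.sub continuous_const).max continuous_const).aestronglyMeasurable).mul
      (h.memLp.aestronglyMeasurable.pow 2)) (Eventually.of_forall fun x => ?_)
  simp only [Pi.add_apply]
  rw [Real.norm_of_nonneg (mul_nonneg (le_max_right _ _) (sq_nonneg _)), ← add_mul]
  gcongr
  refine max_le ?_ (add_nonneg (hV0 x) (abs_nonneg _))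
  linarith [neg_abs_le lam]

/-- Completing the square with the Thomas–Fermi identity leaves the linear term lam(v² - ρ), whose
integral vanishes because v² and ρ have the same mass. -/
theorem energy_eq (h : IsCompetitor V m v H) (hV : Continuous V) (hV0 : ∀ x, 0 ≤ V x)
    (hlim : Tendsto V (cocompact (EuclideanSpace ℝ (Fin N))) atTop)
    (hρ : ∫ x, rhoTF V lam x = m) :
    (∫ x, V x * v x ^ 2) + 1 / 2 * ∫ x, v x ^ 4 =
      (∫ x, (V x * rhoTF V lam x + 1 / 2 * rhoTF V lam x ^ 2)) +
      1 / 2 * (∫ x, (v x ^ 2 - rhoTF V lam x) ^ 2) + ∫ x, max (V x - lam) 0 * v x ^ 2 := by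
  have hρc := continuous_rhoTF (lam := lam) hV
  have hρs := hasCompactSupport_rhoTF (lam := lam) hV hlim
  have iρ : Integrable (rhoTF V lam) := hρc.integrable_of_hasCompactSupport hρs
  have iρ2 := integrable_sq_of_hasCompactSupport hρc hρs
  have iVρ : Integrable fun x => V x * rhoTF V lam x :=
    (hV.mul hρc).integrable_of_hasCompactSupport hρs.mul_left
  have j1 : Integrable fun x => V x * rhoTF V lam x + 1 / 2 * rhoTF V lam x ^ 2 :=
    iVρ.add (iρ2.const_mul _)
  have i2 := h.integrable_sq_sub_rhoTF_sq (lam := lam) hV hlim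
  have j2 : Integrable fun x => V x * rhoTF V lam x + 1 / 2 * rhoTF V lam x ^ 2 +
    1 / 2 * (v x ^ 2 - rhoTF V lam x) ^ 2 := j1.add (i2.const_mul _)
  have i3 := h.integrable_excess (lam := lam) hV hV0
  have j3 : Integrable fun x => V x * rhoTF V lam x + 1 / 2 * rhoTF V lam x ^ 2 +
    1 / 2 * (v x ^ 2 - rhoTF V lam x) ^ 2 + max (V x - lam) 0 * v x ^ 2 := j2.add i3
  have i4 : Integrable fun x => v x ^ 2 - rhoTF V lam x := h.memLp.integrable_sq.sub iρ
  have e (x) : V x * v x ^ 2 + 1 / 2 * v x ^ 4 = V x * rhoTF V lam x + 1 / 2 * rhoTF V lam x ^ 2 +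
      1 / 2 * (v x ^ 2 - rhoTF V lam x) ^ 2 + max (V x - lam) 0 * v x ^ 2 +
      lam * (v x ^ 2 - rhoTF V lam x) := by
    obtain ⟨h1, h2⟩ := thomasFermi_identity (V := V) (lam := lam) x
    linear_combination (v x ^ 2 - rhoTF V lam x) * h1 - h2
  rw [← integral_const_mul, ← integral_add h.potential (h.pow_four.const_mul _)]
  simp only [e]
  rw [integral_add j3 (i4.const_mul _), integral_add j2 i3, integral_add j1 (i2.const_mul _),
    integral_const_mul, integral_const_mul, integral_sub h.memLp.integrable_sq iρ, h.mass, hρ]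
  ring

/-- The Thomas–Fermi identity multiplied by v² and integrated. It isolates how far the multiplier of
a minimizer is from lam. -/
theorem multiplier_eq (h : IsCompetitor V m v H) (hV : Continuous V) (hV0 : ∀ x, 0 ≤ V x)
    (hlim : Tendsto V (cocompact (EuclideanSpace ℝ (Fin N))) atTop) :
    (∫ x, V x * v x ^ 2) + ∫ x, v x ^ 4 = lam * m + (∫ x, max (V x - lam) 0 * v x ^ 2) +
      (∫ x, (v x ^ 2 - rhoTF V lam x) ^ 2) +
      ∫ x, (v x ^ 2 - rhoTF V lam x) * rhoTF V lam x := by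
  have hρc := continuous_rhoTF (lam := lam) hV
  have hρs := hasCompactSupport_rhoTF (lam := lam) hV hlim
  have i2 := h.integrable_sq_sub_rhoTF_sq (lam := lam) hV hlim
  have i3 := h.integrable_excess (lam := lam) hV hV0
  have i1 := h.memLp.integrable_sq.const_mul lam
  have i4 : Integrable fun x => (v x ^ 2 - rhoTF V lam x) * rhoTF V lam x :=
    integrable_mul_of_hasCompactSupport (h.memLp.integrable_sq.locallyIntegrable.sub
      hρc.locallyIntegrable) hρc hρs
  have j1 : Integrable fun x => lam * v x ^ 2 + max (V x - lam) 0 * v x ^ 2 := i1.add i3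
  have j2 : Integrable fun x => lam * v x ^ 2 + max (V x - lam) 0 * v x ^ 2 +
    (v x ^ 2 - rhoTF V lam x) ^ 2 := j1.add i2
  have e (x) : V x * v x ^ 2 + v x ^ 4 = lam * v x ^ 2 + max (V x - lam) 0 * v x ^ 2 +
      (v x ^ 2 - rhoTF V lam x) ^ 2 + (v x ^ 2 - rhoTF V lam x) * rhoTF V lam x := by
    obtain ⟨h1, -⟩ := thomasFermi_identity (V := V) (lam := lam) x
    linear_combination (v x ^ 2) * h1
  rw [← integral_add h.potential h.pow_four]
  simp only [e]
  rw [integral_add j2 i4, integral_add j1 i2, integral_add i1 i3, integral_const_mul, h.mass]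

end IsCompetitor

set_option maxHeartbeats 400000 in
/-- Competitors close to the Thomas–Fermi profile. -/
theorem exists_competitor (hV : ContDiff ℝ ∞ V)
    (hlim : Tendsto V (cocompact (EuclideanSpace ℝ (Fin N))) atTop) (hm : 0 < m)
    (hρ : ∫ x, rhoTF V lam x = m) :
    ∃ δ₀ > 0, ∃ C > 0, ∀ δ, 0 < δ → δ ≤ δ₀ → ∃ v H, IsCompetitor V m v H ∧
      ∫ x, ‖H x‖ ^ 2 ≤ C / δ ∧ ∫ x, (v x ^ 2 - rhoTF V lam x) ^ 2 ≤ C * δ ^ 2 ∧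
      ∀ x, max (V x - lam) 0 * v x ^ 2 = 0 := by
  obtain ⟨h, B, hB0, hh, hh0, hhB, hhd⟩ := exists_smooth_sqrt_profile
  set S : Set (EuclideanSpace ℝ (Fin N)) := {x | V x ≤ lam} with hS
  have hSc : IsCompact S := isCompact_sublevel hV.continuous hlim lam
  have hSm : MeasurableSet S := hSc.isClosed.measurableSet
  have hSv : volume S ≠ ⊤ := hSc.measure_lt_top.ne
  obtain ⟨R, hR⟩ := hSc.isBounded.subset_closedBall (0 : EuclideanSpace ℝ (Fin N))
  obtain ⟨G, hG0, hG'⟩ := IsWeakSolution.exists_bound_pd hV 0 R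
  have hG (x) (hx : x ∈ S) (i) : |pd i V x| ≤ G := by
    refine hG' x ?_ i
    have := hR hx
    rwa [mem_closedBall, dist_eq_norm] at this
  obtain ⟨W, hW0, hW'⟩ := IsWeakSolution.exists_bound_of_continuous
    (continuous_rhoTF (lam := lam) hV.continuous) 0 R
  have hW (x) (hx : x ∈ S) : rhoTF V lam x ≤ W := by
    refine (le_abs_self _).trans (hW' x ?_)
    have := hR hx
    rwa [mem_closedBall, dist_eq_norm] at this
  set s : ℝ := volume.real S with hs
  have hs0 : 0 ≤ s := measureReal_nonneg
  have bound {f : EuclideanSpace ℝ (Fin N) → ℝ} {c : ℝ} (hfS : ∀ x ∈ S, f x ≤ c)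
      (hf0 : ∀ x, 0 ≤ f x) (hfn : ∀ x ∉ S, f x = 0) : ∫ x, f x ≤ c * s := by
    have h1 : ∫ x, S.indicator (fun _ => c) x = c * s := by
      rw [integral_indicator hSm, setIntegral_const, smul_eq_mul, mul_comm]
    rw [← h1]
    refine integral_mono_of_nonneg (Eventually.of_forall hf0)
      ((integrable_indicator_iff hSm).2 (integrableOn_const hSv)) (Eventually.of_forall fun x => ?_)
    by_cases hx : x ∈ S
    · simpa [hx] using hfS x hx
    · simp [hx, hfn x hx]
  set E : ℝ := 2 * (B * s) / m * (W + B) + B with hE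
  -- Before normalization the mass is off by at most Bδs. The second entry keeps this below m/2, so
  -- the normalizing factor stays bounded.
  refine ⟨min 1 (m / (2 * (B * s + 1))), by positivity,
    2 * (N * (B ^ 2 * G ^ 2)) * s + E ^ 2 * s + 1, by positivity, fun δ hδ hδle => ?_⟩
  have hδ1 : δ ≤ 1 := hδle.trans (min_le_left _ _)
  have hδm : B * δ * s ≤ m / 2 := by
    have := hδle.trans (min_le_right _ _)
    rw [le_div_iff₀ (by positivity)] at this
    nlinarith
  -- By scaling, w² differs from ρ by O(δ) and |∇w|² ≤ C/δ on S, w vanishing outside S. Integration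
  -- only uses that S has finite measure, so no regularity of its boundary is needed.
  set w : EuclideanSpace ℝ (Fin N) → ℝ := fun x => Real.sqrt δ * h ((lam - V x) / δ) with hw
  have harg : ContDiff ℝ ∞ fun x => (lam - V x) / δ := (contDiff_const.sub hV).div_const δ
  have hws : ContDiff ℝ ∞ w := contDiff_const.mul (hh.comp harg)
  have hwS (x) (hx : x ∉ S) : w x = 0 := by
    have hx' : lam < V x := not_le.1 hx
    have : (lam - V x) / δ ≤ 0 := div_nonpos_of_nonpos_of_nonneg (by linarith) hδ.le
    simp [hw, hh0 _ this]
  have hwc : HasCompactSupport w := HasCompactSupport.intro hSc fun x hx => hwS x hx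
  have hwρ (x) : |w x ^ 2 - rhoTF V lam x| ≤ B * δ := by
    have e : w x ^ 2 - rhoTF V lam x =
        δ * (h ((lam - V x) / δ) ^ 2 - max ((lam - V x) / δ) 0) := by
      have e1 : δ * max ((lam - V x) / δ) 0 = max (lam - V x) 0 := by
        rw [mul_max_of_nonneg _ _ hδ.le, mul_zero, mul_div_cancel₀ _ hδ.ne']
      rw [mul_sub, e1]
      simp only [hw, mul_pow, Real.sq_sqrt hδ.le, rhoTF]
    rw [e, abs_mul, abs_of_pos hδ, mul_comm B]
    gcongr
    exact hhB _
  have hpw (i) (x) : pd i w x = Real.sqrt δ * (deriv h ((lam - V x) / δ) * (-pd i V x / δ)) := by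
    have h1 : HasFDerivAt (fun x => (lam - V x) / δ) (δ⁻¹ • (-fderiv ℝ V x)) x := by
      simpa only [div_eq_inv_mul] using
        ((hV.differentiableAt_top x).hasFDerivAt.const_sub lam).const_mul δ⁻¹
    have h2 : HasFDerivAt w _ x :=
      (((hh.differentiable (by simp)) ((lam - V x) / δ)).hasDerivAt.comp_hasFDerivAt x h1).const_mul
        (Real.sqrt δ)
    rw [pd, h2.fderiv]
    simp [pd, div_eq_inv_mul]
  have hpwS (i) (x) (hx : x ∉ S) : pd i w x = 0 := by
    have hx' : x ∈ Sᶜ := hx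
    have : w =ᶠ[𝓝 x] fun _ => 0 := by
      filter_upwards [hSc.isClosed.isOpen_compl.mem_nhds hx'] with y hy
      exact hwS y hy
    rw [pd, this.fderiv_eq]
    simp
  have hpwB (i) (x) (hx : x ∈ S) : pd i w x ^ 2 ≤ B ^ 2 * G ^ 2 / δ := by
    rw [hpw]
    have e : (Real.sqrt δ * (deriv h ((lam - V x) / δ) * (-pd i V x / δ))) ^ 2 =
        |deriv h ((lam - V x) / δ)| ^ 2 * |pd i V x| ^ 2 / δ := by
      rw [mul_pow, Real.sq_sqrt hδ.le, mul_pow, div_pow, neg_sq, sq_abs, sq_abs]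
      field_simp
    rw [e]
    have h1 := hhd ((lam - V x) / δ)
    have h2 := hG x hx i
    gcongr
  set n : ℝ := ∫ x, w x ^ 2 with hn
  have iw2 := integrable_sq_of_hasCompactSupport hws.continuous hwc
  have iρ : Integrable (rhoTF V lam) := (continuous_rhoTF hV.continuous).integrable_of_hasCompactSupport
    (hasCompactSupport_rhoTF hV.continuous hlim)
  have hnm : |n - m| ≤ B * δ * s := by
    rw [hn, ← hρ, ← integral_sub iw2 iρ]
    refine (abs_integral_le_integral_abs).trans (bound (fun x _ => hwρ x)
      (fun x => abs_nonneg _) fun x hx => ?_)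
    rw [hwS x hx, rhoTF_eq_zero (not_le.1 hx)]
    simp
  have hn2 : m / 2 ≤ n := by linarith [(abs_le.1 hnm).1]
  have hn0 : 0 < n := by linarith
  set c : ℝ := Real.sqrt (m / n) with hc
  have hc2 : c ^ 2 = m / n := Real.sq_sqrt (by positivity)
  have hc2le : c ^ 2 ≤ 2 := by
    rw [hc2, div_le_iff₀ hn0]; linarith
  have hc1 : |c ^ 2 - 1| ≤ 2 * (B * s) / m * δ := by
    have e : c ^ 2 - 1 = -((n - m) / n) := by rw [hc2]; field_simp; ring
    rw [e, abs_neg, abs_div, abs_of_pos hn0, div_le_iff₀ hn0]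
    calc |n - m| ≤ B * δ * s := hnm
      _ = 2 * (B * s) / m * δ * (m / 2) := by field_simp
      _ ≤ 2 * (B * s) / m * δ * n := by gcongr
  set v : EuclideanSpace ℝ (Fin N) → ℝ := fun x => c * w x with hv
  have hvs : ContDiff ℝ ∞ v := contDiff_const.mul hws
  have hvc : HasCompactSupport v := hwc.mul_left
  have hvS (x) (hx : x ∉ S) : v x = 0 := by simp [hv, hwS x hx]
  have hvρ (x) (hx : x ∈ S) : |v x ^ 2 - rhoTF V lam x| ≤ E * δ := by
    have e : v x ^ 2 - rhoTF V lam x = (c ^ 2 - 1) * w x ^ 2 + (w x ^ 2 - rhoTF V lam x) := by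
      simp only [hv]; ring
    have h1 : w x ^ 2 ≤ W + B := by
      have h2 := (abs_le.1 (hwρ x)).2
      have h3 := hW x hx
      nlinarith
    rw [e]
    refine (abs_add_le _ _).trans ?_
    rw [abs_mul, abs_of_nonneg (sq_nonneg (w x))]
    calc |c ^ 2 - 1| * w x ^ 2 + |w x ^ 2 - rhoTF V lam x|
        ≤ 2 * (B * s) / m * δ * (W + B) + B * δ := by
          gcongr
          exact hwρ x
      _ = E * δ := by rw [hE]; ring
  have hpv (i) (x) : pd i v x = c * pd i w x := congrFun (pd_const_mul hws c i) x
  have hv0 : Continuous v := hvs.continuous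
  have i4 : Integrable fun x => v x ^ 4 := by
    have h1 : Continuous fun x => v x ^ 4 := hv0.pow 4
    have h2 : HasCompactSupport fun x => v x ^ 4 :=
      HasCompactSupport.intro hSc fun x hx => by rw [hvS x hx, zero_pow (by norm_num)]
    exact h1.integrable_of_hasCompactSupport h2
  have iV : Integrable fun x => V x * v x ^ 2 := by
    have h1 : Continuous fun x => V x * v x ^ 2 := hV.continuous.mul (hv0.pow 2)
    have h2 : HasCompactSupport fun x => V x * v x ^ 2 :=
      HasCompactSupport.intro hSc fun x hx => by
        rw [hvS x hx, zero_pow (by norm_num), mul_zero]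
    exact h1.integrable_of_hasCompactSupport h2
  refine ⟨v, cgrad v, ⟨hasWeakGradient_cgrad hvs hvc,
    HasCompactSupport.memLp_of_continuous (continuous_cgrad hvs) (hasCompactSupport_cgrad hvc),
    HasCompactSupport.memLp_of_continuous hvs.continuous hvc, iV, i4, ?_⟩, ?_, ?_, ?_⟩
  · simp only [hv, mul_pow]
    rw [integral_const_mul, hc2, ← hn, div_mul_cancel₀ _ hn0.ne']
  · simp only [norm_cgrad_sq]
    have h1 : ∫ x, ∑ i, pd i v x ^ 2 ≤ N * (2 * (B ^ 2 * G ^ 2 / δ)) * s := by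
      refine bound (fun x hx => ?_) (fun x => Finset.sum_nonneg fun i _ => sq_nonneg _) fun x hx => ?_
      · calc ∑ i, pd i v x ^ 2 ≤ ∑ _i : Fin N, 2 * (B ^ 2 * G ^ 2 / δ) := by
              refine Finset.sum_le_sum fun i _ => ?_
              rw [hpv, mul_pow]
              have := hpwB i x hx
              gcongr
          _ = N * (2 * (B ^ 2 * G ^ 2 / δ)) := by simp
      · refine Finset.sum_eq_zero fun i _ => ?_
        rw [hpv, hpwS i x hx]
        ring
    refine h1.trans ?_
    rw [le_div_iff₀ hδ]
    have e : N * (2 * (B ^ 2 * G ^ 2 / δ)) * s * δ = 2 * (N * (B ^ 2 * G ^ 2)) * s := by field_simp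
    rw [e]
    have : 0 ≤ E ^ 2 * s := by positivity
    linarith
  · have h1 : ∫ x, (v x ^ 2 - rhoTF V lam x) ^ 2 ≤ (E * δ) ^ 2 * s := by
      refine bound (fun x hx => ?_) (fun x => sq_nonneg _) fun x hx => ?_
      · have := abs_le.1 (hvρ x hx)
        exact sq_le_sq' this.1 this.2
      · rw [hvS x hx, rhoTF_eq_zero (not_le.1 hx)]
        ring
    refine h1.trans ?_
    have h2 : 0 ≤ 2 * (N * (B ^ 2 * G ^ 2)) * s := by positivity
    rw [mul_pow, mul_right_comm]
    gcongr
    linarith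
  · intro x
    by_cases hx : x ∈ S
    · have hx' : V x ≤ lam := hx
      rw [max_eq_right (by linarith), zero_mul]
    · rw [hvS x hx]
      ring

end thomasFermi

/-! ### Bounds for minimizers uniform in ε. -/

section uniformBounds
variable {N : ℕ} {V : EuclideanSpace ℝ (Fin N) → ℝ} {lam m : ℝ}

namespace IsPositiveMinimizer
variable {ε δ C : ℝ} {η v : EuclideanSpace ℝ (Fin N) → ℝ}
  {G H : EuclideanSpace ℝ (Fin N) → EuclideanSpace ℂ (Fin N)}

/-- Since δ³ = ε², the competitor's gradient term ε²·C/δ equals Cδ², the same order as its potential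
excess. The energy splitting of both functions then leaves all nonnegative excess terms of η at
O(δ²). -/
theorem integral_sq_sub_rhoTF_sq_le (h : IsPositiveMinimizer ε V m η) (hε : 0 < ε)
    (hm : 0 < m) (hV : Continuous V) (hV0 : ∀ x, 0 ≤ V x)
    (hlim : Tendsto V (cocompact (EuclideanSpace ℝ (Fin N))) atTop)
    (hρ : ∫ x, rhoTF V lam x = m) (hη : IsCompetitor V m η G) (hv : IsCompetitor V m v H)
    (hδ : 0 < δ) (hδε : δ ^ 3 = ε ^ 2) (hH : ∫ x, ‖H x‖ ^ 2 ≤ C / δ)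
    (hvρ : ∫ x, (v x ^ 2 - rhoTF V lam x) ^ 2 ≤ C * δ ^ 2)
    (hve : ∀ x, max (V x - lam) 0 * v x ^ 2 = 0) :
    ∫ x, (η x ^ 2 - rhoTF V lam x) ^ 2 ≤ 3 * C * δ ^ 2 ∧
    |(ε ^ 2 * (∫ x, ‖G x‖ ^ 2) + (∫ x, V x * η x ^ 2) + ∫ x, η x ^ 4) / m - lam| ≤
      (3 * C * δ + (3 * C + ∫ x, rhoTF V lam x ^ 2)) / m * δ := by
  have hρc := continuous_rhoTF (lam := lam) hV
  have hρs := hasCompactSupport_rhoTF (lam := lam) hV hlim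
  have hE := h.energy_le hε hV0 hη hv
  have e1 := hη.energy_eq hV hV0 hlim hρ
  have e2 := hv.energy_eq hV hV0 hlim hρ
  have e3 := hη.multiplier_eq (lam := lam) hV hV0 hlim
  simp only [hve, integral_zero] at e2
  set D := ∫ x, ‖G x‖ ^ 2
  set X := ∫ x, (η x ^ 2 - rhoTF V lam x) ^ 2 with hX
  set Y := ∫ x, max (V x - lam) 0 * η x ^ 2
  set Z := ∫ x, (η x ^ 2 - rhoTF V lam x) * rhoTF V lam x with hZ
  set R := ∫ x, rhoTF V lam x ^ 2 with hR
  have hD : 0 ≤ ε ^ 2 * D := mul_nonneg (sq_nonneg _) (integral_nonneg fun x => sq_nonneg _)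
  have hX0 : 0 ≤ X := integral_nonneg fun x => sq_nonneg _
  have hR0 : 0 ≤ R := integral_nonneg fun x => sq_nonneg _
  have hY0 : 0 ≤ Y := integral_nonneg fun x => mul_nonneg (le_max_right _ _) (sq_nonneg _)
  have h1 : ε ^ 2 * ∫ x, ‖H x‖ ^ 2 ≤ C * δ ^ 2 := by
    refine (mul_le_mul_of_nonneg_left hH (sq_nonneg ε)).trans_eq ?_
    rw [← hδε]; field_simp
  have h2 : ε ^ 2 * D + Y + X ≤ 3 * C * δ ^ 2 := by linarith
  -- Young's inequality with weight δ. This term, linear in η² - ρ, is why the multiplier is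
  -- controlled to order δ rather than δ².
  have hZ' : |Z| ≤ X / (2 * δ) + δ * R / 2 := by
    have i1 := (hη.integrable_sq_sub_rhoTF_sq (lam := lam) hV hlim).div_const (2 * δ)
    have i2 := ((integrable_sq_of_hasCompactSupport hρc hρs).const_mul δ).div_const 2
    have e : X / (2 * δ) + δ * R / 2 = ∫ x, ((η x ^ 2 - rhoTF V lam x) ^ 2 / (2 * δ) +
        δ * rhoTF V lam x ^ 2 / 2) := by
      rw [integral_add i1 i2, integral_div, integral_div, integral_const_mul]
    rw [e]
    have e0 : |Z| ≤ ∫ x, |(η x ^ 2 - rhoTF V lam x) * rhoTF V lam x| :=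
      abs_integral_le_integral_abs
    refine e0.trans (integral_mono_of_nonneg
      (Eventually.of_forall fun x => abs_nonneg _) (i1.add i2) (Eventually.of_forall fun x => ?_))
    beta_reduce
    have (a b : ℝ) : |a * b| ≤ a ^ 2 / (2 * δ) + δ * b ^ 2 / 2 := by
      have e : a ^ 2 / (2 * δ) + δ * b ^ 2 / 2 = (a ^ 2 + (δ * b) ^ 2) / (2 * δ) := by field_simp
      rw [e, le_div_iff₀ (by positivity), abs_mul]
      nlinarith [sq_nonneg (|a| - δ * |b|), sq_abs a, sq_abs b]
    exact this _ _
  have hXδ : X / (2 * δ) ≤ 3 * C * δ / 2 := by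
    rw [div_le_iff₀ (by positivity)]
    linarith
  refine ⟨by linarith, ?_⟩
  rw [add_assoc, e3, div_sub' hm.ne', abs_div, abs_of_pos hm, div_mul_eq_mul_div]
  gcongr
  have hC : 0 ≤ C * δ := by
    have : 0 ≤ δ * (C * δ) := by linarith
    exact nonneg_of_mul_nonneg_right this hδ
  rw [abs_le] at hZ' ⊢
  have hRδ : 0 ≤ R * δ := by positivity
  constructor
  · nlinarith
  · nlinarith

end IsPositiveMinimizer

/-- Bounds on the minimizers that are uniform in `ε`, with `δ = ε ^ (2 / 3)`. -/
theorem exists_uniform_bounds (hV : ContDiff ℝ ∞ V) (hV0 : ∀ x, 0 ≤ V x)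
    (hlim : Tendsto V (cocompact (EuclideanSpace ℝ (Fin N))) atTop) (hm : 0 < m)
    (hρ : ∫ x, rhoTF V lam x = m) :
    ∃ δ₀ > 0, ∃ C > 0, ∃ M > 0, ∃ L > 0, ∀ ε δ η, 0 < ε → 0 < δ → δ ^ 3 = ε ^ 2 →
      IsPositiveMinimizer ε V m η → ∃ l G, IsCompetitor V m η G ∧
        IsWeakSolution V (ε ^ 2) l η ∧ (∀ᵐ x, η x ≤ M) ∧ |l| ≤ L * (1 + ε ^ 2) ∧
        (δ ≤ δ₀ → ∫ x, (η x ^ 2 - rhoTF V lam x) ^ 2 ≤ C * δ ^ 2 ∧ |l - lam| ≤ C * δ) := by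
  obtain ⟨δ₀, hδ₀, C, hC, hv⟩ := exists_competitor hV hlim hm hρ
  -- One fixed competitor, used for finiteness of the energy and for every large ε.
  obtain ⟨w, W, hw, -⟩ := hv δ₀ hδ₀ le_rfl
  set R := ∫ x, rhoTF V lam x ^ 2 with hR
  have hR0 : 0 ≤ R := integral_nonneg fun x => sq_nonneg _
  set C₁ := (3 * C * δ₀ + (3 * C + R)) / m with hC₁
  have hC₁0 : 0 < C₁ := by positivity
  set B := |lam| + C₁ * δ₀ with hB
  have hB0 : 0 < B := by positivity
  set D := ∫ x, ‖W x‖ ^ 2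
  set P := (∫ x, V x * w x ^ 2) + 1 / 2 * ∫ x, w x ^ 4 with hP
  have hD0 : 0 ≤ D := integral_nonneg fun x => sq_nonneg _
  have hP0 : 0 ≤ P := add_nonneg (integral_nonneg fun x => mul_nonneg (hV0 x) (sq_nonneg _))
    (mul_nonneg (by norm_num) (integral_nonneg fun x => by positivity))
  set L := 2 * (D + P / δ₀ ^ 3) / m with hL
  have hL0 : 0 ≤ L := by positivity
  set M₁ := Real.exp (L / 2) * ((m + ∫ y : EuclideanSpace ℝ (Fin N), gauss y) /
    ∫ y : EuclideanSpace ℝ (Fin N), gauss y) with hM₁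
  refine ⟨δ₀, hδ₀, 3 * C + C₁, by positivity, B + 1 + |M₁|, by positivity, B + L, by positivity,
    fun ε δ η hε hδ hδε h => ?_⟩
  obtain ⟨G, hη⟩ := h.exists_isCompetitor hε hV0 hw
  have hs := h.isWeakSolution hε hm hV.continuous hV0 hη
  set l := (ε ^ 2 * (∫ x, ‖G x‖ ^ 2) + (∫ x, V x * η x ^ 2) + ∫ x, η x ^ 4) / m with hl
  have hε2 : 0 < ε ^ 2 := by positivity
  refine ⟨l, G, hη, hs, ?_⟩
  rcases le_or_gt δ δ₀ with hle | hgt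
  · obtain ⟨v, H, hvc, hH, hvρ, hve⟩ := hv δ hδ hle
    obtain ⟨h1, h2⟩ := h.integral_sq_sub_rhoTF_sq_le hε hm hV.continuous hV0 hlim hρ hη hvc hδ hδε
      hH hvρ hve
    have h3 : |l - lam| ≤ C₁ * δ := by
      rw [← hR] at h2
      refine h2.trans ?_
      rw [hC₁]
      gcongr
    have h4 : |l| ≤ B := by
      have : |l| ≤ |l - lam| + |lam| := by simpa using abs_add_le (l - lam) lam
      have : C₁ * δ ≤ C₁ * δ₀ := by gcongr
      linarith
    refine ⟨?_, ?_, fun _ => ⟨?_, ?_⟩⟩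
    · filter_upwards [hs.ae_sq_le hε2 hV.continuous hV0] with x hx
      nlinarith [sq_nonneg (η x - 1), le_abs_self l, abs_nonneg M₁]
    · nlinarith
    · nlinarith [sq_nonneg δ]
    · nlinarith
  -- For δ > δ₀, lm is at most twice the scaled energy of η, hence at most 2(ε²D + P), and P ≤
  -- (P/δ₀³)ε². So l/ε² is bounded, which the Gaussian mean value bound requires.
  · have hE := h.energy_le hε hV0 hη hw
    have hδ3 : δ₀ ^ 3 ≤ ε ^ 2 := by rw [← hδε]; gcongr
    have hl0 : 0 ≤ l := div_nonneg (add_nonneg (add_nonneg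
      (mul_nonneg hε2.le (integral_nonneg fun x => sq_nonneg _))
      (integral_nonneg fun x => mul_nonneg (hV0 x) (sq_nonneg _)))
      (integral_nonneg fun x => by positivity)) hm.le
    have hlL : l ≤ L * ε ^ 2 := by
      have a1 : 0 ≤ ε ^ 2 * ∫ x, ‖G x‖ ^ 2 := mul_nonneg hε2.le (integral_nonneg fun x => sq_nonneg _)
      have a2 : 0 ≤ ∫ x, V x * η x ^ 2 := integral_nonneg fun x => mul_nonneg (hV0 x) (sq_nonneg _)
      have a3 : P ≤ P / δ₀ ^ 3 * ε ^ 2 := by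
        rw [div_mul_eq_mul_div, le_div_iff₀ (by positivity)]
        gcongr
      have hE' : ε ^ 2 * (∫ x, ‖G x‖ ^ 2) + (∫ x, V x * η x ^ 2) + 1 / 2 * ∫ x, η x ^ 4 ≤
          ε ^ 2 * D + P := hE.trans_eq (add_assoc _ _ _)
      rw [hl, hL, div_mul_eq_mul_div]
      refine div_le_div_of_nonneg_right ?_ hm.le
      clear_value D P
      linarith
    refine ⟨?_, ?_, fun hle => absurd hle (not_le.2 hgt)⟩
    · filter_upwards [hs.ae_le_of_div_le hε2 hV.continuous hV0 hlL (by simpa using hη.mass)] with x hx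
      exact hx.trans (by linarith [le_abs_self M₁])
    · rw [abs_of_nonneg hl0]
      calc l ≤ L * ε ^ 2 := hlL
        _ ≤ (B + L) * (1 + ε ^ 2) := by gcongr <;> linarith
end uniformBounds

/-! ### Global L² bound and interior bounds. -/

theorem eLpNorm_two_eq_ofReal_sqrt {α : Type*} [MeasurableSpace α] {μ : Measure α} {f : α → ℝ}
    (hf : MemLp f 2 μ) : eLpNorm f 2 μ = ENNReal.ofReal (Real.sqrt (∫ x, f x ^ 2 ∂μ)) := by
  rw [hf.eLpNorm_eq_integral_rpow_norm (by norm_num) (by norm_num), Real.sqrt_eq_rpow]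
  simp

section convergence
variable {N : ℕ} {V : EuclideanSpace ℝ (Fin N) → ℝ} {lam m : ℝ}

theorem exists_eLpNorm_two_bound (hV : ContDiff ℝ ∞ V) (hV0 : ∀ x, 0 ≤ V x)
    (hlim : Tendsto V (cocompact (EuclideanSpace ℝ (Fin N))) atTop) (hm : 0 < m)
    (hρ : ∫ x, rhoTF V lam x = m) :
    ∃ C : ℝ, ∀ ε δ η, 0 < ε → 0 < δ → δ ^ 3 = ε ^ 2 → IsPositiveMinimizer ε V m η →
      eLpNorm (fun x => η x ^ 2 - rhoTF V lam x) 2 volume ≤ ENNReal.ofReal (C * δ) := by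
  obtain ⟨δ₀, hδ₀, C, hC, M, hM, L, hL, H⟩ := exists_uniform_bounds hV hV0 hlim hm hρ
  have hρc := continuous_rhoTF (lam := lam) hV.continuous
  have hρs := hasCompactSupport_rhoTF (lam := lam) hV.continuous hlim
  set A := 2 * M ^ 2 * m + 2 * ∫ x, rhoTF V lam x ^ 2 with hA
  refine ⟨Real.sqrt C + Real.sqrt A / δ₀, fun ε δ η hε hδ hδε h => ?_⟩
  obtain ⟨l, G, hη, hs, hηM, -, hsmall⟩ := H ε δ η hε hδ hδε h
  have hi := hη.integrable_sq_sub_rhoTF_sq (lam := lam) hV.continuous hlim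
  have hL2 : MemLp (fun x => η x ^ 2 - rhoTF V lam x) 2 volume :=
    (memLp_two_iff_integrable_sq ((hη.memLp.aestronglyMeasurable.pow 2).sub
      hρc.aestronglyMeasurable)).2 hi
  rw [eLpNorm_two_eq_ofReal_sqrt hL2]
  refine ENNReal.ofReal_le_ofReal ?_
  rw [add_mul]
  have hAδ : 0 ≤ Real.sqrt A / δ₀ * δ := by positivity
  have hCδ : 0 ≤ Real.sqrt C * δ := by positivity
  rcases le_or_gt δ δ₀ with hle | hgt
  · refine (Real.sqrt_le_sqrt (hsmall hle).1).trans ?_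
    rw [Real.sqrt_mul hC.le, Real.sqrt_sq hδ.le]
    linarith
  -- For large δ a bound independent of δ suffices, since δ/δ₀ > 1.
  · have hle : ∫ x, (η x ^ 2 - rhoTF V lam x) ^ 2 ≤ A := by
      have i1 := hη.memLp.integrable_sq.const_mul (2 * M ^ 2)
      have i2 := (integrable_sq_of_hasCompactSupport hρc hρs).const_mul 2
      rw [hA, ← hη.mass, ← integral_const_mul, ← integral_const_mul, ← integral_add i1 i2]
      refine integral_mono_ae hi (i1.add i2) ?_
      filter_upwards [hηM, hs.pos] with x hx hx0
      have h1 : η x ^ 2 ≤ M ^ 2 := by gcongr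
      nlinarith [sq_nonneg (η x ^ 2 + rhoTF V lam x), sq_nonneg (η x)]
    have h1 : Real.sqrt A ≤ Real.sqrt A / δ₀ * δ := by
      rw [div_mul_eq_mul_div, le_div_iff₀ hδ₀]
      gcongr
    linarith [Real.sqrt_le_sqrt hle]

/-- Compactness gives room around K. One of the three units of b will pay for replacing lam by l,
leaving the gap 2b of the interior estimate. -/
theorem exists_thickening_bound (hV : Continuous V) {K : Set (EuclideanSpace ℝ (Fin N))}
    (hK : IsCompact K) (hKΩ : K ⊆ omegaTF V lam) :
    ∃ R > 0, ∃ b > 0, ∀ x₀ ∈ K, ∀ x, ‖x - x₀‖ ≤ 3 * R → 3 * b ≤ lam - V x := by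
  have hΩ : IsOpen (omegaTF V lam) := isOpen_lt continuous_const (continuous_rhoTF hV)
  obtain ⟨r, hr, hsub⟩ := hK.exists_cthickening_subset_open hΩ hKΩ
  have hpos : ∀ x ∈ cthickening r K, 0 < lam - V x := fun x hx => by
    simpa [omegaTF, rhoTF] using hsub hx
  obtain ⟨c, hc, hcb⟩ := hK.cthickening.exists_forall_le'
    (continuous_const.sub hV).continuousOn hpos
  refine ⟨r / 3, by positivity, c / 3, by positivity, fun x₀ hx₀ x hx => ?_⟩
  have : c ≤ lam - V x := hcb x (mem_cthickening_of_dist_le x x₀ r K hx₀ (by rw [dist_eq_norm]; linarith))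
  linarith

theorem norm_toLp_le {w : Fin N → ℝ} {B : ℝ} (h : ∀ i, |w i| ≤ B) :
    ‖(WithLp.toLp 2 w : EuclideanSpace ℝ (Fin N))‖ ≤ N * B := by
  refine (EuclideanSpace.norm_eq _).trans_le (Real.sqrt_le_iff.2 ?_)
  have hs : ∑ i, ‖w i‖ ^ 2 ≤ (∑ i, ‖w i‖) ^ 2 :=
    Finset.sum_sq_le_sq_sum_of_nonneg fun i _ => norm_nonneg _
  have hB : ∑ i, ‖w i‖ ≤ N * B := by
    refine (Finset.sum_le_sum fun i _ => h i).trans_eq ?_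
    simp
  have h0 : 0 ≤ ∑ i, ‖w i‖ := Finset.sum_nonneg fun i _ => norm_nonneg _
  exact ⟨h0.trans hB, hs.trans (by gcongr)⟩

-- For small δ the interior estimate is applied to the mollifications of η, with constants free of n
-- and ε. For large δ the sup bound and the cruder gradient bound suffice. Both pass to the limit at
-- almost every point of K.
set_option maxHeartbeats 1000000 in
theorem exists_interior_bounds (hV : ContDiff ℝ ∞ V) (hV0 : ∀ x, 0 ≤ V x)
    (hlim : Tendsto V (cocompact (EuclideanSpace ℝ (Fin N))) atTop) (hm : 0 < m)
    (hρ : ∫ x, rhoTF V lam x = m) {K : Set (EuclideanSpace ℝ (Fin N))}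
    (hK : IsCompact K) (hKΩ : K ⊆ omegaTF V lam) :
    ∃ C : ℝ, ∀ ε δ η, 0 < ε → 0 < δ → δ ^ 3 = ε ^ 2 → IsPositiveMinimizer ε V m η →
      ∃ G, HasWeakGradient (fun x => η x ^ 2) G ∧
        ∀ᵐ x, x ∈ K → |η x ^ 2 - rhoTF V lam x| ≤ C * δ ∧ ‖G x‖ ≤ C := by
  obtain ⟨δ₀, hδ₀, C, hC, M, hM, L, hL, H⟩ := exists_uniform_bounds hV hV0 hlim hm hρ
  obtain ⟨R, hR, b, hb, hRb⟩ := exists_thickening_bound hV.continuous hK hKΩ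
  obtain ⟨R₀, hR₀⟩ := hK.isBounded.subset_closedBall (0 : EuclideanSpace ℝ (Fin N))
  have hball {x₀ x : EuclideanSpace ℝ (Fin N)} (hx₀ : x₀ ∈ K) (hx : ‖x - x₀‖ ≤ 3 * R) :
      ‖x - 0‖ ≤ R₀ + 3 * R := by
    have h1 : ‖x₀‖ ≤ R₀ := by simpa using hR₀ hx₀
    have h2 : ‖x‖ ≤ ‖x - x₀‖ + ‖x₀‖ := by simpa using norm_add_le (x - x₀) x₀
    rw [sub_zero]; linarith
  have hself {x₀ : EuclideanSpace ℝ (Fin N)} (hx₀ : x₀ ∈ K) : ‖x₀ - 0‖ ≤ R₀ + 3 * R :=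
    hball hx₀ (by simp [hR.le])
  obtain ⟨S, hS0, hS⟩ := IsWeakSolution.exists_bound_of_continuous hV.continuous 0 (R₀ + 3 * R + 2)
  obtain ⟨S₁, hS₁0, hS₁⟩ := IsWeakSolution.exists_bound_pd hV 0 (R₀ + 3 * R)
  obtain ⟨S₂, hS₂0, hS₂⟩ := IsWeakSolution.exists_bound_of_continuous hV.lap.continuous 0 (R₀ + 3 * R)
  obtain ⟨ε₀, hε₀, C₅, hC₅, hint⟩ := exists_interior_estimate hV hR hb
    (G := S₁ + S₂ + N * S₁) (M := M + (M ^ 2 + S + (|lam| + b))) (by positivity) (by positivity)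
  -- In order: the uniform bounds hold, |l - lam| ≤ b, ε² = δ³ ≤ δ, and then ε² ≤ ε₀².
  set δ₂ := min (min δ₀ (b / C)) (min 1 (ε₀ ^ 2)) with hδ₂
  have hδ₂0 : 0 < δ₂ := by positivity
  -- Dominates the cruder gradient bound when δ > δ₂, where ε² ≥ δ₂³ and |l|/ε² is bounded.
  set C₆ := N * M + ((M ^ 2 + S) / δ₂ ^ 3 + L * (1 / δ₂ ^ 3 + 1)) * M + 1 with hC₆
  have hC₆0 : 0 < C₆ := by positivity
  set B := C₅ + C + (M ^ 2 + S + |lam|) / δ₂ with hB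
  have hB0 : 0 < B := by positivity
  refine ⟨B + N * (2 * (M * (C₅ + C₆))), fun ε δ η hε hδ hδε h => ?_⟩
  obtain ⟨l, F, hη, hs, hηM, hl, hsmall⟩ := H ε δ η hε hδ hδε h
  have hε2 : 0 < ε ^ 2 := by positivity
  set g : Fin N → EuclideanSpace ℝ (Fin N) → ℝ := fun i x => (F x i).re with hg
  have hgl (i) : LocallyIntegrable (g i) volume := fun x => by
    obtain ⟨s, hs, hi⟩ := hη.hasWeakGradient.locallyIntegrable_apply i x
    exact ⟨s, hs, hi.re⟩
  have hgη (φ : EuclideanSpace ℝ (Fin N) → ℝ) (hφ : ContDiff ℝ ∞ φ) (hc : HasCompactSupport φ)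
      (i : Fin N) : ∫ x, η x * pd i φ x = -∫ x, g i x * φ x :=
    hη.hasWeakGradient.integral_re_mul_pd hφ hc i
  refine ⟨_, hs.hasWeakGradient_sq hε2 hV.continuous hηM hgl hgη, ?_⟩
  have hgn : ∀ᵐ x, ∀ i, Tendsto (fun n => pd i (cv (mol N n) η) x) atTop (𝓝 (g i x)) := by
    refine ae_all_iff.2 fun i => ?_
    filter_upwards [ae_tendsto_cv_mol (hgl i)] with x hx
    simpa only [pd_cv_mol_eq hs.locallyIntegrable hgη] using hx
  have hunM := hs.cv_le hηM
  have key : ∀ᵐ x, x ∈ K → |η x ^ 2 - rhoTF V lam x| ≤ B * δ ∧ ∀ i, |g i x| ≤ C₅ + C₆ := by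
    rcases le_or_gt δ δ₂ with hle | hgt
    · have d1 : δ ≤ δ₀ := hle.trans ((min_le_left _ _).trans (min_le_left _ _))
      have d2 : C * δ ≤ b := by
        rw [← le_div_iff₀' hC]
        exact hle.trans ((min_le_left _ _).trans (min_le_right _ _))
      have d3 : δ ≤ 1 := hle.trans ((min_le_right _ _).trans (min_le_left _ _))
      have d4 : δ ≤ ε₀ ^ 2 := hle.trans ((min_le_right _ _).trans (min_le_right _ _))
      have d5 : ε ^ 2 ≤ δ := by rw [← hδε]; exact pow_le_of_le_one hδ.le d3 (by norm_num)
      have d6 : ε ≤ ε₀ := (sq_le_sq₀ hε.le hε₀.le).1 (d5.trans d4)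
      have hll := (hsmall d1).2
      have hlb := abs_le.1 (hll.trans d2)
      have hlabs : |l| ≤ |lam| + b := by
        have : |l| ≤ |l - lam| + |lam| := by simpa using abs_add_le (l - lam) lam
        linarith
      filter_upwards [hs.ae_tendsto, hgn] with x hx hgx hxK
      -- The tolerance κ = ε² is exactly the relative error allowed by the interior estimate.
      have hev := hs.eventually_abs_sub_le hε2 hV hηM 0 (R₀ + 3 * R) hε2
      have hest : ∀ᶠ n in atTop, |cv (mol N n) η x ^ 2 + V x - l| ≤ C₅ * ε ^ 2 ∧
          ∀ i, |pd i (cv (mol N n) η) x| ≤ C₅ := by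
        filter_upwards [hev] with n hn
        refine hint ε hε d6 l _ x (hs.contDiff_cv n) (hs.cv_pos n) fun y hy => ?_
        have hyR := hball hxK hy
        have p1 := hRb x hxK y hy
        have p2 : |V y| ≤ S := hS y (by linarith)
        have p3 : cv (mol N n) η y ^ 2 ≤ M ^ 2 :=
          pow_le_pow_left₀ (hs.cv_pos n y).le (hunM n y) 2
        refine ⟨by linarith, fun i => (hS₁ y hyR i).trans ?_, (hS₂ y hyR).trans ?_,
          (abs_sub_le_of_pd_le hV hS₁ hyR (hself hxK)).trans ?_, (hunM n y).trans ?_, ?_, hn y hyR⟩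
        · have : 0 ≤ N * S₁ := by positivity
          linarith
        · have : 0 ≤ N * S₁ := by positivity
          linarith
        · gcongr
          linarith
        · linarith [abs_nonneg lam, sq_nonneg M]
        · obtain ⟨a1, a2⟩ := abs_le.1 p2
          obtain ⟨a3, a4⟩ := abs_le.1 hlabs
          have a5 := sq_nonneg (cv (mol N n) η y)
          exact abs_le.2 ⟨by linarith, by linarith⟩
      have l1 : |η x ^ 2 + V x - l| ≤ C₅ * ε ^ 2 :=
        le_of_tendsto (((hx.pow 2).add_const _).sub_const _).abs (hest.mono fun n hn => hn.1)
      have hρx : rhoTF V lam x = lam - V x := by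
        have := hRb x hxK x (by simp [hR.le])
        exact max_eq_left (by linarith)
      constructor
      -- The first part is only O(ε²). The rate δ comes from the multiplier.
      · have e : η x ^ 2 - rhoTF V lam x = (η x ^ 2 + V x - l) + (l - lam) := by rw [hρx]; ring
        rw [e]
        have hA : 0 ≤ (M ^ 2 + S + |lam|) / δ₂ * δ := by positivity
        have h5 : C₅ * ε ^ 2 ≤ C₅ * δ := by gcongr
        rw [hB, add_mul, add_mul]
        linarith [abs_add_le (η x ^ 2 + V x - l) (l - lam)]
      · intro i
        have := le_of_tendsto (hgx i).abs (hest.mono fun n hn => hn.2 i)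
        linarith
    · filter_upwards [hηM, hs.pos, hgn] with x hx hx0 hgx hxK
      have hxR := hself hxK
      have p2 : |V x| ≤ S := hS x (by linarith)
      constructor
      · have p3 : η x ^ 2 ≤ M ^ 2 := by gcongr
        have p4 : 0 ≤ rhoTF V lam x := le_max_right _ _
        have p5 : rhoTF V lam x ≤ S + |lam| :=
          max_le (by linarith [le_abs_self lam, neg_abs_le (V x)]) (by positivity)
        have p6 : |η x ^ 2 - rhoTF V lam x| ≤ M ^ 2 + S + |lam| := by
          have a1 := sq_nonneg (η x)
          have a2 := abs_nonneg lam
          have a3 := sq_nonneg M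
          exact abs_le.2 ⟨by linarith, by linarith⟩
        have p7 : M ^ 2 + S + |lam| ≤ (M ^ 2 + S + |lam|) / δ₂ * δ := by
          rw [div_mul_eq_mul_div, le_div_iff₀ hδ₂0]
          gcongr
        have p8 : 0 ≤ (C₅ + C) * δ := by positivity
        rw [hB, add_mul]
        linarith
      · intro i
        have q1 := le_of_tendsto (hgx i).abs (Eventually.of_forall fun n =>
          hs.abs_pd_cv_le hε2 hV.continuous hηM hS n i hxR)
        have q2 : δ₂ ^ 3 ≤ ε ^ 2 := by rw [← hδε]; gcongr
        have q3 : (M ^ 2 + S + |l|) * M / ε ^ 2 ≤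
            ((M ^ 2 + S) / δ₂ ^ 3 + L * (1 / δ₂ ^ 3 + 1)) * M := by
          have r1 : (M ^ 2 + S) / ε ^ 2 ≤ (M ^ 2 + S) / δ₂ ^ 3 := by gcongr
          have r2 : |l| / ε ^ 2 ≤ L * (1 / δ₂ ^ 3 + 1) := by
            calc |l| / ε ^ 2 ≤ L * (1 + ε ^ 2) / ε ^ 2 := by gcongr
              _ = L * (1 / ε ^ 2 + 1) := by field_simp
              _ ≤ L * (1 / δ₂ ^ 3 + 1) := by gcongr
          calc (M ^ 2 + S + |l|) * M / ε ^ 2 = ((M ^ 2 + S) / ε ^ 2 + |l| / ε ^ 2) * M := by ring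
            _ ≤ _ := by gcongr
        linarith
  filter_upwards [key, hηM, hs.pos] with x hx hxM hx0 hxK
  obtain ⟨h1, h2⟩ := hx hxK
  have h3 : 0 ≤ N * (2 * (M * (C₅ + C₆))) := by positivity
  refine ⟨h1.trans (by gcongr; linarith), (norm_toLp_le fun i => ?_).trans (le_add_of_nonneg_left hB0.le)⟩
  rw [abs_mul, abs_mul, abs_of_pos hx0, abs_two]
  gcongr
  exact h2 i

end convergence

end

/-! ### The theorem, with δ = ε^(2/3). -/

theorem proposition7 {N : ℕ} (hN : 1 ≤ N)
    (V : EuclideanSpace ℝ (Fin N) → ℝ) (hV : ContDiff ℝ ∞ V) (hV_nonneg : ∀ x, 0 ≤ V x)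
    (hV_lim : Tendsto V (cocompact (EuclideanSpace ℝ (Fin N))) atTop)
    (m : ℝ) (hm : 0 < m) (lam₀ : ℝ) (hlam₀ : ∫ x, rhoTF V lam₀ x = m) :
    (∃ C : ℝ, ∀ ε : ℝ, 0 < ε → ∀ η : EuclideanSpace ℝ (Fin N) → ℝ,
      IsPositiveMinimizer ε V m η →
        eLpNorm (fun x => η x ^ 2 - rhoTF V lam₀ x) 2 volume
          ≤ ENNReal.ofReal (C * ε ^ (2 / 3 : ℝ))) ∧
    (∀ K : Set (EuclideanSpace ℝ (Fin N)),
      IsCompact (closure K) → closure K ⊆ omegaTF V lam₀ →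
      ∃ C : ℝ, ∀ ε : ℝ, 0 < ε → ∀ η : EuclideanSpace ℝ (Fin N) → ℝ,
        IsPositiveMinimizer ε V m η →
          eLpNorm (fun x => η x ^ 2 - rhoTF V lam₀ x) ∞ (volume.restrict K)
            ≤ ENNReal.ofReal (C * ε ^ (2 / 3 : ℝ)) ∧
          ∃ G : EuclideanSpace ℝ (Fin N) → EuclideanSpace ℝ (Fin N),
            HasWeakGradient (fun x => η x ^ 2) G ∧
            eLpNorm G ∞ (volume.restrict K) ≤ ENNReal.ofReal C) := by
  have hδε (ε : ℝ) (hε : 0 < ε) : (ε ^ (2 / 3 : ℝ)) ^ 3 = ε ^ 2 := by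
    rw [← Real.rpow_natCast, ← Real.rpow_mul hε.le, ← Real.rpow_natCast]
    norm_num
  constructor
  · obtain ⟨C, hC⟩ := exists_eLpNorm_two_bound hV hV_nonneg hV_lim hm hlam₀
    exact ⟨C, fun ε hε η h => hC ε _ η hε (Real.rpow_pos_of_pos hε _) (hδε ε hε) h⟩
  · intro K hK hKΩ
    obtain ⟨C, hC⟩ := exists_interior_bounds hV hV_nonneg hV_lim hm hlam₀ hK hKΩ
    refine ⟨C, fun ε hε η h => ?_⟩
    obtain ⟨G, hG, hb⟩ := hC ε _ η hε (Real.rpow_pos_of_pos hε _) (hδε ε hε) h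
    -- K need not be measurable, so the bound is proved on its closure and restricted by
    -- monotonicity.
    have hb' : ∀ᵐ x ∂volume.restrict K, |η x ^ 2 - rhoTF V lam₀ x| ≤ C * ε ^ (2 / 3 : ℝ) ∧
        ‖G x‖ ≤ C :=
      ae_mono (Measure.restrict_mono subset_closure le_rfl)
        ((ae_restrict_iff' isClosed_closure.measurableSet).2 hb)
    refine ⟨?_, G, hG, ?_⟩
    · rw [eLpNorm_exponent_top]
      exact eLpNormEssSup_le_of_ae_bound (hb'.mono fun x hx => hx.1)
    · rw [eLpNorm_exponent_top]
      exact eLpNormEssSup_le_of_ae_bound (hb'.mono fun x hx => hx.2)
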